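/- Let $k\ge 1$ and $n\ge 0$ be integers, and let $K=\Delta_n^{(k)}$ be the $k$-skeleton of the $n$-simplex $\Delta_n$. Let $M$ be a closed topological $2k$-manifold (for instance a closed PL $2k$-manifold), or $M=\mathbb R^{2k}$. Let $\Omega\colon H_k(M;\mathbb Z_2)\times H_k(M;\mathbb Z_2)\to\mathbb Z_2$ be the intersection form of $M$: for closed $M$ it is the bilinear form with $\Omega(\alpha\frown[M],\beta\frown[M])=\langle\alpha\smile\beta,[M]\rangle$ for all $\alpha,\beta\in H^k(M;\mathbb Z_2)$, and for $M=\mathbb R^{2k}$ it is zero. Let $\tilde K$ be the deleted product of $K$, whose cells are the products $\sigma\times\tau$ of disjoint simplices $\sigma,\tau$ of $K$, let $\bar K=\tilde K/t$ be its quotient by the involution $t$ exchanging the coordinates, and let $\Phi$ be the bijection from the symmetric $2k$-cochains on $\tilde K$ to $C^{2k}(\bar K;\mathbb Z_2)$ given by $\Phi(\xi)((\sigma\times\tau\cup\tau\times\sigma)/t)=\xi(\sigma\times\tau)$. Brackets denote classes in $H^{2k}(\bar K;\mathbb Z_2)=C^{2k}(\bar K;\mathbb Z_2)/B^{2k}(\bar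 K;\mathbb Z_2)$. Let $\bar{\mathbf o}(K)=[\Phi(\vartheta_g)]$ be the van Kampen obstruction modulo 2, where $g\colon|K|\to\mathbb R^{2k}$ is an arbitrary general position PL map and $\vartheta_g(\sigma\times\tau)=|g(\sigma)\cap g(\tau)|\bmod 2$ for disjoint $k$-simplices $\sigma,\tau$. Here a PL map $g$ is in general position if it is injective on the $(k-1)$-skeleton of $K$, only finitely many points have more than one preimage, each of these has exactly two preimages, both outside the $(k-1)$-skeleton, and $g$ is affine on a neighbourhood of each of the two preimages in the $k$-simplex containing it, the two images crossing transversally. For a homomorphism $\psi\colon C_k(K;\mathbb Z_2)\to H_k(M;\mathbb Z_2)$ put $\omega_\psi(\sigma\times\tau)=\Omega(\psi(\sigma),\psi(\tau))$, and suppose that $[\Phi(\omega_\psi)]+\bar{\mathbf o}(K)=0$. Then: (i) If $\kappa,\kappa'$ are disjoint $(k+1)$-simplices of $\Delta_n$, then $\Omega(\psi(\partial\kappa),\psi(\partial\kappa'))=0$. (ii) Let $J$ be an induced subcomplex of $K$ on $2k+3$ vertices. Then for every vertex $v$ of $J$ $$\sum_{\{\sigma,\tau\}\in P_{J,v}}\Omega\bigl(\psi(\partial(\sigma*\{v\})),\psi(\partial(\tau*\{v\}))\bigr)=1,$$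 where $P_{J,v}$ is the set of all unordered pairs $\{\sigma,\tau\}$ of disjoint $k$-simplices of $J$ avoiding $v$, and $\sigma*\{v\}$ is the simplex spanned by $\sigma$ and $v$. -/

import Mathlib

namespace VanKampen

open CategoryTheory Limits Simplicial Topology

universe u

noncomputable section

/-! ## Singular homology with `ℤ/2` coefficients, cup and cap products -/

/-- The coefficient module `ℤ/2`. -/
abbrev Z2 : ModuleCat.{u} (ZMod 2) := ModuleCat.of (ZMod 2) (ULift.{u} (ZMod 2))

/-- The singular simplicial set of a space. -/
abbrev Sing (M : Type u) [TopologicalSpace M] : SSet.{u} := TopCat.toSSet.obj (TopCat.of M)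

/-- The singular chain complex `C_*(M; ℤ/2)`. -/
abbrev singularChains (M : Type u) [TopologicalSpace M] : ChainComplex (ModuleCat.{u} (ZMod 2)) ℕ :=
  ((AlgebraicTopology.singularChainComplexFunctor (ModuleCat.{u} (ZMod 2))).obj Z2).obj
    (TopCat.of M)

/-- The singular homology group `H_k(M; ℤ/2)`. -/
abbrev singularHomology (M : Type u) [TopologicalSpace M] (k : ℕ) : ModuleCat.{u} (ZMod 2) :=
  (singularChains M).homology k

section Products

variable {X : SSet.{u}}

/-- The value of a simplicial cochain on a simplex. -/
def cochainValue {m : ℕ} (α : (X.chainComplex Z2.{u}).X m ⟶ Z2) (s : X _⦋m⦌) : ZMod 2 :=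
  ((X.ιChainComplex s ≫ α).hom ⟨1⟩).down

/-- The inclusion of `[0, …, k]` in `[0, …, 2k]` as the first `k + 1` vertices. -/
def front (k : ℕ) : ⦋k⦌ ⟶ ⦋2 * k⦌ :=
  SimplexCategory.mkHom ⟨fun i => ⟨i.1, by have := i.2; omega⟩, fun _ _ h => h⟩

/-- The inclusion of `[0, …, k]` in `[0, …, 2k]` as the last `k + 1` vertices. -/
def back (k : ℕ) : ⦋k⦌ ⟶ ⦋2 * k⦌ :=
  SimplexCategory.mkHom
    ⟨fun i => ⟨k + i.1, by have := i.2; omega⟩, fun _ _ h => Nat.add_le_add_left h k⟩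

/-- The cup product (Alexander–Whitney) of two cochains of degree `k`. -/
def cup {k : ℕ} (α β : (X.chainComplex Z2.{u}).X k ⟶ Z2) :
    (X.chainComplex Z2.{u}).X (2 * k) ⟶ Z2 :=
  Cofan.IsColimit.desc (X.isColimitChainComplexXCofan Z2 (2 * k)) fun s =>
    (cochainValue α (X.map (front k).op s) * cochainValue β (X.map (back k).op s)) • 𝟙 Z2

/-- The cap product `α ⌢ z` of a cochain of degree `k` with chains `z` of degree `2k`. -/
def cap {k : ℕ} (α : (X.chainComplex Z2.{u}).X k ⟶ Z2) :
    (X.chainComplex Z2.{u}).X (2 * k) ⟶ (X.chainComplex Z2.{u}).X k :=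
  Cofan.IsColimit.desc (X.isColimitChainComplexXCofan Z2 (2 * k)) fun s =>
    cochainValue α (X.map (front k).op s) • X.ιChainComplex (X.map (back k).op s)

/-- Cocycles of degree `k`. -/
def IsCocycle {k : ℕ} (α : (X.chainComplex Z2.{u}).X k ⟶ Z2) : Prop :=
  (X.chainComplex Z2.{u}).d (k + 1) k ≫ α = 0


theorem value_sum {ι : Type*} (t : Finset ι) (f : ι → ((Z2.{u}) ⟶ Z2)) :
    (((∑ i ∈ t, f i).hom ⟨1⟩).down : ZMod 2) = ∑ i ∈ t, ((f i).hom ⟨1⟩).down := by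
  classical
  induction t using Finset.induction_on with
  | empty => simp
  | insert a t ha ih => rw [Finset.sum_insert ha, Finset.sum_insert ha, ← ih]; rfl

theorem value_negOne_pow_smul (m : ℕ) (f : (Z2.{u}) ⟶ Z2) :
    ((((-1 : ℤ) ^ m • f).hom ⟨1⟩).down : ZMod 2) = (f.hom ⟨1⟩).down := by
  rcases neg_one_pow_eq_or ℤ m with h | h
  · rw [h, one_smul]
  · rw [h, neg_smul, one_smul]
    exact ZMod.neg_eq_self_mod_two _

theorem value_ι_d_comp {m : ℕ} (α : (X.chainComplex Z2.{u}).X m ⟶ Z2) (s : X _⦋m + 1⦌) :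
    cochainValue ((X.chainComplex Z2.{u}).d (m + 1) m ≫ α) s =
      ∑ i, cochainValue α (X.δ i s) := by
  unfold cochainValue
  rw [← Category.assoc, SSet.ιChainComplex_d, Preadditive.sum_comp, value_sum]
  refine Finset.sum_congr rfl fun i _ => ?_
  rw [Preadditive.zsmul_comp, value_negOne_pow_smul]

theorem cochain_ext {m : ℕ} {α β : (X.chainComplex Z2.{u}).X m ⟶ Z2}
    (h : ∀ s, cochainValue α s = cochainValue β s) : α = β := by
  refine SSet.chainComplex_hom_ext fun s => ModuleCat.hom_ext (LinearMap.ext fun x => ?_)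
  have hx : x = x.down • (⟨1⟩ : ULift.{u} (ZMod 2)) := ULift.ext _ _ (mul_one _).symm
  rw [hx, map_smul, map_smul]
  exact congrArg _ (ULift.ext _ _ (h s))

theorem cochainValue_desc {m : ℕ} (c : X _⦋m⦌ → ZMod 2) (s : X _⦋m⦌) :
    cochainValue (Cofan.IsColimit.desc (X.isColimitChainComplexXCofan Z2.{u} m)
      fun s => c s • 𝟙 Z2) s = c s := by
  have h := Cofan.IsColimit.fac (X.isColimitChainComplexXCofan Z2.{u} m)
    (fun s => c s • 𝟙 Z2) s
  have h2 := congrArg (fun f => (f.hom (⟨1⟩ : ULift.{u} (ZMod 2))).down) h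
  refine Eq.trans h2 ?_
  change c s * 1 = c s
  rw [mul_one]

theorem cocycle_sum {k : ℕ} {α : (X.chainComplex Z2.{u}).X k ⟶ Z2} (h : IsCocycle α)
    (s : X _⦋k + 1⦌) : ∑ i, cochainValue α (X.δ i s) = 0 := by
  rw [← value_ι_d_comp, h]
  simp [cochainValue]

/-- The value of `a` on the face of `s` spanned by the set of vertices `S`. -/
def faceValue {k m : ℕ} (a : X _⦋k⦌ → ZMod 2) (s : X _⦋m⦌) (S : Finset ℕ) : ZMod 2 :=
  open Classical in
  if h : ∃ φ : Fin (k + 1) ↪o Fin (m + 1), Finset.univ.image (fun i => (φ i : ℕ)) = S then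
    a (X.map (SimplexCategory.mkHom h.choose.toOrderHom).op s)
  else 0

theorem faceValue_eq {k m : ℕ} (a : X _⦋k⦌ → ZMod 2) (s : X _⦋m⦌)
    (φ : ⦋k⦌ ⟶ ⦋m⦌) (hφ : StrictMono φ.toOrderHom) :
    faceValue a s (Finset.univ.image (fun i : Fin (k + 1) => (φ.toOrderHom i : ℕ))) =
      a (X.map φ.op s) := by
  have h : ∃ ψ : Fin (k + 1) ↪o Fin (m + 1), Finset.univ.image (fun i => (ψ i : ℕ)) =
      Finset.univ.image (fun i : Fin (k + 1) => (φ.toOrderHom i : ℕ)) :=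
    ⟨OrderEmbedding.ofStrictMono _ hφ, rfl⟩
  rw [faceValue, dif_pos h]
  have h2 := h.choose_spec
  have : h.choose = OrderEmbedding.ofStrictMono _ hφ := by
    apply OrderEmbedding.range_inj.1
    ext x
    have h3 := congrArg (fun S => (x : ℕ) ∈ S) h2
    simpa [Fin.val_inj] using h3
  have h4 : SimplexCategory.mkHom
      (OrderEmbedding.ofStrictMono (φ.toOrderHom) hφ).toOrderHom = φ :=
    SimplexCategory.Hom.ext _ _ (OrderHom.ext _ _ rfl)
  rw [this, h4]

theorem exists_face {k m : ℕ} {S : Finset ℕ} (h1 : S.card = k + 1) (h2 : S ⊆ Finset.range (m + 1)) :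
    ∃ φ : ⦋k⦌ ⟶ ⦋m⦌, StrictMono φ.toOrderHom ∧
      Finset.univ.image (fun i : Fin (k + 1) => (φ.toOrderHom i : ℕ)) = S := by
  have hlt : ∀ i, S.orderEmbOfFin h1 i < m + 1 := fun i =>
    Finset.mem_range.1 (h2 (Finset.orderEmbOfFin_mem S h1 i))
  refine ⟨SimplexCategory.mkHom ⟨fun i => ⟨S.orderEmbOfFin h1 i, hlt i⟩, ?_⟩, ?_, ?_⟩
  · intro i j hij
    exact (S.orderEmbOfFin h1).monotone hij
  · intro i j hij
    exact (S.orderEmbOfFin h1).strictMono hij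
  · have := Finset.range_orderEmbOfFin S h1
    ext x
    rw [← Finset.mem_coe (s := S), ← this, Finset.mem_image]
    exact ⟨fun ⟨i, _, h⟩ => ⟨i, h⟩, fun ⟨i, h⟩ => ⟨i, Finset.mem_univ _, h⟩⟩

/-- The `i`-th coface map on vertices. -/
def shift (i x : ℕ) : ℕ := if x < i then x else x + 1

theorem faceValue_δ {k m : ℕ} (a : X _⦋k⦌ → ZMod 2) (s : X _⦋m + 1⦌) (i : Fin (m + 2))
    {S : Finset ℕ} (h1 : S.card = k + 1) (h2 : S ⊆ Finset.range (m + 1)) :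
    faceValue a (X.δ i s) S = faceValue a s (S.image (shift i)) := by
  obtain ⟨φ, hφ, rfl⟩ := exists_face h1 h2
  rw [faceValue_eq a _ φ hφ]
  have h3 : StrictMono (φ ≫ SimplexCategory.δ i).toOrderHom :=
    (Fin.strictMono_succAbove i).comp hφ
  have h4 := faceValue_eq a s (φ ≫ SimplexCategory.δ i) h3
  have h5 : Finset.univ.image (fun j : Fin (k + 1) =>
      ((φ ≫ SimplexCategory.δ i).toOrderHom j : ℕ)) =
      (Finset.univ.image (fun j : Fin (k + 1) => (φ.toOrderHom j : ℕ))).image (shift i) := by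
    rw [Finset.image_image]
    congr 1
    funext j
    change ((i.succAbove (φ.toOrderHom j) : Fin (m + 2)) : ℕ) = shift i (φ.toOrderHom j)
    simp only [Fin.succAbove, shift, Fin.lt_def, Fin.val_castSucc]
    split_ifs <;> rfl
  rw [h5] at h4
  rw [h4]
  congr 1
  rw [op_comp, X.map_comp]
  rfl

theorem faceValue_sum {k m : ℕ} {a : X _⦋k⦌ → ZMod 2} (ha : ∀ s, ∑ i, a (X.δ i s) = 0)
    (s : X _⦋m⦌) {T : Finset ℕ} (h1 : T.card = k + 2) (h2 : T ⊆ Finset.range (m + 1)) :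
    ∑ i ∈ T, faceValue a s (T.erase i) = 0 := by
  obtain ⟨φ, hφ, rfl⟩ := exists_face (k := k + 1) h1 h2
  have hinj : Function.Injective (fun i : Fin (k + 1 + 1) => (φ.toOrderHom i : ℕ)) :=
    fun i j hij => hφ.injective (Fin.ext hij)
  rw [Finset.sum_image fun i _ j _ h => hinj h, ← ha (X.map φ.op s)]
  refine Finset.sum_congr rfl fun i _ => ?_
  have h3 : StrictMono (SimplexCategory.δ i ≫ φ).toOrderHom :=
    hφ.comp (Fin.strictMono_succAbove i)
  have h4 := faceValue_eq a s (SimplexCategory.δ i ≫ φ) h3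
  have h5 : X.map (SimplexCategory.δ i ≫ φ).op s = X.δ i (X.map φ.op s) := by
    rw [op_comp, X.map_comp]; rfl
  rw [← h5, ← h4]
  congr 1
  ext x
  simp only [Finset.mem_erase, Finset.mem_image, Finset.mem_univ, true_and]
  constructor
  · rintro ⟨hx, j, rfl⟩
    have hj : j ≠ i := fun h => hx (by rw [h])
    obtain ⟨l, rfl⟩ := Fin.exists_succAbove_eq hj
    exact ⟨l, rfl⟩
  · rintro ⟨l, rfl⟩
    refine ⟨fun h => ?_, i.succAbove l, rfl⟩
    exact Fin.succAbove_ne i l (hinj h)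

open Finset in
theorem cupOne_identity {k : ℕ} (hk : 1 ≤ k) (a b : Finset ℕ → ZMod 2)
    (ha : ∀ T : Finset ℕ, T.card = k + 2 → T ⊆ range (2 * k + 1) → ∑ i ∈ T, a (T.erase i) = 0)
    (hb : ∀ T : Finset ℕ, T.card = k + 2 → T ⊆ range (2 * k + 1) → ∑ i ∈ T, b (T.erase i) = 0) :
    ∑ i ∈ range (2 * k + 1), ∑ j ∈ range k,
        a ((range (j + 1) ∪ Ico (j + k) (2 * k)).image (shift i)) *
          b ((Ico j (j + k + 1)).image (shift i)) =
      a (range (k + 1)) * b (Ico k (2 * k + 1)) + b (range (k + 1)) * a (Ico k (2 * k + 1)) := by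
  have two : ∀ x : ZMod 2, x + x = 0 := by decide
  set I : ℕ → Finset ℕ := fun j => Ico j (j + k + 1) with hI
  set T : ℕ → Finset ℕ := fun j => range (j + 1) ∪ Ico (j + k) (2 * k + 1) with hT
  set U : ℕ → Finset ℕ := fun j => range (j + 1) ∪ Ico (j + k + 1) (2 * k + 1) with hU
  set P : ℕ → ZMod 2 := fun j => ∑ i ∈ range j, a ((T j).erase i) with hP
  set Q : ℕ → ZMod 2 := fun j => ∑ i ∈ Ico (j + k + 1) (2 * k + 1), a ((T j).erase i) with hQ
  have hPQ : ∀ j ≤ k, P j + Q j = a ((T j).erase j) + a (U j) := by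
    intro j hj
    have hdisj : Disjoint (range (j + 1)) (Ico (j + k) (2 * k + 1)) :=
      disjoint_left.2 fun x h1 h2 => by simp at h1 h2; omega
    have hc : (T j).card = k + 2 := by
      simp only [hT]
      rw [card_union_of_disjoint hdisj]; simp; omega
    have h := ha (T j) hc (fun x hx => by simp [hT] at hx ⊢; omega)
    have e : U j = (T j).erase (j + k) := by
      ext x; simp [hU, hT]; omega
    have h' : ∑ i ∈ T j, a ((T j).erase i) =
        (P j + a ((T j).erase j)) + (a ((T j).erase (j + k)) + Q j) := by
      conv_lhs => rw [show T j = range (j + 1) ∪ Ico (j + k) (2 * k + 1) from rfl]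
      rw [sum_union hdisj, sum_range_succ, sum_eq_sum_Ico_succ_bot (by omega)]
    rw [h] at h'
    rw [e]
    linear_combination -h' - two (a ((T j).erase j)) - two (a ((T j).erase (j + k)))
  have hi : ∀ j ∈ range k, ∑ i ∈ range (2 * k + 1),
        a ((range (j + 1) ∪ Ico (j + k) (2 * k)).image (shift i)) *
          b ((Ico j (j + k + 1)).image (shift i)) =
      P (j + 1) * b (I (j + 1)) + a (U j) * (b (I (j + 1)) + b (I j)) + Q j * b (I j) := by
    intro j hj
    have hj := mem_range.1 hj
    rw [range_eq_Ico, ← sum_Ico_consecutive _ (Nat.zero_le (j + 1)) (by omega : j + 1 ≤ 2 * k + 1),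
      ← sum_Ico_consecutive _ (by omega : j + 1 ≤ j + k + 1) (by omega : j + k + 1 ≤ 2 * k + 1),
      ← range_eq_Ico, ← add_assoc]
    congr 1
    · congr 1
      · rw [hP, sum_mul]
        refine sum_congr rfl fun i hi => ?_
        have hi := mem_range.1 hi
        congr 2
        · ext x
          simp only [hT, mem_image, mem_union, mem_range, mem_Ico, mem_erase, shift]
          constructor
          · rintro ⟨y, hy, rfl⟩; split_ifs <;> omega
          · intro hx
            by_cases hxi : x < i
            · exact ⟨x, by omega, by simp [hxi]⟩
            · exact ⟨x - 1, by omega, by split_ifs <;> omega⟩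
        · ext x
          simp only [hI, mem_image, mem_Ico, shift]
          constructor
          · rintro ⟨y, hy, rfl⟩; split_ifs <;> omega
          · intro hx
            exact ⟨x - 1, by omega, by split_ifs <;> omega⟩
      · have h := hb (Ico j (j + k + 2)) (by simp; omega)
          (fun x hx => by simp at hx ⊢; omega)
        rw [sum_Ico_succ_top (by omega), sum_eq_sum_Ico_succ_bot (by omega)] at h
        have e1 : (Ico j (j + k + 2)).erase j = I (j + 1) := by
          ext x; simp [hI]; omega
        have e2 : (Ico j (j + k + 1 + 1)).erase (j + k + 1) = I j := by
          ext x; simp [hI]; omega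
        rw [e1, e2] at h
        have h2 : b (I (j + 1)) + b (I j) =
            ∑ i ∈ Ico (j + 1) (j + k + 1), b ((Ico j (j + k + 2)).erase i) := by
          linear_combination -h + two (b (I (j + 1))) + two (b (I j))
        rw [h2, mul_sum]
        refine sum_congr rfl fun i hi => ?_
        have hi := mem_Ico.1 hi
        congr 2
        · ext x
          simp only [hU, mem_image, mem_union, mem_range, mem_Ico, shift]
          constructor
          · rintro ⟨y, hy, rfl⟩; split_ifs <;> omega
          · intro hx
            by_cases hxi : x < i
            · exact ⟨x, by omega, by simp [hxi]⟩
            · exact ⟨x - 1, by omega, by split_ifs <;> omega⟩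
        · ext x
          simp only [mem_image, mem_Ico, mem_erase, shift]
          constructor
          · rintro ⟨y, hy, rfl⟩; split_ifs <;> omega
          · intro hx
            by_cases hxi : x < i
            · exact ⟨x, by omega, by simp [hxi]⟩
            · exact ⟨x - 1, by omega, by split_ifs <;> omega⟩
    · rw [hQ, sum_mul]
      refine sum_congr rfl fun i hi => ?_
      have hi := mem_Ico.1 hi
      congr 2
      · ext x
        simp only [hT, mem_image, mem_union, mem_range, mem_Ico, mem_erase, shift]
        constructor
        · rintro ⟨y, hy, rfl⟩; split_ifs <;> omega
        · intro hx
          by_cases hxi : x < i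
          · exact ⟨x, by omega, by simp [hxi]⟩
          · exact ⟨x - 1, by omega, by split_ifs <;> omega⟩
      · ext x
        simp only [hI, mem_image, mem_Ico, shift]
        constructor
        · rintro ⟨y, hy, rfl⟩; split_ifs <;> omega
        · intro hx
          exact ⟨x, by omega, by simp; omega⟩
  rw [sum_comm, sum_congr rfl hi, sum_add_distrib, sum_add_distrib]
  have s1 : ∑ j ∈ range k, P (j + 1) * b (I (j + 1)) = ∑ j ∈ range (k + 1), P j * b (I j) := by
    rw [sum_range_succ']; simp [hP]
  have s2 : ∑ j ∈ range k, Q j * b (I j) = ∑ j ∈ range (k + 1), Q j * b (I j) := by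
    rw [sum_range_succ]
    have : Q k = 0 := by simp only [hQ]; rw [Ico_eq_empty (by omega), sum_empty]
    rw [this]; simp
  have s3 : ∑ j ∈ range (k + 1), P j * b (I j) + ∑ j ∈ range (k + 1), Q j * b (I j) =
      ∑ j ∈ range (k + 1), a ((T j).erase j) * b (I j) + ∑ j ∈ range (k + 1), a (U j) * b (I j) := by
    rw [← sum_add_distrib, ← sum_add_distrib]
    refine sum_congr rfl fun j hj => ?_
    rw [← add_mul, hPQ j (by simp at hj; omega), add_mul]
  have s4 : ∑ j ∈ range (k + 1), a ((T j).erase j) * b (I j) =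
      ∑ j ∈ range k, a (U j) * b (I (j + 1)) + a (Ico k (2 * k + 1)) * b (range (k + 1)) := by
    rw [sum_range_succ']
    congr 1
    · refine sum_congr rfl fun j _ => ?_
      congr 2
      ext x; simp [hT, hU]; omega
    · congr 2
      · ext x; simp [hT]; omega
      · ext x; simp [hI]
  have s5 : ∑ j ∈ range (k + 1), a (U j) * b (I j) =
      ∑ j ∈ range k, a (U j) * b (I j) + a (range (k + 1)) * b (Ico k (2 * k + 1)) := by
    rw [sum_range_succ]
    congr 3
    · ext x; simp [hU]; omega
    · simp only [hI]; congr 1; omega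
  simp only [mul_add, sum_add_distrib]
  rw [s1, s2]
  rw [s4, s5] at s3
  linear_combination s3 + two (∑ j ∈ range k, a (U j) * b (I (j + 1))) +
    two (∑ j ∈ range k, a (U j) * b (I j))

theorem image_front (k : ℕ) :
    Finset.univ.image (fun i : Fin (k + 1) => ((front k).toOrderHom i : ℕ)) =
      Finset.range (k + 1) := by
  ext x
  simp only [Finset.mem_image, Finset.mem_univ, true_and, Finset.mem_range]
  exact ⟨fun ⟨i, h⟩ => h ▸ i.2, fun h => ⟨⟨x, h⟩, rfl⟩⟩

theorem image_back (k : ℕ) :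
    Finset.univ.image (fun i : Fin (k + 1) => ((back k).toOrderHom i : ℕ)) =
      Finset.Ico k (2 * k + 1) := by
  ext x
  simp only [Finset.mem_image, Finset.mem_univ, true_and, Finset.mem_Ico]
  constructor
  · rintro ⟨i, rfl⟩
    have := i.2
    change k ≤ k + i.1 ∧ k + i.1 < _
    omega
  · rintro ⟨h1, h2⟩
    refine ⟨⟨x - k, by omega⟩, ?_⟩
    change k + (x - k) = x
    omega

theorem cochainValue_cup {k : ℕ} (α β : (X.chainComplex Z2.{u}).X k ⟶ Z2) (s : X _⦋2 * k⦌) :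
    cochainValue (cup α β) s = faceValue (cochainValue α) s (Finset.range (k + 1)) *
      faceValue (cochainValue β) s (Finset.Ico k (2 * k + 1)) := by
  rw [← image_front, ← image_back, faceValue_eq _ _ (front k) (fun _ _ h => h),
    faceValue_eq _ _ (back k) (fun _ _ h => Nat.add_lt_add_left h k)]
  exact cochainValue_desc (fun s => cochainValue α (X.map (front k).op s) *
    cochainValue β (X.map (back k).op s)) s

/-- The cup product of cocycles is commutative on cycles. -/
theorem cup_comm {k : ℕ} {α β : (X.chainComplex Z2.{u}).X k ⟶ Z2} (hα : IsCocycle α)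
    (hβ : IsCocycle β) (z : (X.chainComplex Z2.{u}).X (2 * k))
    (hz : ∀ m, (X.chainComplex Z2.{u}).d (2 * k) m z = 0) :
    cup α β z = cup β α z := by
  have two : ∀ x : Z2.{u}, x + x = 0 := fun x => by
    refine ULift.ext _ _ ?_
    exact (by decide : ∀ y : ZMod 2, y + y = 0) x.down
  obtain _ | k := k
  · have : cup α β = cup β α := cochain_ext fun s => by
      rw [cochainValue_cup, cochainValue_cup, mul_comm]
      rfl
    rw [this]
  · let h : X _⦋2 * k + 1⦌ → ZMod 2 := fun t => ∑ j ∈ Finset.range (k + 1),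
      faceValue (cochainValue α) t
        (Finset.range (j + 1) ∪ Finset.Ico (j + (k + 1)) (2 * (k + 1))) *
      faceValue (cochainValue β) t (Finset.Ico j (j + (k + 1) + 1))
    let H : (X.chainComplex Z2.{u}).X (2 * k + 1) ⟶ Z2 :=
      Cofan.IsColimit.desc (X.isColimitChainComplexXCofan Z2 (2 * k + 1)) fun s => h s • 𝟙 Z2
    have key : (X.chainComplex Z2.{u}).d (2 * (k + 1)) (2 * k + 1) ≫ H = cup α β + cup β α := by
      refine cochain_ext fun s => ?_
      have e1 : cochainValue (cup α β + cup β α) s =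
          cochainValue (cup α β) s + cochainValue (cup β α) s := by
        unfold cochainValue
        rw [Preadditive.comp_add]
        rfl
      rw [e1, cochainValue_cup, cochainValue_cup,
        ← cupOne_identity (by omega) _ _
          (fun T h1 h2 => faceValue_sum (cocycle_sum hα) s h1 h2)
          (fun T h1 h2 => faceValue_sum (cocycle_sum hβ) s h1 h2)]
      refine (value_ι_d_comp H s).trans ?_
      rw [← Fin.sum_univ_eq_sum_range (fun i => ∑ j ∈ Finset.range (k + 1),
        faceValue (cochainValue α) s ((Finset.range (j + 1) ∪
          Finset.Ico (j + (k + 1)) (2 * (k + 1))).image (shift i)) *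
        faceValue (cochainValue β) s ((Finset.Ico j (j + (k + 1) + 1)).image (shift i)))]
      refine Finset.sum_congr rfl fun i _ => ?_
      refine (cochainValue_desc h _).trans ?_
      refine Finset.sum_congr rfl fun j hj => ?_
      have hj := Finset.mem_range.1 hj
      congr 1
      · refine faceValue_δ (cochainValue α) s i ?_ ?_
        · rw [Finset.card_union_of_disjoint]
          · simp; omega
          · exact Finset.disjoint_left.2 fun x h1 h2 => by simp at h1 h2; omega
        · intro x hx
          simp at hx ⊢; omega
      · refine faceValue_δ (cochainValue β) s i ?_ ?_
        · simp; omega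
        · intro x hx
          simp at hx ⊢; omega
    have h0 : (cup α β + cup β α) z = 0 := by
      rw [← key]
      change H ((X.chainComplex Z2.{u}).d (2 * (k + 1)) (2 * k + 1) z) = 0
      rw [hz, map_zero]
    have h1 : cup α β z + cup β α z = 0 := h0
    calc cup α β z = cup α β z + (cup β α z + cup β α z) := by rw [two, add_zero]
      _ = cup β α z := by rw [← add_assoc, h1, zero_add]

end Products

section IntersectionForm

variable (M : Type u) [TopologicalSpace M]

/-- A cycle `z` of degree `d` is a fundamental cycle modulo 2 of the `d`-manifold `M` if for each
point `x` its class in `H_d(M, M ∖ {x}; ℤ/2) ≅ ℤ/2` is the generator, i.e. is not zero: `z` is not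
the sum of a boundary and of a chain of `M ∖ {x}`. -/
def IsFundamentalCycle {d : ℕ} (z : (singularChains M).cycles d) : Prop :=
  ∀ x : M, ¬ ∃ (c : (singularChains M).X (d + 1)) (e : (singularChains {y : M // y ≠ x}).X d),
    (singularChains M).iCycles d z = (singularChains M).d (d + 1) d c +
      ((((AlgebraicTopology.singularChainComplexFunctor (ModuleCat.{u} (ZMod 2))).obj Z2).map
        (TopCat.ofHom ⟨Subtype.val, continuous_subtype_val⟩ :
          TopCat.of {y : M // y ≠ x} ⟶ TopCat.of M)).f d) e

/-- The property which characterizes the intersection form of a closed `2k`-manifold: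
`Ω(α ⌢ [M], β ⌢ [M]) = ⟨α ⌣ β, [M]⟩` for all cohomology classes `α`, `β` of degree `k`. -/
def IsIntersectionForm (k : ℕ) (Ω : LinearMap.BilinForm (ZMod 2) (singularHomology M k)) : Prop :=
  ∀ z : (singularChains M).cycles (2 * k), IsFundamentalCycle M z →
  ∀ α β : (singularChains M).X k ⟶ Z2,
    IsCocycle (X := Sing M) α → IsCocycle (X := Sing M) β →
  ∀ a b : (singularChains M).cycles k,
    (singularChains M).iCycles k a = cap (X := Sing M) α ((singularChains M).iCycles _ z) →
    (singularChains M).iCycles k b = cap (X := Sing M) β ((singularChains M).iCycles _ z) →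
    Ω ((singularChains M).homologyπ k a) ((singularChains M).homologyπ k b) =
      (cup (X := Sing M) α β ((singularChains M).iCycles _ z)).down

open Classical in
/-- The intersection form `Ω` on `H_k(M; ℤ/2)`. By Poincaré duality every class of a closed
`2k`-manifold is `α ⌢ [M]` for exactly one class `α`, so that there is exactly one bilinear form
with the property above. (For `M = ℝ²ᵏ`, `k ≥ 1`, the group is zero, and so is the form.) -/
def intersectionForm (k : ℕ) : LinearMap.BilinForm (ZMod 2) (singularHomology M k) :=
  if h : ∃! Ω, IsIntersectionForm M k Ω then h.exists.choose else 0

theorem intersectionForm_symm (k : ℕ) (x y : singularHomology M k) :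
    intersectionForm M k x y = intersectionForm M k y x := by
  unfold intersectionForm
  split_ifs with h
  · have h1 := h.exists.choose_spec
    have h2 : IsIntersectionForm M k (LinearMap.BilinForm.flip h.exists.choose) := by
      intro z hz α β hα hβ a b ha hb
      rw [LinearMap.BilinForm.flip_apply, h1 z hz β α hβ hα b a hb ha]
      congr 1
      refine cup_comm (X := Sing M) hβ hα _ fun m => ?_
      have := (singularChains M).iCycles_d (2 * k) m
      exact congrArg (fun f => f.hom z) this
    exact congrArg (fun B => B x y) (h.unique h1 h2)
  · rfl

end IntersectionForm

/-! ## The `k`-skeleton of the `n`-simplex and its deleted product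

The vertices of the `n`-simplex are the elements of `Fin (n + 1)`; its `m`-simplices are the sets of
`m + 1` vertices. The complex `K` is the `k`-skeleton of the `n`-simplex. -/

section Skeleton

variable (n k : ℕ)

/-- The `k`-simplices of the `n`-simplex. -/
abbrev KSimplex : Type := {σ : Finset (Fin (n + 1)) // σ.card = k + 1}

/-- The group `C_k(K; ℤ/2)` of `k`-chains. -/
abbrev KChain : Type := KSimplex n k →₀ ZMod 2

variable {n} in
/-- The boundary of a `(k+1)`-simplex, as a `k`-chain modulo 2: the sum of its facets. -/
def boundary (κ : Finset (Fin (n + 1))) : KChain n k :=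
  ∑ x ∈ κ, if h : (κ.erase x).card = k + 1 then Finsupp.single ⟨κ.erase x, h⟩ 1 else 0

/-- The `m`-dimensional cells `σ × τ` of the deleted product `K̃` of `K`: products of disjoint
simplices of `K`. -/
abbrev Cell (m : ℕ) : Type :=
  {p : Finset (Fin (n + 1)) × Finset (Fin (n + 1)) //
    p.1.Nonempty ∧ p.2.Nonempty ∧ p.1.card ≤ k + 1 ∧ p.2.card ≤ k + 1 ∧ Disjoint p.1 p.2 ∧
      p.1.card + p.2.card = m + 2}

variable {n k}

/-- The involution `t` exchanging the coordinates. -/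
def Cell.swap {m : ℕ} (p : Cell n k m) : Cell n k m :=
  ⟨p.1.swap, p.2.2.1, p.2.1, p.2.2.2.2.1, p.2.2.2.1, p.2.2.2.2.2.1.symm,
    (Nat.add_comm _ _).trans p.2.2.2.2.2.2⟩

theorem Cell.swap_swap {m : ℕ} (p : Cell n k m) : p.swap.swap = p := rfl

/-- The relation `q ∈ {p, t p}`. -/
def cellSetoid (n k m : ℕ) : Setoid (Cell n k m) where
  r p q := q = p ∨ q = p.swap
  iseqv :=
    { refl := fun _ => Or.inl rfl
      symm := by
        rintro p q (rfl | rfl)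
        · exact Or.inl rfl
        · exact Or.inr rfl
      trans := by
        rintro p q r (rfl | rfl) (rfl | rfl)
        · exact Or.inl rfl
        · exact Or.inr rfl
        · exact Or.inr rfl
        · exact Or.inl rfl }

variable (n k) in
/-- The `m`-dimensional cells of the quotient `K̄ = K̃ / t`. -/
abbrev BarCell (m : ℕ) : Type := Quotient (cellSetoid n k m)

variable (n k) in
/-- The group `C^m(K̄; ℤ/2)` of cellular cochains. -/
abbrev BarCochain (m : ℕ) : Type := BarCell n k m → ZMod 2

variable (n k) in
/-- The group of symmetric cochains on `K̃` with values in `ℤ/2`. -/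
def SymCochain (m : ℕ) : Submodule (ZMod 2) (Cell n k m → ZMod 2) where
  carrier := {ξ | ∀ p, ξ p.swap = ξ p}
  add_mem' := fun h1 h2 p => congrArg₂ (· + ·) (h1 p) (h2 p)
  zero_mem' := fun _ => rfl
  smul_mem' := fun c _ h p => congrArg (c * ·) (h p)

variable (n k) in
/-- The bijection `Φ` from the symmetric cochains on `K̃` to the cochains on `K̄`, with
`Φ(ξ)((σ × τ ∪ τ × σ) / t) = ξ(σ × τ)`. -/
def Phi (m : ℕ) : SymCochain n k m ≃ₗ[ZMod 2] BarCochain n k m where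
  toFun ξ := Quotient.lift ξ.1 (by
    rintro p q (rfl | rfl)
    · rfl
    · exact (ξ.2 p).symm)
  map_add' ξ ζ := funext fun c => Quotient.inductionOn c fun _ => rfl
  map_smul' a ξ := funext fun c => Quotient.inductionOn c fun _ => rfl
  invFun c := ⟨fun p => c (Quotient.mk _ p), fun _ => congrArg c (Quotient.sound (Or.inr rfl))⟩
  left_inv _ := rfl
  right_inv c := funext fun x => Quotient.inductionOn x fun _ => rfl

/-- The cell `q` is a facet of the cell `p`: one factor agrees, and the other factor of `q` is a
facet of that of `p`. -/
def Cell.IsFacet {i j : ℕ} (q : Cell n k i) (p : Cell n k j) : Prop :=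
  (q.1.1 ⊆ p.1.1 ∧ q.1.1.card + 1 = p.1.1.card ∧ q.1.2 = p.1.2) ∨
    (q.1.1 = p.1.1 ∧ q.1.2 ⊆ p.1.2 ∧ q.1.2.card + 1 = p.1.2.card)

theorem Cell.isFacet_swap {i j : ℕ} (q : Cell n k i) (p : Cell n k j) :
    q.swap.IsFacet p.swap ↔ q.IsFacet p := by
  simp only [Cell.IsFacet, Cell.swap, Prod.fst_swap, Prod.snd_swap]
  tauto

variable (n k) in
open Classical in
/-- The coboundary `C^i(K̄; ℤ/2) → C^j(K̄; ℤ/2)` (zero unless `j = i + 1`): the value on a cell of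
`K̄`, the image of a cell `p` of `K̃`, is the sum of the values on the images of the facets of `p`. -/
def coboundary (i j : ℕ) : BarCochain n k i →ₗ[ZMod 2] BarCochain n k j where
  toFun c := Quotient.lift
    (fun p : Cell n k j => ∑ q : Cell n k i, if q.IsFacet p then c (Quotient.mk _ q) else 0) (by
      rintro p _ (rfl | rfl)
      · rfl
      · refine Fintype.sum_equiv ⟨Cell.swap, Cell.swap, Cell.swap_swap, Cell.swap_swap⟩ _ _
          fun q => ?_
        change _ = if q.swap.IsFacet p.swap then c (Quotient.mk _ q.swap) else 0
        rw [Cell.isFacet_swap, show (Quotient.mk (cellSetoid n k i) q.swap) = Quotient.mk _ q from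
          Quotient.sound (Or.inr rfl)])
  map_add' c d := funext fun x => Quotient.inductionOn x fun p => by
    simp only [Quotient.lift_mk, Pi.add_apply, ← Finset.sum_add_distrib]
    exact Finset.sum_congr rfl fun q _ => by split_ifs <;> simp
  map_smul' a c := funext fun x => Quotient.inductionOn x fun p => by
    simp only [Quotient.lift_mk, Pi.smul_apply, smul_eq_mul, RingHom.id_apply, Finset.mul_sum]
    exact Finset.sum_congr rfl fun q _ => by split_ifs <;> simp

variable (n k) in
/-- The cohomology group `H^{2k}(K̄; ℤ/2) = C^{2k}(K̄; ℤ/2) / B^{2k}(K̄; ℤ/2)`; there are no cells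
of dimension `2k + 1`, so all `2k`-cochains are cocycles. -/
abbrev TopCohomology : Type :=
  BarCochain n k (2 * k) ⧸ LinearMap.range (coboundary n k (2 * k - 1) (2 * k))

variable (n k) in
/-- The cohomology class of a cochain of degree `2k`. -/
abbrev cohomologyClass : BarCochain n k (2 * k) →ₗ[ZMod 2] TopCohomology n k :=
  Submodule.mkQ _

theorem Cell.card_fst {p : Finset (Fin (n + 1)) × Finset (Fin (n + 1))}
    (hp : p.1.Nonempty ∧ p.2.Nonempty ∧ p.1.card ≤ k + 1 ∧ p.2.card ≤ k + 1 ∧ Disjoint p.1 p.2 ∧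
      p.1.card + p.2.card = 2 * k + 2) : p.1.card = k + 1 := by
  omega

/-- The first factor of a cell of dimension `2k`. -/
def Cell.fst (p : Cell n k (2 * k)) : KSimplex n k := ⟨p.1.1, Cell.card_fst p.2⟩

/-- The second factor of a cell of dimension `2k`. -/
def Cell.snd (p : Cell n k (2 * k)) : KSimplex n k := p.swap.fst

/-- The symmetric cochain `ω_ψ(σ × τ) = Ω(ψ(σ), ψ(τ))`. -/
def omegaCochain {M : Type u} [TopologicalSpace M]
    (ψ : KChain n k →ₗ[ZMod 2] singularHomology M k) : SymCochain n k (2 * k) :=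
  ⟨fun p => intersectionForm M k (ψ (Finsupp.single p.fst 1)) (ψ (Finsupp.single p.snd 1)),
    fun _ => intersectionForm_symm M k _ _⟩

/-! ## General position maps and the van Kampen obstruction -/

/-- The geometric simplex spanned by a set of vertices of the standard `n`-simplex. -/
def geomSimplex (σ : Finset (Fin (n + 1))) : Set (Fin (n + 1) → ℝ) :=
  {x | x ∈ stdSimplex ℝ (Fin (n + 1)) ∧ ∀ i ∉ σ, x i = 0}

variable (n) in
/-- The polyhedron of the complex of all simplices with at most `c` vertices; thus `|K|` is
`skeleton n (k + 1)`, and the polyhedron of the `(k-1)`-skeleton is `skeleton n k`. -/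
def skeleton (c : ℕ) : Set (Fin (n + 1) → ℝ) :=
  {x | ∃ σ : Finset (Fin (n + 1)), σ.card ≤ c ∧ x ∈ geomSimplex σ}

/-- `g` is piecewise linear on the polyhedron `|K|`: it is affine on each simplex of some finite
subdivision of `K`. -/
def IsPL (k : ℕ) {F : Type*} [AddCommGroup F] [Module ℝ F] (g : (Fin (n + 1) → ℝ) → F) : Prop :=
  ∃ T : Geometry.SimplicialComplex ℝ (Fin (n + 1) → ℝ),
    T.faces.Finite ∧ T.space = skeleton n (k + 1) ∧
    (∀ s ∈ T.faces, ∃ σ : Finset (Fin (n + 1)), σ.card ≤ k + 1 ∧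
      convexHull ℝ (s : Set (Fin (n + 1) → ℝ)) ⊆ geomSimplex σ) ∧
    ∀ s ∈ T.faces, ∃ A : (Fin (n + 1) → ℝ) →ᵃ[ℝ] F,
      Set.EqOn g A (convexHull ℝ (s : Set (Fin (n + 1) → ℝ)))

/-- The images under `g` of the `k`-simplices `σ` and `τ` cross transversally at the image of the
points `y` of `σ` and `y'` of `τ`: near these points, `g` is affine on `σ` and on `τ`, and
the directions of the two images span the whole space. -/
def IsTransverseAt {F : Type*} [AddCommGroup F] [Module ℝ F] (g : (Fin (n + 1) → ℝ) → F)
    (σ τ : KSimplex n k) (y y' : Fin (n + 1) → ℝ) : Prop :=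
  ∃ A B : (Fin (n + 1) → ℝ) →ᵃ[ℝ] F,
    (∀ᶠ x in 𝓝[geomSimplex σ.1] y, g x = A x) ∧ (∀ᶠ x in 𝓝[geomSimplex τ.1] y', g x = B x) ∧
    (vectorSpan ℝ (geomSimplex σ.1)).map A.linear ⊔ (vectorSpan ℝ (geomSimplex τ.1)).map B.linear =
      ⊤

variable (n k) in
/-- General position maps `|K| → ℝ²ᵏ`: piecewise linear, injective on the `(k-1)`-skeleton, with
finitely many multiple points, which are transversal double points with both preimages outside the
`(k-1)`-skeleton. Only the values of `g` on `|K|` matter. -/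
structure IsGeneralPosition (g : (Fin (n + 1) → ℝ) → EuclideanSpace ℝ (Fin (2 * k))) : Prop where
  isPL : IsPL k g
  injOn : Set.InjOn g (skeleton n k)
  finite : {x | ∃ y ∈ skeleton n (k + 1), ∃ y' ∈ skeleton n (k + 1),
    y ≠ y' ∧ g y = x ∧ g y' = x}.Finite
  double : ∀ y ∈ skeleton n (k + 1), ∀ y' ∈ skeleton n (k + 1), y ≠ y' → g y = g y' →
    y ∉ skeleton n k ∧ y' ∉ skeleton n k ∧
      ∀ y'' ∈ skeleton n (k + 1), g y'' = g y → y'' = y ∨ y'' = y'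
  transverse : ∀ σ τ : KSimplex n k, ∀ y ∈ geomSimplex σ.1, ∀ y' ∈ geomSimplex τ.1,
    y ≠ y' → g y = g y' → IsTransverseAt g σ τ y y'

/-- The intersection cochain `ϑ_g(σ × τ)`, for a general position map `g`: the number modulo 2
of the intersection points of `g(σ)` and `g(τ)`. -/
def thetaCochain (g : (Fin (n + 1) → ℝ) → EuclideanSpace ℝ (Fin (2 * k))) :
    SymCochain n k (2 * k) :=
  ⟨fun p => ((g '' geomSimplex p.fst.1 ∩ g '' geomSimplex p.snd.1).ncard : ZMod 2), fun p => by
    change ((g '' geomSimplex p.snd.1 ∩ g '' geomSimplex p.fst.1).ncard : ZMod 2) = _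
    rw [Set.inter_comm]⟩

/-- The value `Ω(ψ(∂(σ * v)), ψ(∂(τ * v)))` as a function of the unordered pair `{σ, τ}`. -/
def pairValue {M : Type u} [TopologicalSpace M]
    (ψ : KChain n k →ₗ[ZMod 2] singularHomology M k) (v : Fin (n + 1)) :
    Sym2 (KSimplex n k) → ZMod 2 :=
  Sym2.lift ⟨fun σ τ => intersectionForm M k
    (ψ (boundary k (insert v σ.1))) (ψ (boundary k (insert v τ.1))),
    fun _ _ => intersectionForm_symm M k _ _⟩

open Classical in
/-- The set `P_{J,v}` of the unordered pairs of disjoint `k`-simplices of `J` which avoid `v`, where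
`J` is the subcomplex induced by the set of vertices `V`. -/
def pairs (k : ℕ) (V : Finset (Fin (n + 1))) (v : Fin (n + 1)) : Finset (Sym2 (KSimplex n k)) :=
  Finset.univ.filter fun p => ∃ σ τ : KSimplex n k, p = s(σ, τ) ∧ Disjoint σ.1 τ.1 ∧
    σ.1 ⊆ V ∧ τ.1 ⊆ V ∧ v ∉ σ.1 ∧ v ∉ τ.1

end Skeleton

end
end VanKampen

open VanKampen

/-!
Let `c` be a cochain with coboundary `Φ(ω_ψ) + Φ(ϑ_g)`. Both conclusions are obtained by evaluating
this identity on cycles modulo 2: the coboundary contributes `0`, so the sum of the values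
`Ω(ψ σ, ψ τ)` over the cells `σ × τ` of the cycle is the parity of the total number of intersection
points of `g(σ)` and `g(τ)`.

* For the first conclusion the cycle is `∂κ × ∂κ'`, for which the number of intersection points is
  even (`sum_ncard_boundary`). By bilinearity, the values of `Ω` add up to `Ω(ψ(∂κ), ψ(∂κ'))`.
* For the second conclusion the cycle of `K̄` consists of all pairs of disjoint `k`-simplices on the
  `2k + 3` vertices of `J`, with one of `σ × τ`, `τ × σ` taken for each pair (`halfCells`). Here the
  number of intersection points is odd (`sum_ncard_halfCells`); this is the theorem of van Kampen
  and Flores. When the forms `Ω(ψ(∂(σ * v)), ψ(∂(τ * v)))` are expanded, the terms in which both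
  facets contain `v` cancel in pairs, and every cell of the cycle occurs exactly once among the
  other terms (`sum_boundary_cone`).

Both parities are degrees modulo 2 of an odd map, `joinMap g`, from the deleted join of `K`,
realized in the boundary of the cross-polytope, to `ℝ²ᵏ × ℝ`. A point with positive part `x` and
negative part `y` is sent to the difference of the homogeneous extensions of `g` at `x` and `y`,
together with the difference of their masses. The zeros are the intersection points of the images
of disjoint simplices, and general position makes them nondegenerate.

The degree is defined by counting. A chain is a formal sum modulo 2 of lists of points, and is
subdivided barycentrically; for a map `G`, one counts the simplices of the subdivision whose images
under `G` span a simplex containing a given small generic vector `v`. For a boundary the count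
vanishes (`ae_count_bd`), and for a simplex on which `G` has finitely many nondegenerate zeros it is
the number of zeros (`eventually_count_push_sd_pow`).

The deleted join of the `k`-skeleton of a `(2k+2)`-simplex is a sphere with the antipodal action,
and two odd maps `G`, `G'` without zeros on its `2k`-skeleton have the same degree on a hemisphere
(`eventually_count_push_eq_of_odd`). Indeed, the boundary of the hemisphere is `c₁ + t c₁`, so that
the degrees differ by the number of times that the homotopy `y` on `c₁` covers `v` or `-v`, that is,
by the number of times that the segment from `v` to `-v` crosses `∂ y`. Now `∂ c₁ = c₀ + t c₀` as
well, so apart from parts which avoid the origin, `∂ y` is invariant under the antipodal map of the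
target, and the crossings occur in pairs. For this the homotopy has to be generic, so both maps are
compared to a third one, with generic values at the vertices (`exists_generic_odd`). The degree is
computed from a linear map `G'` with exactly one pair of antipodal zeros
(`exists_linearMap_joinTarget`).
-/

namespace ListChain

open Finsupp MeasureTheory Module Filter Topology

/-! ### Chains of lists -/

section Chains

variable {X Y : Type*}

/-- Chains modulo 2 whose simplices are arbitrary finite sequences of vertices, of all lengths at
once; the empty sequence is the augmentation. -/
abbrev Chain (X : Type*) : Type _ := List X →₀ ZMod 2

theorem supported_induction {s : Set (List X)} {p : Chain X → Prop} (h0 : p 0)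
    (hadd : ∀ c c', p c → p c' → p (c + c')) (hs : ∀ l ∈ s, p (single l 1)) {c : Chain X}
    (hc : c ∈ supported (ZMod 2) (ZMod 2) s) : p c := by
  rw [supported_eq_span_single] at hc
  induction hc using Submodule.span_induction with
  | mem x hx => obtain ⟨l, hl, rfl⟩ := hx; exact hs l hl
  | zero => exact h0
  | add x y _ _ hx hy => exact hadd x y hx hy
  | smul r x _ hx =>
    have : r = 0 ∨ r = 1 := (by decide : ∀ r : ZMod 2, r = 0 ∨ r = 1) r
    rcases this with rfl | rfl
    · rwa [zero_smul]
    · rwa [one_smul]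

theorem linearMap_mem_of_single {s : Set (List X)} {A : Type*} [AddCommGroup A]
    [Module (ZMod 2) A] {f : Chain X →ₗ[ZMod 2] A} {U : Submodule (ZMod 2) A}
    (h : ∀ l ∈ s, f (single l 1) ∈ U) {c : Chain X}
    (hc : c ∈ supported (ZMod 2) (ZMod 2) s) : f c ∈ U := by
  rw [supported_eq_span_single] at hc
  have : Submodule.span (ZMod 2) ((fun l => single l (1 : ZMod 2)) '' s) ≤ U.comap f := by
    rw [Submodule.span_le]
    rintro _ ⟨l, hl, rfl⟩
    exact h l hl
  exact this hc

/-- The cone with apex `a`. -/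
noncomputable def cone (a : X) : Chain X →ₗ[ZMod 2] Chain X :=
  lmapDomain (ZMod 2) (ZMod 2) (List.cons a)

@[simp] theorem cone_single (a : X) (l : List X) (r : ZMod 2) :
    cone a (single l r) = single (a :: l) r := by simp [cone]

/-- The boundary of a sequence of vertices: the sum of the sequences with one entry removed. -/
noncomputable def bdList : List X → Chain X
  | [] => 0
  | a :: l => single l 1 + cone a (bdList l)

/-- The (augmented) boundary operator. -/
noncomputable def bd : Chain X →ₗ[ZMod 2] Chain X := linearCombination (ZMod 2) bdList

@[simp] theorem bd_single (l : List X) : bd (single l 1) = bdList l := by simp [bd]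

theorem bd_cone (a : X) (c : Chain X) : bd (cone a c) = c + cone a (bd c) := by
  induction c using Finsupp.induction_linear with
  | zero => simp
  | add x y hx hy => rw [map_add, map_add, hx, hy, map_add, map_add]; abel
  | single l r => simp [bd, bdList]

theorem bd_bdList (l : List X) : bd (bdList l) = 0 := by
  induction l with
  | nil => simp [bdList]
  | cons a l ih =>
    rw [bdList, map_add, bd_cone, ih, map_zero, add_zero, bd_single, ZModModule.add_self]

theorem bd_bd (c : Chain X) : bd (bd c) = 0 := by
  induction c using Finsupp.induction_linear with
  | zero => simp
  | add x y hx hy => rw [map_add, map_add, hx, hy, add_zero]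
  | single l r =>
    rw [← mul_one r, ← smul_eq_mul, ← smul_single, map_smul, map_smul, bd_single, bd_bdList,
      smul_zero]

/-- The chain map induced by a map of vertices. -/
noncomputable def push (f : X → Y) : Chain X →ₗ[ZMod 2] Chain Y :=
  lmapDomain (ZMod 2) (ZMod 2) (List.map f)

@[simp] theorem push_single (f : X → Y) (l : List X) (r : ZMod 2) :
    push f (single l r) = single (l.map f) r := by simp [push]

theorem push_cone (f : X → Y) (a : X) (c : Chain X) :
    push f (cone a c) = cone (f a) (push f c) := by
  induction c using Finsupp.induction_linear with
  | zero => simp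
  | add x y hx hy => simp only [map_add, hx, hy]
  | single l r => simp

theorem push_bdList (f : X → Y) (l : List X) : push f (bdList l) = bdList (l.map f) := by
  induction l with
  | nil => simp [bdList]
  | cons a l ih => rw [bdList, map_add, push_cone, ih, push_single, List.map_cons, bdList]

theorem bd_push (f : X → Y) (c : Chain X) : bd (push f c) = push f (bd c) := by
  induction c using Finsupp.induction_linear with
  | zero => simp
  | add x y hx hy => simp only [map_add, hx, hy]
  | single l r =>
    rw [← mul_one r, ← smul_eq_mul, ← smul_single, map_smul, map_smul, map_smul, map_smul,
      push_single, bd_single, bd_single, push_bdList]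

/-- The prism on a simplex, for two maps of vertices `f` and `g`. -/
noncomputable def prismList (f g : X → Y) : List X → Chain Y
  | [] => 0
  | a :: l => single (f a :: g a :: l.map g) 1 + cone (f a) (prismList f g l)

/-- The prism operator, a chain homotopy between `push f` and `push g`. -/
noncomputable def prism (f g : X → Y) : Chain X →ₗ[ZMod 2] Chain Y :=
  linearCombination (ZMod 2) (prismList f g)

@[simp] theorem prism_single (f g : X → Y) (l : List X) :
    prism f g (single l 1) = prismList f g l := by simp [prism]

theorem prism_cone (f g : X → Y) (a : X) (c : Chain X) :
    prism f g (cone a c) = cone (f a) (cone (g a) (push g c)) + cone (f a) (prism f g c) := by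
  induction c using Finsupp.induction_linear with
  | zero => simp
  | add x y hx hy => rw [map_add, map_add, hx, hy]; simp only [map_add]; abel
  | single l r => simp [prism, prismList]

theorem bd_prism (f g : X → Y) (c : Chain X) :
    bd (prism f g c) = push f c + push g c + prism f g (bd c) := by
  have key : ∀ l : List X, bd (prismList f g l) =
      push f (single l 1) + push g (single l 1) + prism f g (bdList l) := by
    intro l
    induction l with
    | nil => simp [prismList, bdList, ZModModule.add_self]
    | cons a l ih =>
      have two := fun x : Chain Y => ZModModule.add_self x
      have h1 : bdList (l.map g) = push g (bdList l) := (push_bdList g l).symm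
      have h2 := congrArg (cone (f a)) ih
      simp only [map_add, push_single, cone_single] at h2
      simp only [prismList, bdList, map_add, bd_cone, bd_single, prism_cone, prism_single,
        push_single, h1, h2, cone_single, List.map_cons]
      linear_combination (norm := module) (1 : ZMod 2) • two (single (f a :: l.map g) 1)
  induction c using Finsupp.induction_linear with
  | zero => simp
  | add x y hx hy => simp only [map_add, hx, hy]; abel
  | single l r =>
    rw [← mul_one r, ← smul_eq_mul, ← smul_single]
    simp only [map_smul, ← smul_add]
    rw [prism_single, bd_single, key]

theorem prism_push {Z : Type*} (f g : Y → Z) (h : X → Y) (c : Chain X) :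
    prism f g (push h c) = prism (f ∘ h) (g ∘ h) c := by
  have key : ∀ l : List X, prismList f g (l.map h) = prismList (f ∘ h) (g ∘ h) l := by
    intro l
    induction l with
    | nil => rfl
    | cons a l ih => simp [prismList, ih]
  induction c using Finsupp.induction_linear with
  | zero => simp
  | add x y hx hy => simp only [map_add, hx, hy]
  | single l r => simp [prism, key]

theorem push_prism {Z : Type*} (f g : X → Y) (h : Y → Z) (c : Chain X) :
    push h (prism f g c) = prism (h ∘ f) (h ∘ g) c := by
  have key : ∀ l : List X, push h (prismList f g l) = prismList (h ∘ f) (h ∘ g) l := by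
    intro l
    induction l with
    | nil => simp [prismList]
    | cons a l ih => simp [prismList, ih, push_cone]
  induction c using Finsupp.induction_linear with
  | zero => simp
  | add x y hx hy => simp only [map_add, hx, hy]
  | single l r => simp [prism, key]

/-! ### Supports -/

/-- The chains all of whose simplices belong to `s`. -/
abbrev supp (s : Set (List X)) : Submodule (ZMod 2) (Chain X) := supported (ZMod 2) (ZMod 2) s

theorem single_mem_supp {s : Set (List X)} {l : List X} (h : l ∈ s) :
    single l (1 : ZMod 2) ∈ supp s := single_mem_supported _ _ h

theorem cone_mem {s t : Set (List X)} {a : X} (h : ∀ l ∈ s, a :: l ∈ t) {c : Chain X}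
    (hc : c ∈ supp s) : cone a c ∈ supp t :=
  linearMap_mem_of_single (fun l hl => by rw [cone_single]; exact single_mem_supp (h l hl)) hc

theorem bdList_mem (l : List X) :
    bdList l ∈ supp {l' | l'.length + 1 = l.length ∧ l'.Sublist l} := by
  induction l with
  | nil => exact Submodule.zero_mem _
  | cons a l ih =>
    refine Submodule.add_mem _ (single_mem_supp ?_) (cone_mem (fun l' h => ?_) ih)
    · exact ⟨rfl, List.sublist_cons_self _ _⟩
    · exact ⟨by simp [← h.1], h.2.cons_cons _⟩

theorem bd_mem {s t : Set (List X)}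
    (h : ∀ l ∈ s, ∀ l', l'.length + 1 = l.length → l'.Sublist l → l' ∈ t) {c : Chain X}
    (hc : c ∈ supp s) : bd c ∈ supp t :=
  linearMap_mem_of_single (fun l hl => by
    rw [bd_single]
    exact supported_mono (fun l' h' => h l hl l' h'.1 h'.2) (bdList_mem l)) hc

theorem push_mem {f : X → Y} {s : Set (List X)} {t : Set (List Y)} (h : ∀ l ∈ s, l.map f ∈ t)
    {c : Chain X} (hc : c ∈ supp s) : push f c ∈ supp t :=
  linearMap_mem_of_single (fun l hl => by rw [push_single]; exact single_mem_supp (h l hl)) hc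

theorem prismList_mem (f g : X → Y) (l : List X) :
    prismList f g l ∈
      supp {l' | l'.length = l.length + 1 ∧ ∀ y ∈ l', ∃ x ∈ l, y = f x ∨ y = g x} := by
  induction l with
  | nil => exact Submodule.zero_mem _
  | cons a l ih =>
    refine Submodule.add_mem _ (single_mem_supp ?_) (cone_mem (fun l' h => ?_) ih)
    · refine ⟨by simp, fun y hy => ?_⟩
      simp only [List.mem_cons, List.mem_map] at hy ⊢
      rcases hy with rfl | rfl | ⟨x, hx, rfl⟩
      · exact ⟨a, Or.inl rfl, Or.inl rfl⟩
      · exact ⟨a, Or.inl rfl, Or.inr rfl⟩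
      · exact ⟨x, Or.inr hx, Or.inr rfl⟩
    · refine ⟨by simp [h.1], fun y hy => ?_⟩
      rcases List.mem_cons.1 hy with rfl | hy
      · exact ⟨a, List.mem_cons_self, Or.inl rfl⟩
      · obtain ⟨x, hx, h'⟩ := h.2 y hy
        exact ⟨x, List.mem_cons_of_mem _ hx, h'⟩

theorem prism_mem {f g : X → Y} {s : Set (List X)} {t : Set (List Y)}
    (h : ∀ l ∈ s, ∀ l' : List Y, l'.length = l.length + 1 →
      (∀ y ∈ l', ∃ x ∈ l, y = f x ∨ y = g x) → l' ∈ t)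
    {c : Chain X} (hc : c ∈ supp s) : prism f g c ∈ supp t :=
  linearMap_mem_of_single (fun l hl => by
    rw [prism_single]
    exact supported_mono (fun l' h' => h l hl l' h'.1 h'.2) (prismList_mem f g l)) hc

theorem bdList_eq_sum (l : List X) :
    bdList l = ∑ i : Fin l.length, single (l.eraseIdx i) 1 := by
  induction l with
  | nil => simp [bdList]
  | cons a l ih =>
    rw [bdList, ih]
    simp only [List.length_cons]
    rw [Fin.sum_univ_succ]
    simp

end Chains

/-! ### Barycentric subdivision -/

theorem bdList_mem_length {X : Type*} {m : ℕ} {l : List X} (h : l.length = m + 1) :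
    bdList l ∈ supp {l : List X | l.length = m} :=
  supported_mono (fun l' h' => by have := h'.1; rw [h] at this; exact Nat.succ.inj this)
    (bdList_mem l)

theorem bd_mem_length {X : Type*} {m : ℕ} {c : Chain X}
    (h : c ∈ supp {l : List X | l.length = m + 1}) :
    bd c ∈ supp {l : List X | l.length = m} :=
  bd_mem (fun l hl l' h1 _ => by rw [hl] at h1; exact Nat.succ.inj h1) h

section Subdivision

variable {E F : Type*} [AddCommGroup E] [Module ℝ E] [AddCommGroup F] [Module ℝ F]

/-- The barycenter of a sequence of points. -/
noncomputable def bary (l : List E) : E := (l.length : ℝ)⁻¹ • l.sum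

theorem map_bary (L : E →ₗ[ℝ] F) (l : List E) : L (bary l) = bary (l.map L) := by
  simp [bary, map_list_sum]

theorem bary_mem {K : Set E} (hK : Convex ℝ K) {l : List E} (h0 : l ≠ []) (h : ∀ x ∈ l, x ∈ K) :
    bary l ∈ K := by
  have hn : (l.length : ℝ) ≠ 0 := by simpa using h0
  have h1 : bary l = ∑ i : Fin l.length, (l.length : ℝ)⁻¹ • l.get i := by
    rw [bary, ← Finset.smul_sum]
    congr 1
    conv_lhs => rw [← List.ofFn_get l, List.sum_ofFn]
  rw [h1]
  refine hK.sum_mem (fun _ _ => by positivity) ?_ (fun i _ => h _ (l.get_mem i))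
  simp [hn]

/-- Barycentric subdivision of simplices with `m` vertices: the subdivided boundary is coned off
from the barycenter. -/
noncomputable def sd : ℕ → (Chain E →ₗ[ZMod 2] Chain E)
  | 0 => LinearMap.id
  | m + 1 => linearCombination (ZMod 2) fun l => cone (bary l) (sd m (bdList l))

theorem sd_succ_single (m : ℕ) (l : List E) :
    sd (m + 1) (single l 1) = cone (bary l) (sd m (bdList l)) := by
  simp [sd]

/-- The chain homotopy between barycentric subdivision and the identity. -/
noncomputable def sdHomotopy : ℕ → (Chain E →ₗ[ZMod 2] Chain E)
  | 0 => 0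
  | m + 1 => linearCombination (ZMod 2) fun l =>
      cone (bary l) (single l 1 + sdHomotopy m (bdList l))

theorem sdHomotopy_succ_single (m : ℕ) (l : List E) :
    sdHomotopy (m + 1) (single l 1) = cone (bary l) (single l 1 + sdHomotopy m (bdList l)) := by
  simp [sdHomotopy]

theorem bd_sd {m : ℕ} {c : Chain E} (h : c ∈ supp {l : List E | l.length = m + 1}) :
    bd (sd (m + 1) c) = sd m (bd c) := by
  induction m generalizing c with
  | zero =>
    refine supported_induction (p := fun c => bd (sd 1 c) = sd 0 (bd c))
      (by simp) (fun c c' h h' => by simp only [map_add, h, h'])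
      (fun l hl => ?_) h
    obtain ⟨a, rfl⟩ := List.length_eq_one_iff.1 hl
    simp [sd, bdList]
  | succ m ih =>
    refine supported_induction (p := fun c => bd (sd (m + 2) c) = sd (m + 1) (bd c))
      (by simp) (fun c c' h h' => by simp only [map_add, h, h'])
      (fun l hl => ?_) h
    rw [sd_succ_single, bd_cone, ih (bdList_mem_length hl), bd_bdList, map_zero, map_zero, add_zero,
      bd_single]

theorem bd_sdHomotopy {m : ℕ} {c : Chain E} (h : c ∈ supp {l : List E | l.length = m}) :
    bd (sdHomotopy m c) = c + sd m c + sdHomotopy (m - 1) (bd c) := by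
  induction m generalizing c with
  | zero =>
    simp [sdHomotopy, sd, ZModModule.add_self]
  | succ m ih =>
    rw [Nat.add_sub_cancel]
    refine supported_induction (p := fun c => bd (sdHomotopy (m + 1) c) =
      c + sd (m + 1) c + sdHomotopy m (bd c))
      (by simp) (fun c c' h h' => by simp only [map_add, h, h']; abel)
      (fun l hl => ?_) h
    rw [sdHomotopy_succ_single, bd_cone, map_add, bd_single, ih (bdList_mem_length hl), bd_bdList,
      map_zero, add_zero, ← add_assoc, ZModModule.add_self, zero_add, sd_succ_single]
    abel

theorem sd_pow_succ (m r : ℕ) (c : Chain E) : (sd m ^ (r + 1)) c = (sd m ^ r) (sd m c) := by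
  rw [pow_succ]; rfl

theorem sd_pow_succ' (m r : ℕ) (c : Chain E) : (sd m ^ (r + 1)) c = sd m ((sd m ^ r) c) := by
  rw [pow_succ']; rfl

theorem push_sd (L : E →ₗ[ℝ] F) (m : ℕ) (c : Chain E) : push L (sd m c) = sd m (push L c) := by
  induction m generalizing c with
  | zero => rfl
  | succ m ih =>
    refine supported_induction (p := fun c => push L (sd (m + 1) c) = sd (m + 1) (push L c))
      (s := Set.univ) (by simp)
      (fun c c' h h' => by simp only [map_add, h, h']) (fun l hl => ?_) (by simp [supported_univ])
    rw [sd_succ_single, push_cone, ih, push_bdList, push_single, sd_succ_single, map_bary]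

theorem sd_mem_length {m : ℕ} {c : Chain E} (h : c ∈ supp {l : List E | l.length = m}) :
    sd m c ∈ supp {l : List E | l.length = m} := by
  induction m generalizing c with
  | zero => exact h
  | succ m ih =>
    refine linearMap_mem_of_single (fun l hl => ?_) h
    rw [sd_succ_single]
    exact cone_mem (fun l' h' => by simpa using h') (ih (bdList_mem_length hl))

theorem sdHomotopy_mem {m : ℕ} {K : Set E} (hK : Convex ℝ K) {c : Chain E}
    (h : c ∈ supp {l : List E | l.length = m ∧ ∀ x ∈ l, x ∈ K}) :
    sdHomotopy m c ∈ supp {l : List E | l.length = m + 1 ∧ ∀ x ∈ l, x ∈ K} := by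
  induction m generalizing c with
  | zero => exact Submodule.zero_mem _
  | succ m ih =>
    refine linearMap_mem_of_single (fun l hl => ?_) h
    rw [sdHomotopy_succ_single]
    refine cone_mem (s := {l : List E | l.length = m + 1 ∧ ∀ x ∈ l, x ∈ K}) (fun l' h' => ?_)
      (Submodule.add_mem _ (single_mem_supp hl) (ih ?_))
    · refine ⟨by simpa using h'.1, fun x hx => ?_⟩
      rcases List.mem_cons.1 hx with rfl | hx
      · exact bary_mem hK (by rintro rfl; simp at hl) hl.2
      · exact h'.2 x hx
    · refine supported_mono (fun l' h' => And.intro ?_ fun x hx => ?_) (bdList_mem l)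
      · have := h'.1; rw [hl.1] at this; exact Nat.succ.inj this
      · exact hl.2 x (h'.2.subset hx)

end Subdivision

section Mesh

variable {E : Type*} [NormedAddCommGroup E] [NormedSpace ℝ E]

theorem norm_sum_sub_length_smul_le {x : E} {D : ℝ} (l : List E) (h : ∀ y ∈ l, dist y x ≤ D) :
    ‖l.sum - (l.length : ℝ) • x‖ ≤ l.length * D := by
  induction l with
  | nil => simp
  | cons a l ih =>
    have h1 := ih fun y hy => h y (List.mem_cons_of_mem _ hy)
    have h2 := h a List.mem_cons_self
    rw [dist_eq_norm] at h2
    have : (a :: l).sum - (((a :: l).length : ℕ) : ℝ) • x =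
        (a - x) + (l.sum - (l.length : ℝ) • x) := by
      simp only [List.sum_cons, List.length_cons, Nat.cast_add, Nat.cast_one]
      module
    rw [this]
    refine (norm_add_le _ _).trans ?_
    push_cast [List.length_cons]
    linarith

theorem dist_bary_le {m : ℕ} {l : List E} (hl : l.length = m + 1) {D : ℝ}
    (h : ∀ x ∈ l, ∀ y ∈ l, dist x y ≤ D) {x : E} (hx : x ∈ l) :
    dist x (bary l) ≤ (m : ℝ) / (m + 1) * D := by
  obtain ⟨s, t, rfl⟩ := List.append_of_mem hx
  have hst : (s ++ t).length = m := by simp at hl ⊢; omega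
  have h1 := norm_sum_sub_length_smul_le (x := x) (D := D) (s ++ t) fun y hy => h y (by
    simp at hy ⊢; tauto) x hx
  rw [hst] at h1
  have hm : (0 : ℝ) < m + 1 := by positivity
  have h2 : bary (s ++ x :: t) - x = ((m : ℝ) + 1)⁻¹ • ((s ++ t).sum - (m : ℝ) • x) := by
    have h3 : (s ++ x :: t).sum = (s ++ t).sum + x := by
      simp only [List.sum_append, List.sum_cons]; abel
    rw [bary, hl, h3]
    push_cast
    have : (((m : ℝ) + 1)⁻¹ * (m + 1)) • x = x := by rw [inv_mul_cancel₀ hm.ne', one_smul]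
    linear_combination (norm := module) this
  rw [dist_comm, dist_eq_norm, h2, norm_smul, norm_inv, Real.norm_of_nonneg hm.le]
  calc ((m : ℝ) + 1)⁻¹ * _ ≤ ((m : ℝ) + 1)⁻¹ * (m * D) := by gcongr
    _ = _ := by ring

/-- Subdivision shrinks the diameter of simplices with `m + 1` vertices by the factor
`m / (m + 1)`. -/
theorem sd_mem {m : ℕ} {K : Set E} (hK : Convex ℝ K) {D : ℝ} (hD : 0 ≤ D) {c : Chain E}
    (h : c ∈ supp {l : List E | l.length = m + 1 ∧ (∀ x ∈ l, x ∈ K) ∧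
      ∀ x ∈ l, ∀ y ∈ l, dist x y ≤ D}) :
    sd (m + 1) c ∈ supp {l : List E | l.length = m + 1 ∧ (∀ x ∈ l, x ∈ K) ∧
      ∀ x ∈ l, ∀ y ∈ l, dist x y ≤ (m : ℝ) / (m + 1) * D} := by
  induction m generalizing c K with
  | zero =>
    refine linearMap_mem_of_single (fun l hl => ?_) h
    obtain ⟨a, rfl⟩ := List.length_eq_one_iff.1 hl.1
    have : sd (0 + 1) (single [a] 1) = single [a] (1 : ZMod 2) := by
      simp [sd, bdList, bary]
    rw [this]
    refine single_mem_supp ⟨rfl, hl.2.1, ?_⟩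
    simp
  | succ m ih =>
    refine linearMap_mem_of_single (fun l hl => ?_) h
    rw [sd_succ_single]
    have h0 : l ≠ [] := by rintro rfl; simp at hl
    have hc := convex_convexHull ℝ {x | x ∈ l}
    have h1 : bdList l ∈ supp {l' : List E | l'.length = m + 1 ∧
        (∀ x ∈ l', x ∈ convexHull ℝ {x | x ∈ l}) ∧ ∀ x ∈ l', ∀ y ∈ l', dist x y ≤ D} := by
      refine supported_mono
        (fun l' h' => And.intro ?_ (And.intro (fun x hx => ?_) fun x hx y hy => ?_)) (bdList_mem l)
      · have := h'.1; rw [hl.1] at this; exact Nat.succ.inj this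
      · exact subset_convexHull ℝ _ (h'.2.subset hx)
      · exact hl.2.2 x (h'.2.subset hx) y (h'.2.subset hy)
    have hb : ∀ x ∈ convexHull ℝ {x | x ∈ l},
        dist x (bary l) ≤ ((m + 1 : ℕ) : ℝ) / ((m + 1 : ℕ) + 1) * D := fun x hx =>
      convexHull_min (fun y hy => Metric.mem_closedBall.2 (dist_bary_le hl.1 hl.2.2 hy))
        (convex_closedBall _ _) hx
    have hlK : convexHull ℝ {x | x ∈ l} ⊆ K := convexHull_min hl.2.1 hK
    have hpos : (0 : ℝ) ≤ ((m + 1 : ℕ) : ℝ) / ((m + 1 : ℕ) + 1) * D := by positivity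
    refine cone_mem (fun l' h' => ?_) (ih hc h1)
    refine ⟨by simpa using h'.1, fun x hx => ?_, fun x hx y hy => ?_⟩
    · rcases List.mem_cons.1 hx with rfl | hx
      · exact bary_mem hK h0 hl.2.1
      · exact hlK (h'.2.1 x hx)
    · rcases List.mem_cons.1 hx with rfl | hx <;> rcases List.mem_cons.1 hy with rfl | hy
      · simpa using hpos
      · rw [dist_comm]; exact hb y (h'.2.1 y hy)
      · exact hb x (h'.2.1 x hx)
      · refine (h'.2.2 x hx y hy).trans ?_
        gcongr ?_ * D
        push_cast
        rw [div_le_div_iff₀ (by positivity) (by positivity)]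
        nlinarith

theorem sd_pow_mem {m : ℕ} {K : Set E} (hK : Convex ℝ K) {D : ℝ} (hD : 0 ≤ D) {c : Chain E}
    (h : c ∈ supp {l : List E | l.length = m + 1 ∧ (∀ x ∈ l, x ∈ K) ∧
      ∀ x ∈ l, ∀ y ∈ l, dist x y ≤ D}) (r : ℕ) :
    (sd (m + 1) ^ r) c ∈ supp {l : List E | l.length = m + 1 ∧ (∀ x ∈ l, x ∈ K) ∧
      ∀ x ∈ l, ∀ y ∈ l, dist x y ≤ ((m : ℝ) / (m + 1)) ^ r * D} := by
  induction r with
  | zero => simpa using h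
  | succ r ih =>
    rw [sd_pow_succ', pow_succ' ((m : ℝ) / (m + 1)), mul_assoc]
    exact sd_mem hK (by positivity) ih

/-- Iterated subdivisions of a simplex become arbitrarily fine. -/
theorem eventually_sd_pow_mem {l : List E} {m : ℕ} (hl : l.length = m + 1) {δ : ℝ} (hδ : 0 < δ) :
    ∀ᶠ r in Filter.atTop, (sd (m + 1) ^ r) (single l 1) ∈
      supp {l' : List E | l'.length = m + 1 ∧ (∀ x ∈ l', x ∈ convexHull ℝ {x | x ∈ l}) ∧
        ∀ x ∈ l', ∀ y ∈ l', dist x y < δ} := by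
  have hfin : {x | x ∈ l}.Finite := l.finite_toSet
  set D := Metric.diam {x | x ∈ l}
  have hq : (m : ℝ) / (m + 1) < 1 := by
    rw [div_lt_one (by positivity)]; linarith
  have ht := (tendsto_pow_atTop_nhds_zero_of_lt_one (by positivity) hq).mul_const D
  rw [zero_mul] at ht
  filter_upwards [ht.eventually_lt_const hδ] with r hr
  refine supported_mono ?_ (sd_pow_mem (convex_convexHull ℝ {x | x ∈ l}) Metric.diam_nonneg
    (single_mem_supp ⟨hl, fun x hx => subset_convexHull ℝ _ hx, fun x hx y hy =>
      Metric.dist_le_diam_of_mem hfin.isBounded hx hy⟩) r)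
  exact fun l' h' => ⟨h'.1, h'.2.1, fun x hx y hy => (h'.2.2 x hx y hy).trans_lt hr⟩

end Mesh

section Powers

variable {E F : Type*} [AddCommGroup E] [Module ℝ E] [AddCommGroup F] [Module ℝ F]

theorem push_sd_pow (L : E →ₗ[ℝ] F) (m r : ℕ) (c : Chain E) :
    push L ((sd m ^ r) c) = (sd m ^ r) (push L c) := by
  induction r generalizing c with
  | zero => rfl
  | succ r ih => rw [sd_pow_succ, sd_pow_succ, ih, push_sd]

theorem sd_pow_mem_length {m : ℕ} {c : Chain E} (h : c ∈ supp {l : List E | l.length = m}) (r : ℕ) :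
    (sd m ^ r) c ∈ supp {l : List E | l.length = m} := by
  induction r generalizing c with
  | zero => exact h
  | succ r ih => rw [sd_pow_succ]; exact ih (sd_mem_length h)

theorem bd_sd_pow {m : ℕ} {c : Chain E} (h : c ∈ supp {l : List E | l.length = m + 1}) (r : ℕ) :
    bd ((sd (m + 1) ^ r) c) = (sd m ^ r) (bd c) := by
  induction r generalizing c with
  | zero => rfl
  | succ r ih =>
    rw [sd_pow_succ, sd_pow_succ, ih (sd_mem_length h),
      bd_sd h]

end Powers

/-! ### Generic polyhedra of dimension at most one -/

/-- From a point of the positive orthant, one can move in a direction which is not in the orthant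
until a decreasing coordinate vanishes for the first time. -/
theorem exists_add_smul_vanishing {ι : Type*} [Finite ι] {z q : ι → ℝ} (hz : 0 ≤ z)
    (hq : ∃ i, q i < 0) :
    ∃ t : ℝ, 0 ≤ t ∧ 0 ≤ z + t • q ∧ ∃ i, q i < 0 ∧ (z + t • q) i = 0 := by
  classical
  cases nonempty_fintype ι
  obtain ⟨i, hi, hmin⟩ := Finset.exists_min_image (Finset.univ.filter fun i => q i < 0)
    (fun i => z i / (-q i)) (by obtain ⟨i, hi⟩ := hq; exact ⟨i, by simpa using hi⟩)
  have hi : q i < 0 := by simpa using hi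
  have ht : 0 ≤ z i / (-q i) := div_nonneg (hz i) (by linarith)
  refine ⟨z i / (-q i), ht, fun j => ?_, i, hi, ?_⟩
  · simp only [Pi.zero_apply, Pi.add_apply, Pi.smul_apply, smul_eq_mul]
    rcases lt_or_ge (q j) 0 with hj | hj
    · have h1 := hmin j (by simpa using hj)
      rw [le_div_iff₀ (by linarith)] at h1
      linarith
    · have := mul_nonneg ht hj
      have := hz j
      simp only [Pi.zero_apply] at this
      linarith
  · simp only [Pi.add_apply, Pi.smul_apply, smul_eq_mul]
    rw [div_neg, neg_mul, div_mul_cancel₀ _ hi.ne, add_neg_cancel]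

/-- If the polyhedron `{z ≥ 0, A z = b}` is bounded and at most one-dimensional, and no two
coordinates vanish simultaneously on it, then it is empty or a segment, and exactly
two coordinates vanish somewhere on it. -/
theorem sum_vanishing_eq_zero {ι U : Type*} [Fintype ι] [AddCommGroup U] [Module ℝ U]
    [FiniteDimensional ℝ U] (A : (ι → ℝ) →ₗ[ℝ] U) (hcard : finrank ℝ U < Fintype.card ι) (b : U)
    (hbdd : ∀ q, 0 ≤ q → A q = 0 → q = 0)
    (hgen : ∀ z, 0 ≤ z → A z = b → ∀ i j, z i = 0 → z j = 0 → i = j)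
    [DecidablePred fun i => ∃ z, 0 ≤ z ∧ A z = b ∧ z i = 0] :
    ∑ i, (if ∃ z, 0 ≤ z ∧ A z = b ∧ z i = 0 then (1 : ZMod 2) else 0) = 0 := by
  classical
  by_cases hne : ∃ i z, 0 ≤ z ∧ A z = b ∧ z i = 0
  swap
  · push Not at hne
    exact Finset.sum_eq_zero fun i _ => if_neg fun ⟨z, h1, h2, h3⟩ => hne i z h1 h2 h3
  obtain ⟨i₀, z₀, hz₀, hA₀, h₀⟩ := hne
  have hneg : ∀ q, A q = 0 → q ≠ 0 → ∃ i, q i < 0 := by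
    intro q hAq hq
    by_contra! h
    exact hq (hbdd q h hAq)
  -- The polyhedron is at most one-dimensional, since otherwise one could move along the
  -- hyperplane `z i₀ = 0` until a second coordinate vanishes.
  have hker : ∀ q, A q = 0 → q i₀ = 0 → q = 0 := by
    intro q hAq hq0
    by_contra hq
    obtain ⟨t, ht, hpos, j, hj, hj0⟩ := exists_add_smul_vanishing hz₀ (hneg q hAq hq)
    have := hgen _ hpos (by rw [map_add, map_smul, hAq, hA₀]; simp) i₀ j (by simp [h₀, hq0]) hj0
    rw [← this, hq0] at hj
    exact lt_irrefl _ hj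
  obtain ⟨q, hAq, hq0⟩ : ∃ q, A q = 0 ∧ 0 < q i₀ := by
    have hk : LinearMap.ker A ≠ ⊥ := LinearMap.ker_ne_bot_of_finrank_lt (by simpa using hcard)
    obtain ⟨q, hq, hq0⟩ := Submodule.exists_mem_ne_zero_of_ne_bot hk
    have hq : A q = 0 := hq
    rcases lt_trichotomy (q i₀) 0 with h | h | h
    · exact ⟨-q, by rw [map_neg, hq, neg_zero], by simpa using h⟩
    · exact absurd (hker q hq h) hq0
    · exact ⟨q, hq, h⟩
  obtain ⟨t₁, ht₁, hpos₁, i₁, hi₁, h₁⟩ := exists_add_smul_vanishing hz₀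
    (hneg q hAq (by rintro rfl; exact lt_irrefl _ hq0))
  have hA₁ : A (z₀ + t₁ • q) = b := by rw [map_add, map_smul, hAq, hA₀]; simp
  have hne : i₀ ≠ i₁ := by rintro rfl; exact lt_asymm hq0 hi₁
  have hset : (Finset.univ.filter fun i => ∃ z, 0 ≤ z ∧ A z = b ∧ z i = 0) = {i₀, i₁} := by
    ext i
    simp only [Finset.mem_filter, Finset.mem_univ, true_and, Finset.mem_insert,
      Finset.mem_singleton]
    constructor
    · rintro ⟨z, hz, hA, hi⟩
      obtain ⟨t, rfl⟩ : ∃ t : ℝ, z = z₀ + t • q := by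
        refine ⟨z i₀ / q i₀, ?_⟩
        rw [← sub_eq_zero]
        refine hker _ (by simp [hA, hA₀, hAq]) ?_
        simp [h₀, hq0.ne']
      have ht : 0 ≤ t := by
        have := hz i₀
        simp only [Pi.zero_apply, Pi.add_apply, h₀, Pi.smul_apply, smul_eq_mul, zero_add] at this
        exact nonneg_of_mul_nonneg_left this hq0
      rcases ht.eq_or_lt with rfl | ht
      · exact Or.inl (hgen _ hz hA i i₀ hi (by simp [h₀]))
      right
      have h2 := hz i₁
      have h3 := hpos₁ i
      have h4 := hz₀ i
      simp only [Pi.zero_apply, Pi.add_apply, Pi.smul_apply, smul_eq_mul] at h2 h3 h4 h₁ hi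
      have htt : t ≤ t₁ := by
        by_contra! hlt
        nlinarith
      rcases htt.eq_or_lt with rfl | hlt
      · exact hgen _ hz hA i i₁ (by simpa using hi) (by simpa using h₁)
      · exfalso
        have hzi : z₀ i = 0 := by
          have : t₁ * (z₀ i + t * q i) - t * (z₀ i + t₁ * q i) = (t₁ - t) * z₀ i := by ring
          rw [hi] at this
          have h5 : (t₁ - t) * z₀ i ≤ 0 := by nlinarith
          nlinarith
        have hqi : q i = 0 := by
          rw [hzi, zero_add] at hi
          exact (mul_eq_zero.1 hi).resolve_left ht.ne'
        have := hgen _ hz₀ hA₀ i i₀ hzi h₀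
        rw [← this, hqi] at hq0
        exact lt_irrefl _ hq0
    · rintro (rfl | rfl)
      · exact ⟨z₀, hz₀, hA₀, h₀⟩
      · exact ⟨_, hpos₁, hA₁, h₁⟩
  rw [Finset.sum_boole, hset, Finset.card_pair hne]
  rfl

theorem mem_convexHull_image_iff {ι W : Type*} [Fintype ι] [AddCommGroup W] [Module ℝ W]
    (f : ι → W) (S : Set ι) (v : W) :
    v ∈ convexHull ℝ (f '' S) ↔
      ∃ z : ι → ℝ, 0 ≤ z ∧ ∑ i, z i = 1 ∧ ∑ i, z i • f i = v ∧ ∀ i ∉ S, z i = 0 := by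
  classical
  constructor
  · intro h
    refine convexHull_min (t := {v | ∃ z : ι → ℝ, 0 ≤ z ∧ ∑ i, z i = 1 ∧ ∑ i, z i • f i = v ∧
      ∀ i ∉ S, z i = 0}) ?_ ?_ h
    · rintro _ ⟨i, hi, rfl⟩
      refine ⟨Pi.single i 1, ?_, by simp, by simp [Pi.single_apply], ?_⟩
      · exact Pi.single_nonneg.2 zero_le_one
      · intro j hj
        exact Pi.single_eq_of_ne (fun h => hj (by rw [h]; exact hi)) _
    · rintro _ ⟨z, hz, hz1, rfl, hzS⟩ _ ⟨y, hy, hy1, rfl, hyS⟩ a b ha hb hab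
      refine ⟨a • z + b • y, add_nonneg (smul_nonneg ha hz) (smul_nonneg hb hy), ?_, ?_, ?_⟩
      · simp [Finset.sum_add_distrib, ← Finset.mul_sum, hz1, hy1, hab]
      · simp [Finset.sum_add_distrib, Finset.smul_sum, add_smul, smul_smul]
      · intro i hi
        simp [hzS i hi, hyS i hi]
  · rintro ⟨z, hz, hz1, rfl, hzS⟩
    have e1 : ∑ i, z i • f i = ∑ i ∈ Finset.univ.filter (· ∈ S), z i • f i :=
      (Finset.sum_filter_of_ne fun i _ h => by
        by_contra hi; exact h (by rw [hzS i hi, zero_smul])).symm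
    have e2 : ∑ i, z i = ∑ i ∈ Finset.univ.filter (· ∈ S), z i :=
      (Finset.sum_filter_of_ne fun i _ h => by by_contra hi; exact h (hzS i hi)).symm
    rw [e1]
    refine (convex_convexHull ℝ _).sum_mem (fun i _ => hz i) (e2 ▸ hz1) fun i hi => ?_
    exact subset_convexHull ℝ _ ⟨i, (Finset.mem_filter.1 hi).2, rfl⟩

theorem setOf_mem_eraseIdx {W : Type*} (l : List W) (i : Fin l.length) :
    {x | x ∈ l.eraseIdx i} = l.get '' {j | j ≠ i} := by
  ext x
  simp only [Set.mem_ofPred_eq, List.mem_eraseIdx_iff_getElem, Set.mem_image]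
  constructor
  · rintro ⟨j, hj, hne, rfl⟩
    exact ⟨⟨j, hj⟩, fun h => hne (congrArg Fin.val h), rfl⟩
  · rintro ⟨j, hne, rfl⟩
    exact ⟨j, j.2, fun h => hne (Fin.ext h), rfl⟩

theorem setOf_mem_eq_image {W : Type*} (l : List W) : {x | x ∈ l} = l.get '' Set.univ := by
  ext x
  simp [List.mem_iff_get]

/-! ### Counting the simplices which meet a set -/

section Count

variable {W : Type*} [AddCommGroup W] [Module ℝ W]

open Classical in
/-- The number modulo 2 of the simplices of a chain whose convex hull meets the set `S`. -/
noncomputable def count (S : Set W) : Chain W →ₗ[ZMod 2] ZMod 2 :=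
  linearCombination (ZMod 2) fun l => if (convexHull ℝ {x | x ∈ l} ∩ S).Nonempty then 1 else 0

open Classical in
theorem count_single (S : Set W) (l : List W) : count S (single l 1) =
    if (convexHull ℝ {x | x ∈ l} ∩ S).Nonempty then 1 else 0 := by
  simp [count]

theorem count_eq_zero {S : Set W} {c : Chain W}
    (h : c ∈ supp {l | Disjoint (convexHull ℝ {x | x ∈ l}) S}) : count S c = 0 := by
  refine supported_induction (p := fun c => count S c = 0) (map_zero _)
    (fun c c' h h' => by rw [map_add, h, h', add_zero]) (fun l hl => ?_) h
  rw [count_single, if_neg]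
  rw [Set.not_nonempty_iff_eq_empty]
  exact Set.disjoint_iff_inter_eq_empty.1 hl

theorem count_push_neg (S : Set W) (c : Chain W) :
    count S (push Neg.neg c) = count (-S) c := by
  refine supported_induction (s := Set.univ) (p := fun c => count S (push Neg.neg c) = count (-S) c)
    (by simp) (fun c c' h h' => by simp only [map_add, h, h']) (fun l _ => ?_)
    (by simp [supported_univ])
  rw [push_single, count_single, count_single]
  have h1 : {x | x ∈ l.map Neg.neg} = -{x | x ∈ l} := by
    ext x
    simp only [List.mem_map, Set.mem_ofPred_eq, Set.mem_neg]
    exact ⟨fun ⟨a, ha, h⟩ => by rwa [← h, neg_neg], fun h => ⟨-x, h, neg_neg x⟩⟩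
  rw [h1, convexHull_neg]
  congr 1
  rw [eq_iff_iff]
  constructor
  · rintro ⟨x, h1, h2⟩
    exact ⟨-x, h1, by simpa using h2⟩
  · rintro ⟨x, h1, h2⟩
    exact ⟨-x, by simpa using h1, h2⟩

end Count

section Generic

variable {W : Type*} [NormedAddCommGroup W] [NormedSpace ℝ W] [FiniteDimensional ℝ W]
  [MeasurableSpace W] [BorelSpace W] (μ : Measure W) [μ.IsAddHaarMeasure]

theorem ae_notMem_convexHull_image {ι : Type*} (f : ι → W) (s : Finset ι)
    (hs : s.card ≤ finrank ℝ W) : ∀ᵐ v ∂μ, v ∉ convexHull ℝ (f '' s) := by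
  classical
  have h : affineSpan ℝ (f '' s) ≠ ⊤ := by
    intro h
    obtain ⟨m, hm⟩ : ∃ m, s.card = m + 1 := by
      refine Nat.exists_eq_succ_of_ne_zero fun h0 => ?_
      rw [Finset.card_eq_zero] at h0
      subst h0
      simp only [Finset.coe_empty, Set.image_empty, AffineSubspace.span_empty] at h
      exact AffineSubspace.bot_ne_top ℝ W W h
    have h1 := finrank_vectorSpan_image_finset_le ℝ f s hm
    rw [← direction_affineSpan, Finset.coe_image, h, AffineSubspace.direction_top,
      finrank_top] at h1
    omega
  have h2 := Measure.addHaar_affineSubspace μ _ h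
  refine measure_mono_null (fun v hv => ?_) h2
  exact convexHull_subset_affineSpan _ (not_not.1 hv)

theorem ae_notMem_span_image {ι : Type*} (f : ι → W) (s : Finset ι)
    (hs : s.card < finrank ℝ W) : ∀ᵐ v ∂μ, v ∉ Submodule.span ℝ (f '' s) := by
  classical
  refine measure_mono_null (fun v hv => not_not.1 hv) (Measure.addHaar_submodule μ _ fun h => ?_)
  have h1 := finrank_span_finset_le_card (R := ℝ) (s.image f)
  rw [Finset.coe_image, Set.finrank, h, finrank_top] at h1
  exact absurd (h1.trans Finset.card_image_le) (not_le.2 hs)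

theorem ae_neg {p : W → Prop} (h : ∀ᵐ v ∂μ, p v) : ∀ᵐ v ∂μ, p (-v) :=
  (Measure.measurePreserving_neg μ).quasiMeasurePreserving.ae h

/-- A generic point lies in an even number of facets of a simplex with `dim W + 2` vertices. -/
theorem ae_count_bdList {l : List W} (hl : l.length = finrank ℝ W + 2) :
    ∀ᵐ v ∂μ, count {v} (bdList l) = 0 := by
  classical
  have h1 : ∀ᵐ v ∂μ, ∀ i j : Fin l.length, i ≠ j →
      v ∉ convexHull ℝ (l.get '' (({i, j}ᶜ : Finset (Fin l.length)) : Set (Fin l.length))) := by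
    simp only [ae_all_iff]
    intro i j hij
    refine ae_notMem_convexHull_image μ _ _ ?_
    rw [Finset.card_compl, Finset.card_pair hij, Fintype.card_fin, hl]
    omega
  filter_upwards [h1] with v hv
  rw [bdList_eq_sum, map_sum]
  let A : (Fin l.length → ℝ) →ₗ[ℝ] W × ℝ :=
    (∑ i, (LinearMap.proj (φ := fun _ : Fin l.length => ℝ) i).smulRight (l.get i)).prod
      (∑ i, LinearMap.proj (φ := fun _ : Fin l.length => ℝ) i)
  have hA : ∀ z, A z = (∑ i, z i • l.get i, ∑ i, z i) := fun z => by
    simp [A]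
  have key := sum_vanishing_eq_zero A (by simp [hl]) (v, 1) ?_ ?_
  · rw [← key]
    refine Finset.sum_congr rfl fun i _ => ?_
    rw [count_single, setOf_mem_eraseIdx]
    congr 1
    rw [Set.inter_singleton_nonempty, mem_convexHull_image_iff, eq_iff_iff]
    refine exists_congr fun z => ?_
    rw [hA, Prod.mk.injEq]
    simp only [ne_eq, Set.mem_ofPred_eq, not_not, forall_eq]
    tauto
  · intro q hq hAq
    rw [hA, Prod.mk_eq_zero] at hAq
    have := (Finset.sum_eq_zero_iff_of_nonneg fun i _ => hq i).1 hAq.2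
    exact funext fun i => this i (Finset.mem_univ i)
  · intro z hz hAz i j hi hj
    by_contra hij
    rw [hA, Prod.mk.injEq] at hAz
    refine hv i j hij ((mem_convexHull_image_iff _ _ _).2 ⟨z, hz, hAz.2, hAz.1, fun m hm => ?_⟩)
    simp only [Finset.coe_compl, Finset.coe_insert, Finset.coe_singleton, Set.mem_compl_iff,
      not_not, Set.mem_insert_iff, Set.mem_singleton_iff] at hm
    rcases hm with rfl | rfl <;> assumption

theorem ae_count_bd {c : Chain W} (hc : c ∈ supp {l : List W | l.length = finrank ℝ W + 2}) :
    ∀ᵐ v ∂μ, count {v} (bd c) = 0 := by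
  refine supported_induction (p := fun c => ∀ᵐ v ∂μ, count {v} (bd c) = 0) (by simp)
    (fun c c' h h' => ?_) (fun l hl => by simpa using ae_count_bdList μ hl) hc
  filter_upwards [h, h'] with v h h'
  rw [map_add, map_add, h, h', add_zero]

/-- Cycles have degree zero, as they are boundaries. -/
theorem ae_count_cycle {c : Chain W} (hc : c ∈ supp {l : List W | l.length = finrank ℝ W + 1})
    (h : bd c = 0) : ∀ᵐ v ∂μ, count {v} c = 0 := by
  have h1 := ae_count_bd μ (c := cone 0 c) (cone_mem (fun l hl => by simpa using hl) hc)
  rw [bd_cone, h, map_zero, add_zero] at h1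
  exact h1

/-- Subdivision does not change the degree: the part of the homotopy over the boundary lies in the
facets, which do not contain a generic point. -/
theorem ae_count_sd {c : Chain W} (hc : c ∈ supp {l : List W | l.length = finrank ℝ W + 1}) :
    ∀ᵐ v ∂μ, count {v} (sd (finrank ℝ W + 1) c) = count {v} c := by
  set d := finrank ℝ W with hd
  have h1 : ∀ᵐ v ∂μ, count {v} (sdHomotopy d (bd c)) = 0 := by
    refine supported_induction (p := fun c => ∀ᵐ v ∂μ, count {v} (sdHomotopy d c) = 0) (by simp)
      (fun c c' h h' => ?_) (fun l hl => ?_) (bd_mem_length hc)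
    · filter_upwards [h, h'] with v h h'
      rw [map_add, map_add, h, h', add_zero]
    · have hl : l.length = d := hl
      have h2 := ae_notMem_convexHull_image μ l.get Finset.univ (by simp [hl, hd])
      rw [Finset.coe_univ, ← setOf_mem_eq_image] at h2
      filter_upwards [h2] with v hv
      refine count_eq_zero (supported_mono (fun l' h' => ?_)
        (sdHomotopy_mem (convex_convexHull ℝ {x | x ∈ l})
          (single_mem_supp ⟨hl, fun x hx => subset_convexHull ℝ _ hx⟩)))
      rw [Set.mem_ofPred_eq, Set.disjoint_singleton_right]
      exact fun h => hv (convexHull_min h'.2 (convex_convexHull ℝ _) h)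
  have h2 := ae_count_bd μ (c := sdHomotopy (d + 1) c)
    (supported_mono (fun l hl => hl.1) (sdHomotopy_mem (K := Set.univ) convex_univ
      (supported_mono (fun l hl => And.intro hl fun _ _ => trivial) hc)))
  rw [bd_sdHomotopy hc] at h2
  filter_upwards [h1, h2] with v h1 h2
  rw [Nat.add_sub_cancel, map_add, map_add, h1, add_zero] at h2
  rw [← ZModModule.sub_eq_add, sub_eq_zero] at h2
  exact h2.symm

theorem ae_count_sd_pow {c : Chain W} (hc : c ∈ supp {l : List W | l.length = finrank ℝ W + 1})
    (r : ℕ) : ∀ᵐ v ∂μ, count {v} ((sd (finrank ℝ W + 1) ^ r) c) = count {v} c := by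
  induction r with
  | zero => simp
  | succ r ih =>
    filter_upwards [ih, ae_count_sd μ (sd_pow_mem_length hc r)] with v h1 h2
    rw [sd_pow_succ', h2, h1]

/-- Modulo 2, the number of the points `v`, `-v` which lie in a simplex is the number of facets of
the simplex which meet the segment between these points. -/
theorem ae_count_add_count_neg {l : List W} (hl : l.length = finrank ℝ W + 1)
    (h0 : ∀ i j : Fin l.length, i ≠ j → (0 : W) ∉ convexHull ℝ (l.get '' {i, j}ᶜ)) :
    ∀ᵐ v ∂μ, count {v} (single l 1) + count {-v} (single l 1) =
      count (segment ℝ v (-v)) (bdList l) := by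
  classical
  have h1 : ∀ᵐ v ∂μ, ∀ i : Fin l.length,
      v ∉ convexHull ℝ (l.get '' (({i}ᶜ : Finset (Fin l.length)) : Set (Fin l.length))) := by
    simp only [ae_all_iff]
    intro i
    refine ae_notMem_convexHull_image μ _ _ ?_
    rw [Finset.card_compl, Finset.card_singleton, Fintype.card_fin, hl]
    omega
  have h2 : ∀ᵐ v ∂μ, ∀ i j : Fin l.length, i ≠ j →
      v ∉ Submodule.span ℝ (l.get '' (({i, j}ᶜ : Finset (Fin l.length)) : Set (Fin l.length))) := by
    simp only [ae_all_iff]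
    intro i j hij
    refine ae_notMem_span_image μ _ _ ?_
    have : 1 < l.length := by
      have h1 := i.2; have h2 := j.2
      by_contra h
      exact hij (Fin.ext (by omega))
    rw [Finset.card_compl, Finset.card_pair hij, Fintype.card_fin, hl]
    omega
  filter_upwards [h1, ae_neg μ h1, h2] with v hv hv' hv2
  let P : (i : Fin l.length ⊕ Bool) → (Fin l.length ⊕ Bool → ℝ) →ₗ[ℝ] ℝ := LinearMap.proj
  let A : (Fin l.length ⊕ Bool → ℝ) →ₗ[ℝ] W × ℝ × ℝ :=
    (∑ i, (P (Sum.inl i)).smulRight (l.get i) -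
        (P (Sum.inr true) - P (Sum.inr false)).smulRight v).prod
      ((∑ i, P (Sum.inl i)).prod (P (Sum.inr true) + P (Sum.inr false)))
  have hA : ∀ z b, A z = (0, 1, 1) ∧ b ↔ (∑ i, z (Sum.inl i) • l.get i =
      (z (Sum.inr true) - z (Sum.inr false)) • v ∧ ∑ i, z (Sum.inl i) = 1 ∧
        z (Sum.inr true) + z (Sum.inr false) = 1) ∧ b := fun z b => by
    have : A z = (∑ i, z (Sum.inl i) • l.get i -
      (z (Sum.inr true) - z (Sum.inr false)) • v, ∑ i, z (Sum.inl i),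
        z (Sum.inr true) + z (Sum.inr false)) := by
      simp [A, P, LinearMap.sum_apply]
    rw [this, Prod.mk.injEq, Prod.mk.injEq, sub_eq_zero]
  have key := sum_vanishing_eq_zero A (by simp [hl]) (0, 1, 1) ?_ ?_
  · rw [Fintype.sum_sum_type, Fintype.sum_bool] at key
    have e1 : count {v} (single l 1) = if ∃ z, 0 ≤ z ∧ A z = (0, 1, 1) ∧ z (Sum.inr false) = 0
        then 1 else 0 := by
      rw [count_single]
      congr 1
      rw [Set.inter_singleton_nonempty, setOf_mem_eq_image, mem_convexHull_image_iff, eq_iff_iff]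
      constructor
      · rintro ⟨z, hz, hz1, hzv, -⟩
        refine ⟨Sum.elim z fun b => if b then 1 else 0, ?_, ?_⟩
        · rintro (i | b)
          · exact hz i
          · rcases b <;> simp
        · rw [hA]; simp [hz1, ← hzv]
      · rintro ⟨z, hz, h⟩
        rw [hA] at h
        obtain ⟨⟨h1, h2, h3⟩, h4⟩ := h
        refine ⟨fun i => z (Sum.inl i), fun i => hz _, h2, ?_, by simp⟩
        rw [h1]
        rw [h4, add_zero] at h3
        rw [h3, h4]; simp
    have e2 : count {-v} (single l 1) = if ∃ z, 0 ≤ z ∧ A z = (0, 1, 1) ∧ z (Sum.inr true) = 0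
        then 1 else 0 := by
      rw [count_single]
      congr 1
      rw [Set.inter_singleton_nonempty, setOf_mem_eq_image, mem_convexHull_image_iff, eq_iff_iff]
      constructor
      · rintro ⟨z, hz, hz1, hzv, -⟩
        refine ⟨Sum.elim z fun b => if b then 0 else 1, ?_, ?_⟩
        · rintro (i | b)
          · exact hz i
          · rcases b <;> simp
        · rw [hA]; simp only [List.get_eq_getElem] at hzv; simp [hz1, hzv]
      · rintro ⟨z, hz, h⟩
        rw [hA] at h
        obtain ⟨⟨h1, h2, h3⟩, h4⟩ := h
        refine ⟨fun i => z (Sum.inl i), fun i => hz _, h2, ?_, by simp⟩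
        rw [h1]
        rw [h4, zero_add] at h3
        rw [h3, h4]; simp
    have e3 : count (segment ℝ v (-v)) (bdList l) = ∑ i : Fin l.length,
        if ∃ z, 0 ≤ z ∧ A z = (0, 1, 1) ∧ z (Sum.inl i) = 0 then 1 else 0 := by
      rw [bdList_eq_sum, map_sum]
      refine Finset.sum_congr rfl fun i _ => ?_
      rw [count_single, setOf_mem_eraseIdx]
      congr 1
      rw [eq_iff_iff]
      constructor
      · rintro ⟨w, hw, a, b, ha, hb, hab, rfl⟩
        obtain ⟨z, hz, hz1, hzv, hzi⟩ := (mem_convexHull_image_iff _ _ _).1 hw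
        refine ⟨Sum.elim z fun t => if t then a else b, ?_, ?_⟩
        · rintro (i | b)
          · exact hz i
          · rcases b <;> simpa
        · rw [hA]
          refine ⟨⟨?_, by simpa using hz1, by simpa using hab⟩, by simpa using hzi i⟩
          simp only [Sum.elim_inl, Sum.elim_inr, hzv]
          simp only [if_true, Bool.false_eq_true, if_false]
          module
      · rintro ⟨z, hz, h⟩
        rw [hA] at h
        obtain ⟨⟨h1, h2, h3⟩, h4⟩ := h
        refine ⟨(z (Sum.inr true) - z (Sum.inr false)) • v,
          (mem_convexHull_image_iff _ _ _).2 ⟨fun i => z (Sum.inl i), fun i => hz _, h2, h1, ?_⟩,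
          z (Sum.inr true), z (Sum.inr false), hz _, hz _, h3, by module⟩
        simpa using h4
    rw [e1, e2, e3]
    exact (by decide : ∀ x y s : ZMod 2, s + (y + x) = 0 → x + y = s) _ _ _ key
  · intro q hq hAq
    have h1 : A q = (∑ i, q (Sum.inl i) • l.get i -
      (q (Sum.inr true) - q (Sum.inr false)) • v, ∑ i, q (Sum.inl i),
        q (Sum.inr true) + q (Sum.inr false)) := by
      simp [A, P, LinearMap.sum_apply]
    rw [h1, Prod.mk_eq_zero, Prod.mk_eq_zero] at hAq
    have h2 := (Finset.sum_eq_zero_iff_of_nonneg fun i _ => hq (Sum.inl i)).1 hAq.2.1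
    have h3 := hAq.2.2
    have h4 := hq (Sum.inr true)
    have h5 := hq (Sum.inr false)
    simp only [Pi.zero_apply] at h4 h5
    funext i
    rcases i with i | b
    · exact h2 i (Finset.mem_univ i)
    · rcases b <;> simp only [Pi.zero_apply] <;> linarith
  · intro z hz hAz
    obtain ⟨⟨h1, h2, h3⟩, -⟩ := (hA z True).1 ⟨hAz, trivial⟩
    have aux1 : ∀ i, z (Sum.inl i) = 0 → z (Sum.inr true) = 0 → False := by
      intro i hi ht
      refine hv' i ((mem_convexHull_image_iff _ _ _).2
        ⟨fun i => z (Sum.inl i), fun i => hz _, h2, ?_, by simpa using hi⟩)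
      rw [ht, zero_add] at h3
      rw [h1, ht, h3]; simp
    have aux2 : ∀ i, z (Sum.inl i) = 0 → z (Sum.inr false) = 0 → False := by
      intro i hi ht
      refine hv i ((mem_convexHull_image_iff _ _ _).2
        ⟨fun i => z (Sum.inl i), fun i => hz _, h2, ?_, by simpa using hi⟩)
      rw [ht, add_zero] at h3
      rw [h1, ht, h3]; simp
    have aux3 : z (Sum.inr false) = 0 → z (Sum.inr true) = 0 → False := by
      intro hf ht
      rw [hf, ht] at h3
      simp at h3
    rintro (i | b) (j | b') hi hj
    · by_contra hij
      have hij : i ≠ j := fun h => hij (by rw [h])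
      have h4 : (z (Sum.inr true) - z (Sum.inr false)) • v ∈
          convexHull ℝ (l.get '' {i, j}ᶜ) := by
        refine (mem_convexHull_image_iff _ _ _).2
          ⟨fun i => z (Sum.inl i), fun i => hz _, h2, h1, fun m hm => ?_⟩
        simp only [Set.mem_compl_iff, not_not, Set.mem_insert_iff, Set.mem_singleton_iff] at hm
        rcases hm with rfl | rfl <;> assumption
      by_cases hs : z (Sum.inr true) - z (Sum.inr false) = 0
      · rw [hs, zero_smul] at h4
        exact h0 i j hij h4
      · refine hv2 i j hij ?_
        have h5 := convexHull_subset_affineSpan _ h4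
        have h6 := affineSpan_subset_span h5
        have h7 := (Submodule.smul_mem_iff _ hs).1 h6
        rw [Finset.coe_compl, Finset.coe_pair]
        exact h7
    · rcases b'
      · exact (aux2 i hi hj).elim
      · exact (aux1 i hi hj).elim
    · rcases b
      · exact (aux2 j hj hi).elim
      · exact (aux1 j hj hi).elim
    · rcases b <;> rcases b'
      · rfl
      · exact (aux3 hi hj).elim
      · exact (aux3 hj hi).elim
      · rfl

end Generic

/-! ### Counting zeros by fine subdivisions -/

section Local

variable {E W : Type*} [NormedAddCommGroup E] [NormedAddCommGroup W]

/-- The images of small simplices under a map without zeros stay away from the origin. -/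
theorem exists_disjoint_convexHull_map [NormedSpace ℝ W] {Δ U : Set E}
    (hΔ : IsCompact Δ) (hU : IsOpen U)
    {f : E → W} (hf : ContinuousOn f Δ) (h0 : ∀ x ∈ Δ, x ∉ U → f x ≠ 0) :
    ∃ ε > 0, ∀ᶠ δ in 𝓝[>] (0 : ℝ), ∀ l : List E, (∀ x ∈ l, x ∈ Δ ∧ x ∉ U) →
      (∀ x ∈ l, ∀ y ∈ l, dist x y < δ) →
        Disjoint (convexHull ℝ {x | x ∈ l.map f}) (Metric.ball (0 : W) ε) := by
  obtain ⟨ε, hε, hlow⟩ : ∃ ε > 0, ∀ x ∈ Δ \ U, 2 * ε ≤ ‖f x‖ := by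
    have hK : IsCompact (Δ \ U) := hΔ.diff hU
    rcases (Δ \ U).eq_empty_or_nonempty with he | hne
    · exact ⟨1, one_pos, fun x hx => by rw [he] at hx; exact hx.elim⟩
    · obtain ⟨x, hx, hmin⟩ := hK.exists_isMinOn hne (hf.mono Set.sdiff_subset).norm
      refine ⟨‖f x‖ / 2, half_pos (norm_pos_iff.2 (h0 x hx.1 hx.2)), fun y hy => ?_⟩
      have : ‖f x‖ ≤ ‖f y‖ := hmin hy
      linarith
  obtain ⟨δ₀, hδ₀, huc⟩ := Metric.uniformContinuousOn_iff.1
    (hΔ.uniformContinuousOn_of_continuous hf) ε hε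
  refine ⟨ε, hε, ?_⟩
  filter_upwards [Ioo_mem_nhdsGT hδ₀] with δ hδ l hl hd
  rcases l with _ | ⟨a, l⟩
  · simp
  have ha := hl a List.mem_cons_self
  have hsub : convexHull ℝ {x | x ∈ (a :: l).map f} ⊆ Metric.ball (f a) ε := by
    refine convexHull_min ?_ (convex_ball _ _)
    intro y hy
    obtain ⟨x, hx, rfl⟩ := List.mem_map.1 hy
    exact huc x (hl x hx).1 a ha.1 ((hd x hx a List.mem_cons_self).trans hδ.2)
  refine Disjoint.mono_left hsub (Metric.ball_disjoint_ball ?_)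
  have := hlow a ha
  rw [dist_zero_right]
  linarith

variable [MeasurableSpace W] (μ : Measure W) [μ.IsAddHaarMeasure]

theorem neBot_nhds_inf_ae : (𝓝 (0 : W) ⊓ ae μ).NeBot := by
  rw [Filter.inf_neBot_iff]
  intro s hs t ht
  have h1 : Dense t := Measure.dense_of_ae (μ := μ) (p := (· ∈ t)) ht
  obtain ⟨u, hus, hu, h0⟩ := mem_nhds_iff.1 hs
  obtain ⟨x, hx, hxt⟩ := h1.inter_open_nonempty u hu ⟨0, h0⟩
  exact ⟨x, hus hx, hxt⟩

variable [NormedSpace ℝ E] [NormedSpace ℝ W] [FiniteDimensional ℝ W] [BorelSpace W]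

/-- Let `G` be a continuous map, on a simplex of dimension `dim W`, with finitely many zeros, near
each of which it agrees with a linear map which is injective on the simplex. If the simplex is
subdivided finely, then the piecewise linear approximation of `G` has as many zeros, modulo 2, as
`G`. -/
theorem eventually_count_push_sd_pow {l₀ : List E} (hl : l₀.length = finrank ℝ W + 1) {G : E → W}
    (hG : ContinuousOn G (convexHull ℝ {x | x ∈ l₀})) (Z : Finset E)
    (hZ : ∀ x ∈ convexHull ℝ {x | x ∈ l₀}, G x = 0 ↔ x ∈ Z)
    (hZl : ∀ z ∈ Z, z ∈ convexHull ℝ {x | x ∈ l₀})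
    (hloc : ∀ z ∈ Z, ∃ M : E →ₗ[ℝ] W, (∀ᶠ x in 𝓝[convexHull ℝ {x | x ∈ l₀}] z, G x = M x) ∧
      Set.InjOn M (convexHull ℝ {x | x ∈ l₀}) ∧
        (0 : W) ∈ interior (convexHull ℝ {x | x ∈ l₀.map M})) :
    ∀ᶠ r in atTop, ∀ᶠ v in 𝓝 (0 : W) ⊓ ae μ,
      count {v} (push G ((sd (finrank ℝ W + 1) ^ r) (single l₀ 1))) = (Z.card : ZMod 2) := by
  classical
  set Δ := convexHull ℝ {x | x ∈ l₀} with hΔdef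
  have hfin : {x | x ∈ l₀}.Finite := l₀.finite_toSet
  have hΔ : IsCompact Δ := hfin.isCompact_convexHull ℝ
  choose! M hMG hMinj hMint using hloc
  have hMz : ∀ z ∈ Z, M z z = 0 := fun z hz =>
    ((hMG z hz).self_of_nhdsWithin (hZl z hz)).symm.trans ((hZ z (hZl z hz)).2 hz)
  obtain ⟨ρ, ⟨hnear, hsep⟩, hρ⟩ : ∃ ρ : ℝ, ((∀ z ∈ Z, ∀ x ∈ Δ, dist x z < ρ → G x = M z x) ∧
      ∀ z ∈ Z, ∀ z' ∈ Z, z ≠ z' → 2 * ρ < dist z z') ∧ 0 < ρ := by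
    refine Eventually.exists (f := 𝓝[>] (0 : ℝ)) ?_
    refine Eventually.and (Eventually.and ?_ ?_) self_mem_nhdsWithin
    · rw [Filter.eventually_all_finset]
      intro z hz
      obtain ⟨ε, hε, h⟩ := Metric.mem_nhdsWithin_iff.1 (hMG z hz)
      filter_upwards [Ioo_mem_nhdsGT hε] with ρ hρ x hx hxz
      exact h ⟨hxz.trans hρ.2, hx⟩
    · rw [Filter.eventually_all_finset]
      intro z hz
      rw [Filter.eventually_all_finset]
      intro z' hz'
      by_cases hne : z = z'
      · exact Eventually.of_forall fun _ h => absurd hne h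
      · filter_upwards [Ioo_mem_nhdsGT (half_pos (dist_pos.2 hne))] with ρ hρ _
        have := hρ.2
        linarith
  have hρ2 := half_pos hρ
  obtain ⟨εG, hεG, hfarG⟩ := exists_disjoint_convexHull_map hΔ
    (U := ⋃ z ∈ Z, Metric.ball z (ρ / 2))
    (isOpen_biUnion fun z _ => Metric.isOpen_ball) hG (fun x hx hxU h => hxU
      (Set.mem_biUnion ((hZ x hx).1 h) (Metric.mem_ball_self hρ2)))
  have hcont : ∀ z ∈ Z, ContinuousOn (M z) Δ := by
    intro z hz
    -- On the simplex, `M z` is the composite of the inclusion in the span of its vertices, which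
    -- is finite-dimensional, with a linear map.
    set S := Submodule.span ℝ {x | x ∈ l₀}
    have : FiniteDimensional ℝ S := FiniteDimensional.span_of_finite ℝ hfin
    have h1 : Continuous ((M z).comp S.subtype) := LinearMap.continuous_of_finiteDimensional _
    rw [continuousOn_iff_continuous_domRestrict]
    have hsub : ∀ x : Δ, (x : E) ∈ S := fun x =>
      convexHull_min Submodule.subset_span S.convex x.2
    exact h1.comp (Continuous.subtype_mk continuous_subtype_val hsub)
  have hfar := fun z (hz : z ∈ Z) => exists_disjoint_convexHull_map hΔ
    (U := Metric.ball z (ρ / 2)) Metric.isOpen_ball (hcont z hz) (fun x hx hxU h => hxU (by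
      rw [hMinj z hz hx (hZl z hz) (h.trans (hMz z hz).symm)]
      exact Metric.mem_ball_self hρ2))
  choose! ε hε hfar using hfar
  obtain ⟨δ, ⟨⟨hδG, hδM⟩, hδρ⟩, hδ⟩ := (((hfarG.and
    ((Filter.eventually_all_finset Z).2 hfar)).and (Ioo_mem_nhdsGT hρ2)).and
      self_mem_nhdsWithin).exists
  filter_upwards [eventually_sd_pow_mem hl hδ] with r hr
  have hv1 : ∀ᶠ v in 𝓝 (0 : W), v ∈ Metric.ball (0 : W) εG ∧
      (∀ z ∈ Z, v ∈ Metric.ball (0 : W) (ε z)) ∧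
      ∀ z ∈ Z, v ∈ convexHull ℝ {x | x ∈ l₀.map (M z)} := by
    refine Eventually.and (Metric.ball_mem_nhds _ hεG) (Eventually.and ?_ ?_)
    · exact (Filter.eventually_all_finset Z).2 fun z hz => Metric.ball_mem_nhds _ (hε z hz)
    · exact (Filter.eventually_all_finset Z).2 fun z hz => mem_interior_iff_mem_nhds.1 (hMint z hz)
  have hv2 : ∀ᵐ v ∂μ, ∀ z ∈ Z, count {v} ((sd (finrank ℝ W + 1) ^ r) (single (l₀.map (M z)) 1)) =
      count {v} (single (l₀.map (M z)) 1) :=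
    (Filter.eventually_all_finset Z).2 fun z hz =>
      ae_count_sd_pow μ (single_mem_supp (by simpa using hl)) r
  filter_upwards [hv1.filter_mono inf_le_left, hv2.filter_mono inf_le_right] with v hv hv'
  obtain ⟨hvG, hvM, hvint⟩ := hv
  have key : count {v} (push G ((sd (finrank ℝ W + 1) ^ r) (single l₀ 1))) =
      ∑ z ∈ Z, count {v} (push (M z) ((sd (finrank ℝ W + 1) ^ r) (single l₀ 1))) := by
    refine supported_induction (p := fun c => count {v} (push G c) =
      ∑ z ∈ Z, count {v} (push (M z) c)) (by simp)
      (fun c c' h h' => by simp only [map_add, h, h', Finset.sum_add_distrib]) (fun l hl => ?_) hr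
    obtain ⟨-, hlΔ, hld⟩ := hl
    have hzero : ∀ z ∈ Z, (∀ x ∈ l, x ∉ Metric.ball z (ρ / 2)) →
        count {v} (push (M z) (single l 1)) = 0 := by
      intro z hz hl'
      rw [push_single]
      refine count_eq_zero (single_mem_supp ?_)
      exact (hδM z hz l (fun x hx => ⟨hlΔ x hx, hl' x hx⟩) hld).mono_right
        (Set.singleton_subset_iff.2 (hvM z hz))
    by_cases hex : ∃ z ∈ Z, ∃ x ∈ l, x ∈ Metric.ball z (ρ / 2)
    · obtain ⟨z, hz, x, hx, hxz⟩ := hex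
      have hxz : dist x z < ρ / 2 := hxz
      rw [Finset.sum_eq_single_of_mem z hz]
      · rw [push_single, push_single]
        congr 2
        refine List.map_congr_left fun y hy => hnear z hz y (hlΔ y hy) ?_
        have h1 := hld y hy x hx
        have h2 := dist_triangle y x z
        linarith [hδρ.2]
      · intro z' hz' hne
        refine hzero z' hz' fun y hy hyz => ?_
        have hyz : dist y z' < ρ / 2 := hyz
        have h1 := hld x hx y hy
        have h2 := dist_triangle z x z'
        have h3 := dist_triangle x y z'
        have h4 := hsep z hz z' hz' hne.symm
        rw [dist_comm z x] at h2
        linarith [hδρ.2]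
    · push Not at hex
      rw [Finset.sum_eq_zero fun z hz => hzero z hz fun x hx => hex z hz x hx, push_single]
      refine count_eq_zero (single_mem_supp ?_)
      refine (hδG l (fun x hx => ⟨hlΔ x hx, ?_⟩) hld).mono_right
        (Set.singleton_subset_iff.2 hvG)
      simp only [Set.mem_iUnion, not_exists]
      exact fun z hz => hex z hz x hx
  rw [key, Finset.sum_congr rfl fun z hz => ?_, Finset.sum_const, nsmul_one]
  rw [push_sd_pow, push_single, hv' z hz, count_single, if_pos]
  exact ⟨v, hvint z hz, rfl⟩

end Local

/-! ### Odd maps -/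

theorem push_neg_prism {E W : Type*} [Neg E] [Neg W] {f g : E → W} (hf : ∀ x, f (-x) = -f x)
    (hg : ∀ x, g (-x) = -g x) (c : Chain E) :
    prism f g (push Neg.neg c) = push Neg.neg (prism f g c) := by
  rw [prism_push, push_prism, show f ∘ Neg.neg = Neg.neg ∘ f from funext hf,
    show g ∘ Neg.neg = Neg.neg ∘ g from funext hg]

theorem eventually_count_segment_eq_zero {W : Type*} [NormedAddCommGroup W]
    [NormedSpace ℝ W] {c : Chain W}
    (h : c ∈ supp {l | (0 : W) ∉ convexHull ℝ {x | x ∈ l}}) :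
    ∀ᶠ v in 𝓝 (0 : W), count (segment ℝ v (-v)) c = 0 := by
  refine supported_induction (p := fun c => ∀ᶠ v in 𝓝 (0 : W), count (segment ℝ v (-v)) c = 0)
    (by simp) (fun c c' h h' => ?_) (fun l hl => ?_) h
  · filter_upwards [h, h'] with v h h'
    rw [map_add, h, h', add_zero]
  · have hcl : IsClosed (convexHull ℝ {x | x ∈ l}) :=
      (l.finite_toSet.isCompact_convexHull ℝ).isClosed
    obtain ⟨ε, hε, hball⟩ := Metric.isOpen_iff.1 hcl.isOpen_compl 0 hl
    filter_upwards [Metric.ball_mem_nhds (0 : W) hε] with v hv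
    refine count_eq_zero (single_mem_supp (Set.disjoint_left.2 fun x hx hxs => ?_))
    have hv' : -v ∈ Metric.ball (0 : W) ε := by simpa using hv
    exact hball ((convex_ball (0 : W) ε).segment_subset hv hv' hxs) hx

section Odd

variable {E W : Type*} [NormedAddCommGroup W]
  [NormedSpace ℝ W] [FiniteDimensional ℝ W] [MeasurableSpace W] [BorelSpace W] (μ : Measure W)
  [μ.IsAddHaarMeasure]

/-- There are odd functions whose values at finitely many points are in general position with
respect to each other and to a finite set of vectors. -/
theorem exists_generic_odd [AddGroup E] [DecidableEq E] (Y : Finset E) (T : Finset W) :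
    ∃ R : E → W, (∀ x, R (-x) = -R x) ∧ ∀ A ⊆ Y, (∀ x ∈ A, -x ∉ A) → ∀ s ⊆ T,
      A.card + s.card ≤ finrank ℝ W → ∀ α : E → ℝ,
        ∑ x ∈ A, α x • R x ∈ Submodule.span ℝ (s : Set W) → ∀ x ∈ A, α x = 0 := by
  classical
  let μ : Measure W := Measure.addHaar
  induction Y using Finset.induction_on with
  | empty =>
    refine ⟨0, by simp, fun A hA => ?_⟩
    rw [Finset.subset_empty.1 hA]
    simp
  | insert x Y hx ih =>
    obtain ⟨R, hR, hgen⟩ := ih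
    by_cases hxx : -x = x
    · refine ⟨R, hR, fun A hA hA' => ?_⟩
      have : x ∉ A := fun h => hA' x h (hxx.symm ▸ h)
      exact hgen A ((Finset.subset_insert_iff_of_notMem this).1 hA) hA'
    obtain ⟨w, hw⟩ : ∃ w : W, ∀ A ∈ Y.powerset, ∀ s ∈ T.powerset,
        A.card + s.card < finrank ℝ W →
          w ∉ Submodule.span ℝ ((s ∪ A.image R : Finset W) : Set W) := by
      have : ∀ᵐ w ∂μ, ∀ A ∈ Y.powerset, ∀ s ∈ T.powerset,
          A.card + s.card < finrank ℝ W →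
            w ∉ Submodule.span ℝ ((s ∪ A.image R : Finset W) : Set W) := by
        rw [Filter.eventually_all_finset]
        intro A _
        rw [Filter.eventually_all_finset]
        intro s _
        by_cases h : A.card + s.card < finrank ℝ W
        · have h1 : (s ∪ A.image R).card < finrank ℝ W := by
            have h1 := Finset.card_union_le s (A.image R)
            have h2 := Finset.card_image_le (s := A) (f := R)
            omega
          filter_upwards [ae_notMem_span_image μ id _ h1] with w hw _
          simpa using hw
        · exact Eventually.of_forall fun _ h' => absurd h' h
      have := neBot_nhds_inf_ae μ
      have hne : (ae μ).NeBot := Filter.NeBot.mono this inf_le_right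
      exact Eventually.exists ‹_›
    set R' : E → W := fun y => if y = x then w else if y = -x then -w else R y with hR'
    have hx1 : R' x = w := if_pos rfl
    have hx2 : R' (-x) = -w := by simp [hR', hxx]
    have hx3 : ∀ y, y ≠ x → y ≠ -x → R' y = R y := fun y h1 h2 => by simp [hR', h1, h2]
    refine ⟨R', fun y => ?_, fun A hA hA' s hs hcard α hsum => ?_⟩
    · by_cases h1 : y = x
      · rw [h1, hx1, hx2]
      by_cases h2 : y = -x
      · rw [h2, hx2, neg_neg, neg_neg, hx1]
      rw [hx3 y h1 h2, hx3 (-y) (fun h => h2 (by rw [← h, neg_neg]))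
        (fun h => h1 (neg_injective h)),
        hR]
    -- The case that the new point `x` or its antipode lies in `A`.
    have main : ∀ e ∈ A, (∃ t : ℝ, t ≠ 0 ∧ R' e = t • w) → (∀ y ∈ A, y ≠ e → y ≠ x ∧ y ≠ -x) →
        ∀ y ∈ A, α y = 0 := by
      rintro e he ⟨t, ht, hte⟩ hy
      have hsub : A.erase e ⊆ Y := fun y h =>
        (Finset.mem_insert.1 (hA (Finset.mem_of_mem_erase h))).resolve_left
          (hy y (Finset.mem_of_mem_erase h) (Finset.ne_of_mem_erase h)).1
      have hcard' : (A.erase e).card + 1 = A.card := Finset.card_erase_add_one he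
      have hsum' : ∑ y ∈ A.erase e, α y • R' y = ∑ y ∈ A.erase e, α y • R y :=
        Finset.sum_congr rfl fun y h => by
          have := hy y (Finset.mem_of_mem_erase h) (Finset.ne_of_mem_erase h)
          rw [hx3 y this.1 this.2]
      rw [← Finset.add_sum_erase A _ he, hsum', hte] at hsum
      have hα : α e = 0 := by
        by_contra hα
        refine hw (A.erase e) (Finset.mem_powerset.2 hsub) s (Finset.mem_powerset.2 hs)
          (by omega) ?_
        have h1 : ∑ y ∈ A.erase e, α y • R y ∈
            Submodule.span ℝ ((s ∪ (A.erase e).image R : Finset W) : Set W) := by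
          refine Submodule.sum_mem _ fun y h => Submodule.smul_mem _ _ (Submodule.subset_span ?_)
          simp only [Finset.coe_union, Finset.coe_image]
          exact Or.inr ⟨y, h, rfl⟩
        have h2 := Submodule.span_mono (R := ℝ)
          (t := ((s ∪ (A.erase e).image R : Finset W) : Set W))
          (by simp) hsum
        have h3 := Submodule.sub_mem _ h2 h1
        rw [add_sub_cancel_right, smul_smul] at h3
        exact (Submodule.smul_mem_iff _ (mul_ne_zero hα ht)).1 h3
      intro y hyA
      by_cases hye : y = e
      · rw [hye, hα]
      · refine hgen (A.erase e) hsub (fun z hz hz' => hA' z (Finset.mem_of_mem_erase hz)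
          (Finset.mem_of_mem_erase hz')) s hs (by omega) α ?_ y (Finset.mem_erase.2 ⟨hye, hyA⟩)
        rwa [hα, zero_smul, zero_add] at hsum
    by_cases hxA : x ∈ A
    · exact main x hxA ⟨1, one_ne_zero, by rw [hx1, one_smul]⟩ fun y hyA hyx =>
        ⟨hyx, fun h => hA' x hxA (h ▸ hyA)⟩
    by_cases hxA' : -x ∈ A
    · exact main (-x) hxA' ⟨-1, by norm_num, by rw [hx2, neg_one_smul]⟩ fun y hyA hyx =>
        ⟨fun h => hxA (h ▸ hyA), hyx⟩
    · refine hgen A ((Finset.subset_insert_iff_of_notMem hxA).1 hA) hA' s hs hcard α ?_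
      rwa [Finset.sum_congr rfl fun y hy => by
        rw [← hx3 y (fun h => hxA (h ▸ hy)) (fun h => hxA' (h ▸ hy))]]

/-- Let `C₂`, `C₁`, `C₀` be chains such that `∂ C₂ = C₁ + t C₁` and `∂ C₁ = C₀ + t C₀`, where
`t` is the antipodal map. If `G` and `R` are odd maps and the linear homotopy between them is
generic on `C₁`, then they have the same degree on `C₂`: the homotopy sweeps out
`y + t y` on `∂ C₂`, where `y` comes from `C₁`, and this covers `v` as many times as `y` covers `v`
and `-v`. The segment between `v` and `-v` crosses the boundary of `y` an even number of times,
since this boundary consists of a part which avoids the origin and of a chain `u + t u`. -/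
theorem eventually_count_push_eq_of_generic [AddCommGroup E] [DecidableEq E] {C₂ C₁ C₀ : Chain E}
    (hC₂ : C₂ ∈ supp {l : List E | l.length = finrank ℝ W + 1})
    (hb₂ : bd C₂ = C₁ + push Neg.neg C₁) (hb₁ : bd C₁ = C₀ + push Neg.neg C₀)
    {G R : E → W} (hG : ∀ x, G (-x) = -G x) (hR : ∀ x, R (-x) = -R x)
    (hC₁ : C₁ ∈ supp {l : List E | l.length = finrank ℝ W ∧ ∀ A B : Finset E, (∀ x ∈ A, x ∈ l) →
      (∀ x ∈ B, x ∈ l) → A.card + B.card ≤ finrank ℝ W →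
        (0 : W) ∉ convexHull ℝ (G '' A ∪ R '' B)}) :
    ∀ᶠ v in 𝓝 (0 : W) ⊓ ae μ, count {v} (push G C₂) = count {v} (push R C₂) := by
  classical
  set d := finrank ℝ W with hd
  set y := prism G R C₁ with hy
  set u := prism G R C₀ with hu
  have h1 : ∀ᵐ v ∂μ, count {v} (bd (prism G R C₂)) = 0 := by
    refine ae_count_bd μ (prism_mem (fun l hl l' hl' _ => ?_) hC₂)
    rw [Set.mem_ofPred_eq, hl', hl]
  have hyb : ∀ᵐ v ∂μ, count {v} y + count {-v} y = count (segment ℝ v (-v)) (bd y) := by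
    have hys : y ∈ supp {l' : List W | l'.length = d + 1 ∧
        ∀ i j : Fin l'.length, i ≠ j → (0 : W) ∉ convexHull ℝ (l'.get '' {i, j}ᶜ)} := by
      refine prism_mem (fun l hl l' hl' hmem => ?_) hC₁
      obtain ⟨hlen, hl⟩ := hl
      refine ⟨by rw [hl', hlen], fun i j hij h0 => ?_⟩
      have hch : ∀ m : Fin l'.length, ∃ x ∈ l, l'.get m = G x ∨ l'.get m = R x :=
        fun m => hmem _ (l'.get_mem m)
      choose e hel heq using hch
      set I : Finset (Fin l'.length) := {i, j}ᶜ
      have hI : I.card + 2 = l'.length := by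
        have := Finset.card_compl_add_card ({i, j} : Finset (Fin l'.length))
        rwa [Finset.card_pair hij, Fintype.card_fin] at this
      have hfil := Finset.card_filter_add_card_filter_not (s := I) (fun m => l'.get m = G (e m))
      refine hl ((I.filter fun m => l'.get m = G (e m)).image e)
        ((I.filter fun m => ¬ l'.get m = G (e m)).image e) ?_ ?_ ?_ (convexHull_mono ?_ h0)
      · intro x hx
        obtain ⟨m, -, rfl⟩ := Finset.mem_image.1 hx
        exact hel m
      · intro x hx
        obtain ⟨m, -, rfl⟩ := Finset.mem_image.1 hx
        exact hel m
      · have h2 := Finset.card_image_le (s := I.filter fun m => l'.get m = G (e m)) (f := e)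
        have h3 := Finset.card_image_le (s := I.filter fun m => ¬ l'.get m = G (e m)) (f := e)
        omega
      · rintro _ ⟨m, hm, rfl⟩
        have hmI : m ∈ I := by simpa [I] using hm
        by_cases hmG : l'.get m = G (e m)
        · refine Or.inl ⟨e m, ?_, hmG.symm⟩
          exact Finset.mem_coe.2 (Finset.mem_image_of_mem _ (Finset.mem_filter.2 ⟨hmI, hmG⟩))
        · refine Or.inr ⟨e m, ?_, ((heq m).resolve_left hmG).symm⟩
          exact Finset.mem_coe.2 (Finset.mem_image_of_mem _ (Finset.mem_filter.2 ⟨hmI, hmG⟩))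
    refine supported_induction (p := fun y => ∀ᵐ v ∂μ, count {v} y + count {-v} y =
      count (segment ℝ v (-v)) (bd y)) (by simp) (fun c c' h h' => ?_) (fun l hl => ?_) hys
    · filter_upwards [h, h'] with v h h'
      simp only [map_add]
      rw [← h, ← h']
      abel
    · rw [bd_single]
      exact ae_count_add_count_neg μ hl.1 hl.2
  have hsegG : ∀ᶠ v in 𝓝 (0 : W), count (segment ℝ v (-v)) (push G C₁) = 0 := by
    refine eventually_count_segment_eq_zero (push_mem (fun l hl h => ?_) hC₁)
    refine hl.2 l.toFinset ∅ (by simp) (by simp)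
      (by simpa [hl.1] using l.toFinset_card_le) (convexHull_mono ?_ h)
    intro x hx
    obtain ⟨a, ha, rfl⟩ := List.mem_map.1 hx
    exact Or.inl ⟨a, by simpa using ha, rfl⟩
  have hsegR : ∀ᶠ v in 𝓝 (0 : W), count (segment ℝ v (-v)) (push R C₁) = 0 := by
    refine eventually_count_segment_eq_zero (push_mem (fun l hl h => ?_) hC₁)
    refine hl.2 ∅ l.toFinset (by simp) (by simp)
      (by simpa [hl.1] using l.toFinset_card_le) (convexHull_mono ?_ h)
    intro x hx
    obtain ⟨a, ha, rfl⟩ := List.mem_map.1 hx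
    exact Or.inr ⟨a, by simpa using ha, rfl⟩
  filter_upwards [h1.filter_mono inf_le_right, hyb.filter_mono inf_le_right,
    hsegG.filter_mono inf_le_left, hsegR.filter_mono inf_le_left] with v h1 hyb hsegG hsegR
  have e1 : bd (prism G R C₂) = push G C₂ + push R C₂ + (y + push Neg.neg y) := by
    rw [bd_prism, hb₂, map_add, push_neg_prism hG hR]
  have e2 : bd y = push G C₁ + push R C₁ + (u + push Neg.neg u) := by
    rw [bd_prism, hb₁, map_add, push_neg_prism hG hR]
  have hseg : -segment ℝ v (-v) = segment ℝ v (-v) := by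
    rw [segment_symm]
    ext x
    constructor
    · rintro ⟨a, b, ha, hb, hab, h⟩
      exact ⟨b, a, hb, ha, by rwa [add_comm], by
        rw [← neg_neg x, ← h]; module⟩
    · rintro ⟨a, b, ha, hb, hab, h⟩
      exact ⟨b, a, hb, ha, by rwa [add_comm], by
        rw [← h]; module⟩
  rw [e2, map_add, map_add, map_add, hsegG, hsegR, count_push_neg, hseg, ZModModule.add_self,
    ZModModule.add_self, add_zero] at hyb
  rw [e1, map_add, map_add, map_add, count_push_neg, Set.neg_singleton, hyb, add_zero,
    ← ZModModule.sub_eq_add, sub_eq_zero] at h1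
  exact h1

end Odd

section Compare

variable {E W : Type*} [NormedAddCommGroup E] [NormedSpace ℝ E] [NormedAddCommGroup W]
  [NormedSpace ℝ W] [FiniteDimensional ℝ W] [MeasurableSpace W] [BorelSpace W] (μ : Measure W)
  [μ.IsAddHaarMeasure]

theorem push_neg_sd_pow (m r : ℕ) (c : Chain E) :
    push Neg.neg ((sd m ^ r) c) = (sd m ^ r) (push Neg.neg c) :=
  push_sd_pow (-LinearMap.id : E →ₗ[ℝ] E) m r c

/-- Two odd maps without zeros on `c₁` have the same degree on a chain `c₂` with
`∂ c₂ = c₁ + t c₁`, where `t` is the antipodal map: both can be compared to a generic odd map of the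
vertices of a fine subdivision. -/
theorem eventually_count_push_eq_of_odd {m : ℕ} (hm : finrank ℝ W = m + 1) {c₂ c₁ c₀ : Chain E}
    (hc₂ : c₂ ∈ supp {l : List E | l.length = m + 2})
    (hb₂ : bd c₂ = c₁ + push Neg.neg c₁) (hb₁ : bd c₁ = c₀ + push Neg.neg c₀)
    {G G' : E → W} (hG : ∀ x, G (-x) = -G x) (hG' : ∀ x, G' (-x) = -G' x)
    (hc₁ : c₁ ∈ supp {l : List E | l.length = m + 1 ∧
      (∀ x ∈ convexHull ℝ {x | x ∈ l}, -x ∉ convexHull ℝ {x | x ∈ l}) ∧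
      (ContinuousOn G (convexHull ℝ {x | x ∈ l}) ∧ ∀ x ∈ convexHull ℝ {x | x ∈ l}, G x ≠ 0) ∧
      ContinuousOn G' (convexHull ℝ {x | x ∈ l}) ∧ ∀ x ∈ convexHull ℝ {x | x ∈ l}, G' x ≠ 0}) :
    ∀ᶠ r in atTop, ∀ᶠ v in 𝓝 (0 : W) ⊓ ae μ,
      count {v} (push G ((sd (m + 2) ^ r) c₂)) = count {v} (push G' ((sd (m + 2) ^ r) c₂)) := by
  classical
  have h1 : ∀ᶠ r in atTop, (sd (m + 1) ^ r) c₁ ∈ supp {l : List E | l.length = m + 1 ∧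
      (∀ x ∈ l, -x ∉ l) ∧ (0 : W) ∉ convexHull ℝ {x | x ∈ l.map G} ∧
        (0 : W) ∉ convexHull ℝ {x | x ∈ l.map G'}} := by
    refine supported_induction (p := fun c => ∀ᶠ r in atTop, (sd (m + 1) ^ r) c ∈
      supp {l : List E | l.length = m + 1 ∧ (∀ x ∈ l, -x ∉ l) ∧
        (0 : W) ∉ convexHull ℝ {x | x ∈ l.map G} ∧ (0 : W) ∉ convexHull ℝ {x | x ∈ l.map G'}})
      (Eventually.of_forall fun r => by rw [map_zero]; exact Submodule.zero_mem _)
      (fun c c' h h' => ?_) (fun l hl => ?_) hc₁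
    · filter_upwards [h, h'] with r h h'
      rw [map_add]
      exact Submodule.add_mem _ h h'
    · obtain ⟨hlen, hanti, ⟨hcG, hG0⟩, hcG', hG'0⟩ := hl
      have hΔ := l.finite_toSet.isCompact_convexHull ℝ
      obtain ⟨ε, hε, hfar⟩ := exists_disjoint_convexHull_map hΔ isOpen_empty hcG
        fun x hx _ => hG0 x hx
      obtain ⟨ε', hε', hfar'⟩ := exists_disjoint_convexHull_map hΔ isOpen_empty hcG'
        fun x hx _ => hG'0 x hx
      obtain ⟨δ, ⟨h1, h2⟩, hδ⟩ := ((hfar.and hfar').and self_mem_nhdsWithin).exists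
      filter_upwards [eventually_sd_pow_mem hlen hδ] with r hr
      refine supported_mono (fun l' hl' => ?_) hr
      obtain ⟨hlen', hsub, hd⟩ := hl'
      refine ⟨hlen', fun x hx hx' => hanti x (hsub x hx) (hsub _ hx'), fun h => ?_, fun h => ?_⟩
      · exact Set.disjoint_left.1 (h1 l' (fun x hx => ⟨hsub x hx, Set.notMem_empty _⟩) hd) h
          (Metric.mem_ball_self hε)
      · exact Set.disjoint_left.1 (h2 l' (fun x hx => ⟨hsub x hx, Set.notMem_empty _⟩) hd) h
          (Metric.mem_ball_self hε')
  filter_upwards [h1] with r hr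
  set C₁ := (sd (m + 1) ^ r) c₁ with hC₁
  set Y : Finset E := C₁.support.biUnion List.toFinset
  obtain ⟨R, hR, hgen⟩ := exists_generic_odd Y (Y.image G ∪ Y.image G')
  have hB₂ : bd ((sd (m + 2) ^ r) c₂) = C₁ + push Neg.neg C₁ := by
    rw [bd_sd_pow hc₂, hb₂, map_add, push_neg_sd_pow]
  have hB₁ : bd C₁ = (sd m ^ r) c₀ + push Neg.neg ((sd m ^ r) c₀) := by
    rw [hC₁, bd_sd_pow (supported_mono (fun l hl => hl.1) hc₁), hb₁, map_add, push_neg_sd_pow]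
  -- `Q` is one of the two maps.
  have main : ∀ Q : E → W, (∀ x, Q (-x) = -Q x) → Y.image Q ⊆ Y.image G ∪ Y.image G' →
      C₁ ∈ supp {l : List E | l.length = m + 1 ∧ (∀ x ∈ l, -x ∉ l) ∧
        (0 : W) ∉ convexHull ℝ {x | x ∈ l.map Q}} →
      ∀ᶠ v in 𝓝 (0 : W) ⊓ ae μ, count {v} (push Q ((sd (m + 2) ^ r) c₂)) =
        count {v} (push R ((sd (m + 2) ^ r) c₂)) := by
    intro Q hQ hQY hQ1
    refine eventually_count_push_eq_of_generic μ (by rw [hm]; exact sd_pow_mem_length hc₂ r)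
      hB₂ hB₁ hQ hR ?_
    rw [mem_supported] at hQ1 ⊢
    intro l hl
    obtain ⟨hlen, hanti, hQ0⟩ := hQ1 hl
    have hlY : ∀ x ∈ l, x ∈ Y := fun x hx => Finset.mem_biUnion.2 ⟨l, hl, by simpa using hx⟩
    refine ⟨by rw [hm, hlen], fun A B hA hB hcard h0 => ?_⟩
    have e1 : Q '' A ∪ R '' B = (Sum.elim (fun x : A => Q x) (fun x : B => R x)) '' Set.univ := by
      ext w
      simp
    rw [e1, mem_convexHull_image_iff] at h0
    obtain ⟨z, hz, hz1, hz0, -⟩ := h0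
    rw [Fintype.sum_sum_type] at hz1 hz0
    simp only [Sum.elim_inl, Sum.elim_inr] at hz0
    set α : E → ℝ := fun x => if h : x ∈ B then z (Sum.inr ⟨x, h⟩) else 0 with hα
    have hαz : ∀ x : B, α x = z (Sum.inr x) := fun x => by simp [hα]
    have hsum : ∑ x ∈ B, α x • R x = ∑ x : B, z (Sum.inr x) • R x := by
      rw [← Finset.sum_coe_sort B]
      exact Finset.sum_congr rfl fun x _ => by rw [hαz]
    have hαzero := hgen B (fun x hx => hlY x (hB x hx))
      (fun x hx hx' => hanti x (hB x hx) (hB _ hx'))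
      (A.image Q) ((Finset.image_subset_image fun x hx => hlY x (hA x hx)).trans hQY)
      (by have := Finset.card_image_le (s := A) (f := Q); omega) α (by
        rw [hsum, ← add_eq_zero_iff_neg_eq.1 hz0]
        refine Submodule.neg_mem _ (Submodule.sum_mem _ fun x _ => Submodule.smul_mem _ _
          (Submodule.subset_span ?_))
        exact Finset.mem_coe.2 (Finset.mem_image_of_mem _ x.2))
    have hz2 : ∀ x : B, z (Sum.inr x) = 0 := fun x => by rw [← hαz, hαzero x x.2]
    simp only [hz2, zero_smul, Finset.sum_const_zero, add_zero] at hz1 hz0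
    refine hQ0 (convexHull_mono (s := (fun x : A => Q x) '' Set.univ) ?_
      ((mem_convexHull_image_iff _ _ _).2 ⟨fun x => z (Sum.inl x), fun x => hz _, hz1, hz0,
        fun x hx => absurd (Set.mem_univ x) hx⟩))
    rintro _ ⟨x, -, rfl⟩
    exact List.mem_map_of_mem (hA x x.2)
  filter_upwards [main G hG Finset.subset_union_left
      (supported_mono (fun l hl => And.intro hl.1 (And.intro hl.2.1 hl.2.2.1)) hr),
    main G' hG' Finset.subset_union_right
      (supported_mono (fun l hl => And.intro hl.1 (And.intro hl.2.1 hl.2.2.2)) hr)] with v hv hv'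
  rw [hv, hv']

end Compare

/-! ### Nondegenerate zeros -/

theorem bdList_eq_sum_erase {X : Type*} [DecidableEq X] {l : List X} (h : l.Nodup) :
    bdList l = ∑ a ∈ l.toFinset, single (l.erase a) 1 := by
  induction l with
  | nil => simp [bdList]
  | cons a l ih =>
    obtain ⟨ha, hl⟩ := List.nodup_cons.1 h
    rw [bdList, ih hl, List.toFinset_cons, Finset.sum_insert (by simpa using ha), map_sum]
    congr 1
    · simp
    · refine Finset.sum_congr rfl fun b hb => ?_
      have : b ≠ a := by rintro rfl; exact ha (by simpa using hb)
      rw [cone_single, List.erase_cons_tail (by simpa using this.symm)]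

theorem sort_erase {X : Type*} [LinearOrder X] (s : Finset X) (a : X) :
    (s.erase a).sort = s.sort.erase a := by
  have h1 : (s.sort.erase a).Nodup := (s.sort_nodup (· ≤ ·)).erase a
  have h2 : (s.sort.erase a).toFinset = s.erase a := by
    ext b
    rw [List.mem_toFinset, (s.sort_nodup (· ≤ ·)).mem_erase_iff, Finset.mem_sort, Finset.mem_erase]
  rw [← h2]
  exact (List.toFinset_sort (· ≤ ·) h1).2 ((s.pairwise_sort (· ≤ ·)).sublist List.erase_sublist)

theorem bdList_map_sort {X Y : Type*} [LinearOrder X] (f : X → Y) (s : Finset X) :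
    bdList (s.sort.map f) = ∑ a ∈ s, single ((s.erase a).sort.map f) 1 := by
  rw [← push_bdList, bdList_eq_sum_erase (s.sort_nodup (· ≤ ·)), Finset.sort_toFinset, map_sum]
  exact Finset.sum_congr rfl fun a _ => by rw [push_single, sort_erase]

/-- A linear map to a space of dimension `d` which is nondegenerate on a simplex of dimension `d` is
injective on it, and maps its interior to the interior of its image. -/
theorem injOn_and_mem_interior {E W : Type*} [AddCommGroup E] [Module ℝ E] [NormedAddCommGroup W]
    [NormedSpace ℝ W] [FiniteDimensional ℝ W] {l : List E} (hl : l.length = finrank ℝ W + 1)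
    {M : E →ₗ[ℝ] W} (hM : (vectorSpan ℝ (convexHull ℝ {x | x ∈ l})).map M = ⊤)
    {z : Fin l.length → ℝ} (hz : ∀ i, 0 < z i) (hz1 : ∑ i, z i = 1)
    (hz0 : M (∑ i, z i • l.get i) = 0) :
    Set.InjOn M (convexHull ℝ {x | x ∈ l}) ∧
      (0 : W) ∈ interior (convexHull ℝ {x | x ∈ l.map M}) := by
  set p : Fin l.length → W := fun i => M (l.get i) with hp
  have hrange : Set.range p = M '' {x | x ∈ l} := by
    rw [setOf_mem_eq_image, Set.image_univ, ← Set.range_comp]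
    rfl
  have hspan : vectorSpan ℝ (Set.range p) = ⊤ := by
    rw [hrange, ← hM, ← direction_affineSpan ℝ (convexHull ℝ _), affineSpan_convexHull,
      direction_affineSpan]
    exact (AffineMap.map_vectorSpan M.toAffineMap).symm
  have hind : AffineIndependent ℝ p := by
    rw [affineIndependent_iff_finrank_vectorSpan_eq ℝ p (n := finrank ℝ W) (by simp [hl]), hspan,
      finrank_top]
  have htop : affineSpan ℝ (Set.range p) = ⊤ := by
    have : Nonempty (Fin l.length) := ⟨⟨0, by omega⟩⟩
    rw [AffineSubspace.affineSpan_eq_top_iff_vectorSpan_eq_top_of_nonempty ℝ W W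
      (Set.range_nonempty p), hspan]
  have hz0' : ∑ i, z i • p i = 0 := by
    rw [← hz0, map_sum]
    simp [hp]
  constructor
  · intro x hx y hy hxy
    rw [setOf_mem_eq_image, mem_convexHull_image_iff] at hx hy
    obtain ⟨a, -, ha1, rfl, -⟩ := hx
    obtain ⟨b, -, hb1, rfl, -⟩ := hy
    have h1 := (affineIndependent_iff.1 hind) Finset.univ (a - b)
      (by simp [Finset.sum_sub_distrib, ha1, hb1])
      (by
        rw [map_sum, map_sum] at hxy
        simp only [map_smul] at hxy
        simp only [Pi.sub_apply, sub_smul, Finset.sum_sub_distrib, hp]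
        exact sub_eq_zero.2 hxy)
    have h2 : a = b := funext fun i => sub_eq_zero.1 (h1 i (Finset.mem_univ i))
    rw [h2]
  · let B : AffineBasis (Fin l.length) ℝ W := ⟨p, hind, htop⟩
    have hB : {x | x ∈ l.map M} = Set.range B := by
      change _ = Set.range p
      rw [hrange]
      ext x
      simp
    rw [hB, B.interior_convexHull]
    intro i
    have h1 : Finset.univ.affineCombination ℝ p z = 0 := by
      rw [Finset.affineCombination_eq_linear_combination _ _ _ hz1, hz0']
    have h2 := B.coord_apply_combination_of_mem (Finset.mem_univ i) hz1
    change B.coord i (Finset.univ.affineCombination ℝ p z) = z i at h2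
    rw [h1] at h2
    rw [h2]
    exact hz i

end ListChain

namespace VanKampen

open Finsupp MeasureTheory Module Filter Topology ListChain

variable {n k : ℕ}

/-! ### The deleted join -/

/-- The vertices of the simplex of the deleted join which corresponds to the pair `σ`, `τ`: the
vertex `i` of `σ` becomes the basis vector `e i`, the vertex `i` of `τ` becomes `-e i`. -/
noncomputable def signed (σ : Finset (Fin (n + 1))) (i : Fin (n + 1)) : Fin (n + 1) → ℝ :=
  Pi.single i (if i ∈ σ then 1 else -1)

/-- The simplex of the deleted join which corresponds to the pair `σ`, `τ` of disjoint simplices.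
The deleted join is realized in the boundary of the cross-polytope; the exchange of the factors is
the antipodal map. -/
noncomputable def cellList (σ τ : Finset (Fin (n + 1))) : List (Fin (n + 1) → ℝ) :=
  (σ ∪ τ).sort.map (signed σ)

theorem length_cellList {σ τ : Finset (Fin (n + 1))} (h : Disjoint σ τ) :
    (cellList σ τ).length = σ.card + τ.card := by
  rw [cellList, List.length_map, Finset.length_sort, Finset.card_union_of_disjoint h]

theorem bdList_cellList (σ τ : Finset (Fin (n + 1))) :
    bdList (cellList σ τ) = ∑ i ∈ σ ∪ τ, single (cellList (σ.erase i) (τ.erase i)) 1 := by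
  rw [cellList, bdList_map_sort]
  refine Finset.sum_congr rfl fun i _ => ?_
  rw [cellList, ← Finset.erase_union_distrib]
  congr 1
  refine List.map_congr_left fun j hj => ?_
  have hj : j ≠ i := by simp only [Finset.mem_sort] at hj; exact Finset.ne_of_mem_erase hj
  simp [signed, hj]

theorem map_neg_cellList {σ τ : Finset (Fin (n + 1))} (h : Disjoint σ τ) :
    (cellList σ τ).map Neg.neg = cellList τ σ := by
  rw [cellList, cellList, List.map_map, Finset.union_comm]
  refine List.map_congr_left fun j hj => ?_
  rw [Finset.mem_sort, Finset.mem_union] at hj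
  have h1 : j ∈ σ → j ∉ τ := fun h1 h2 => Finset.disjoint_left.1 h h1 h2
  rw [Function.comp_apply, signed, signed, ← Pi.single_neg]
  congr 1
  by_cases hσ : j ∈ σ
  · simp [hσ, h1 hσ]
  · simp [hσ, hj.resolve_right hσ]

/-- The geometric simplex spanned by `cellList σ τ`. -/
def cellSet (σ τ : Finset (Fin (n + 1))) : Set (Fin (n + 1) → ℝ) :=
  {x | (∀ i ∈ σ, 0 ≤ x i) ∧ (∀ i ∈ τ, x i ≤ 0) ∧ (∀ i, i ∉ σ → i ∉ τ → x i = 0) ∧ ∑ i, |x i| = 1}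

theorem setOf_mem_cellList (σ τ : Finset (Fin (n + 1))) :
    {x | x ∈ cellList σ τ} = signed σ '' {i | i ∈ σ ∪ τ} := by
  ext x
  simp only [cellList, Set.mem_ofPred_eq, List.mem_map, Finset.mem_sort, Set.mem_image]

theorem convexHull_cellList {σ τ : Finset (Fin (n + 1))} (h : Disjoint σ τ) :
    convexHull ℝ {x | x ∈ cellList σ τ} = cellSet σ τ := by
  have hsum : ∀ (z : Fin (n + 1) → ℝ) (j : Fin (n + 1)),
      (∑ i, z i • signed σ i) j = z j * (if j ∈ σ then 1 else -1) := by
    intro z j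
    rw [Finset.sum_apply, Finset.sum_eq_single j]
    · simp [signed]
    · intro i _ hij
      simp [signed, hij.symm]
    · simp
  ext x
  rw [setOf_mem_cellList, mem_convexHull_image_iff]
  constructor
  · rintro ⟨z, hz, hz1, rfl, hzS⟩
    have hz : ∀ i, 0 ≤ z i := hz
    refine ⟨fun i hi => ?_, fun i hi => ?_, fun i hi hi' => ?_, ?_⟩
    · rw [hsum, if_pos hi, mul_one]; exact hz i
    · rw [hsum, if_neg fun h' => Finset.disjoint_left.1 h h' hi]
      linarith [hz i]
    · rw [hsum, hzS i (by simp [hi, hi']), zero_mul]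
    · rw [← hz1]
      refine Finset.sum_congr rfl fun i _ => ?_
      rw [hsum, abs_mul, abs_of_nonneg (hz i)]
      split_ifs <;> simp
  · rintro ⟨h1, h2, h3, h4⟩
    refine ⟨fun i => |x i|, fun i => abs_nonneg _, h4, funext fun j => ?_, fun i hi => ?_⟩
    · rw [hsum]
      by_cases hσ : j ∈ σ
      · rw [if_pos hσ, mul_one, abs_of_nonneg (h1 j hσ)]
      · rw [if_neg hσ]
        by_cases hτ : j ∈ τ
        · rw [abs_of_nonpos (h2 j hτ)]; ring
        · rw [h3 j hσ hτ]; simp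
    · have : x i = 0 := h3 i (fun h' => hi (by simp [h'])) (fun h' => hi (by simp [h']))
      simp [this]

theorem neg_notMem_cellSet {σ τ : Finset (Fin (n + 1))} {x : Fin (n + 1) → ℝ}
    (hx : x ∈ cellSet σ τ) : -x ∉ cellSet σ τ := by
  intro hx'
  obtain ⟨h1, h2, h3, h4⟩ := hx
  have : ∀ i, x i = 0 := by
    intro i
    by_cases hσ : i ∈ σ
    · have := hx'.1 i hσ
      simp only [Pi.neg_apply] at this
      linarith [h1 i hσ]
    by_cases hτ : i ∈ τ
    · have := hx'.2.1 i hτ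
      simp only [Pi.neg_apply] at this
      linarith [h2 i hτ]
    exact h3 i hσ hτ
  simp [this] at h4

/-- Nondegeneracy on a simplex of the deleted join, at a point all of whose coordinates are nonzero.
-/
theorem injOn_and_mem_interior_cell {W : Type*} [NormedAddCommGroup W]
    [NormedSpace ℝ W] [FiniteDimensional ℝ W] {σ τ : Finset (Fin (n + 1))} (h : Disjoint σ τ)
    (hcard : σ.card + τ.card = finrank ℝ W + 1) {M : (Fin (n + 1) → ℝ) →ₗ[ℝ] W}
    (hM : (vectorSpan ℝ (cellSet σ τ)).map M = ⊤) {x : Fin (n + 1) → ℝ} (hx : x ∈ cellSet σ τ)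
    (hxσ : ∀ i ∈ σ, x i ≠ 0) (hxτ : ∀ i ∈ τ, x i ≠ 0) (hx0 : M x = 0) :
    Set.InjOn M (convexHull ℝ {x | x ∈ cellList σ τ}) ∧
      (0 : W) ∈ interior (convexHull ℝ {x | x ∈ (cellList σ τ).map M}) := by
  rw [← convexHull_cellList h] at hx hM
  have hx' := hx
  rw [setOf_mem_eq_image, mem_convexHull_image_iff] at hx'
  obtain ⟨z, hz, hz1, rfl, -⟩ := hx'
  refine injOn_and_mem_interior ((length_cellList h).trans hcard) hM (fun m => ?_) hz1 hx0
  -- If the coefficient of a vertex were zero, the corresponding coordinate of `x` would vanish.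
  refine lt_of_le_of_ne (hz m) fun hm => ?_
  have hnd : (cellList σ τ).Nodup := by
    refine List.Nodup.map (fun i j hij => ?_) (Finset.sort_nodup _ _)
    by_contra hne
    have := congrFun hij i
    simp only [signed, Pi.single_eq_same, Pi.single_eq_of_ne hne] at this
    split_ifs at this <;> norm_num at this
  obtain ⟨i, hi, hie⟩ := List.mem_map.1 ((cellList σ τ).get_mem m)
  rw [Finset.mem_sort, Finset.mem_union] at hi
  have hxi : (∑ j, z j • (cellList σ τ).get j) i = 0 := by
    rw [Finset.sum_apply]
    refine Finset.sum_eq_zero fun j _ => ?_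
    by_cases hjm : j = m
    · rw [hjm, ← hm]; simp
    · obtain ⟨i', -, hie'⟩ := List.mem_map.1 ((cellList σ τ).get_mem j)
      have hii : i ≠ i' := by
        rintro rfl
        exact hjm ((List.nodup_iff_injective_get.1 hnd) (hie'.symm.trans hie))
      rw [← hie', Pi.smul_apply, signed, Pi.single_eq_of_ne hii, smul_zero]
  rcases hi with hi | hi
  · exact hxσ i hi hxi
  · exact hxτ i hi hxi

/-! ### The map of the deleted join -/

/-- The radial extension of a map of a simplex to the cone over it. -/
noncomputable def radial {F : Type*} [AddCommGroup F] [Module ℝ F] (g : (Fin (n + 1) → ℝ) → F)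
    (X : Fin (n + 1) → ℝ) : F :=
  (∑ i, X i) • g ((∑ i, X i)⁻¹ • X)

/-- The positive part of a vector. -/
def posPartVec (x : Fin (n + 1) → ℝ) : Fin (n + 1) → ℝ := fun i => max (x i) 0

/-- The odd map of the deleted join which is induced by a map `g` of `|K|`; its zeros are the pairs
of points of disjoint simplices with the same image under `g`. -/
noncomputable def joinMap {F : Type*} [AddCommGroup F] [Module ℝ F] (g : (Fin (n + 1) → ℝ) → F)
    (x : Fin (n + 1) → ℝ) : F × ℝ :=
  (radial g (posPartVec x) - radial g (posPartVec (-x)), ∑ i, x i)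

theorem joinMap_neg {F : Type*} [AddCommGroup F] [Module ℝ F] (g : (Fin (n + 1) → ℝ) → F)
    (x : Fin (n + 1) → ℝ) : joinMap g (-x) = -joinMap g x := by
  simp [joinMap]

theorem posPartVec_eq {σ τ : Finset (Fin (n + 1))} {x : Fin (n + 1) → ℝ}
    (hx : x ∈ cellSet σ τ) (i : Fin (n + 1)) :
    posPartVec x i = if i ∈ σ then x i else 0 := by
  obtain ⟨h1, h2, h3, -⟩ := hx
  simp only [posPartVec]
  split_ifs with hσ
  · exact max_eq_left (h1 i hσ)
  · by_cases hτ : i ∈ τ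
    · exact max_eq_right (h2 i hτ)
    · rw [h3 i hσ hτ, max_self]

theorem neg_mem_cellSet {σ τ : Finset (Fin (n + 1))} {x : Fin (n + 1) → ℝ}
    (hx : x ∈ cellSet σ τ) : -x ∈ cellSet τ σ := by
  obtain ⟨h1, h2, h3, h4⟩ := hx
  exact ⟨fun i hi => by simpa using h2 i hi, fun i hi => by simpa using h1 i hi,
    fun i hi hi' => by simpa using h3 i hi' hi, by simpa using h4⟩

theorem isCompact_geomSimplex (σ : Finset (Fin (n + 1))) : IsCompact (geomSimplex σ) := by
  have h1 : IsClosed {x : Fin (n + 1) → ℝ | ∀ i ∉ σ, x i = 0} := by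
    simp only [Set.ofPred_forall]
    exact isClosed_iInter fun i => isClosed_iInter fun _ =>
      isClosed_eq (continuous_apply i) continuous_const
  exact (isCompact_stdSimplex ℝ (Fin (n + 1))).inter_right h1

theorem smul_mem_geomSimplex {σ : Finset (Fin (n + 1))} {X : Fin (n + 1) → ℝ} (h0 : ∀ i, 0 ≤ X i)
    (hσ : ∀ i ∉ σ, X i = 0) (hX : ∑ i, X i ≠ 0) : (∑ i, X i)⁻¹ • X ∈ geomSimplex σ := by
  refine ⟨⟨fun i => ?_, ?_⟩, fun i hi => by simp [hσ i hi]⟩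
  · exact mul_nonneg (inv_nonneg.2 (Finset.sum_nonneg fun i _ => h0 i)) (h0 i)
  · simp only [Pi.smul_apply, smul_eq_mul, ← Finset.mul_sum]
    exact inv_mul_cancel₀ hX

theorem continuousOn_radial {F : Type*} [NormedAddCommGroup F] [NormedSpace ℝ F]
    {g : (Fin (n + 1) → ℝ) → F} {σ : Finset (Fin (n + 1))} (hg : ContinuousOn g (geomSimplex σ)) :
    ContinuousOn (radial g) {X | (∀ i, 0 ≤ X i) ∧ ∀ i ∉ σ, X i = 0} := by
  intro X hX
  have hs : Continuous fun X : Fin (n + 1) → ℝ => ∑ i, X i := by fun_prop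
  by_cases h0 : ∑ i, X i = 0
  · obtain ⟨C, hC⟩ := (isCompact_geomSimplex σ).exists_bound_of_continuousOn hg
    have hX0 : radial g X = 0 := by rw [radial, h0, zero_smul]
    rw [ContinuousWithinAt, hX0]
    have hlim : Tendsto (fun X : Fin (n + 1) → ℝ => (∑ i, X i) * C)
        (𝓝[{X | (∀ i, 0 ≤ X i) ∧ ∀ i ∉ σ, X i = 0}] X) (𝓝 0) := by
      have := (hs.mul_const C).tendsto X
      rw [h0, zero_mul] at this
      exact this.mono_left nhdsWithin_le_nhds
    refine squeeze_zero_norm' ?_ hlim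
    filter_upwards [self_mem_nhdsWithin] with Y hY
    have hY0 : 0 ≤ ∑ i, Y i := Finset.sum_nonneg fun i _ => hY.1 i
    rw [radial, norm_smul, Real.norm_of_nonneg hY0]
    by_cases hY1 : ∑ i, Y i = 0
    · rw [hY1, zero_mul, zero_mul]
    · exact mul_le_mul_of_nonneg_left (hC _ (smul_mem_geomSimplex hY.1 hY.2 hY1)) hY0
  · refine ContinuousWithinAt.smul hs.continuousWithinAt ?_
    have hev : ∀ᶠ Y in 𝓝[{X | (∀ i, 0 ≤ X i) ∧ ∀ i ∉ σ, X i = 0}] X,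
        (∑ i, Y i)⁻¹ • Y ∈ geomSimplex σ := by
      filter_upwards [self_mem_nhdsWithin,
        (hs.continuousAt.eventually_ne h0).filter_mono nhdsWithin_le_nhds] with Y hY hY1
      exact smul_mem_geomSimplex hY.1 hY.2 hY1
    have hlim : Tendsto (fun Y : Fin (n + 1) → ℝ => (∑ i, Y i)⁻¹ • Y)
        (𝓝[{X | (∀ i, 0 ≤ X i) ∧ ∀ i ∉ σ, X i = 0}] X) (𝓝 ((∑ i, X i)⁻¹ • X)) :=
      (((hs.continuousAt.inv₀ h0).smul continuousAt_id).tendsto).mono_left nhdsWithin_le_nhds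
    exact (hg _ (smul_mem_geomSimplex hX.1 hX.2 h0)).tendsto.comp
      (tendsto_nhdsWithin_iff.2 ⟨hlim, hev⟩)

theorem continuous_posPartVec : Continuous (posPartVec (n := n)) :=
  continuous_pi fun i => (continuous_apply i).max continuous_const

theorem posPartVec_mapsTo (σ τ : Finset (Fin (n + 1))) :
    Set.MapsTo posPartVec (cellSet σ τ) {X | (∀ i, 0 ≤ X i) ∧ ∀ i ∉ σ, X i = 0} := fun x hx =>
  ⟨fun i => le_max_right _ _, fun i hi => by rw [posPartVec_eq hx, if_neg hi]⟩

theorem continuousOn_joinMap {F : Type*} [NormedAddCommGroup F] [NormedSpace ℝ F]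
    {g : (Fin (n + 1) → ℝ) → F} {σ τ : Finset (Fin (n + 1))}
    (hσ : ContinuousOn g (geomSimplex σ)) (hτ : ContinuousOn g (geomSimplex τ)) :
    ContinuousOn (joinMap g) (cellSet σ τ) := by
  refine ContinuousOn.prodMk (ContinuousOn.sub ?_ ?_) (by fun_prop)
  · exact (continuousOn_radial hσ).comp continuous_posPartVec.continuousOn (posPartVec_mapsTo σ τ)
  · exact (continuousOn_radial hτ).comp (continuous_posPartVec.comp continuous_neg).continuousOn
      fun x hx => posPartVec_mapsTo τ σ (neg_mem_cellSet hx)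

theorem continuousOn_of_isPL {F : Type*} [NormedAddCommGroup F] [NormedSpace ℝ F]
    {g : (Fin (n + 1) → ℝ) → F} (hg : IsPL k g) : ContinuousOn g (skeleton n (k + 1)) := by
  obtain ⟨T, hfin, hspace, -, hT⟩ := hg
  rw [← hspace, Geometry.SimplicialComplex.space]
  rw [Set.biUnion_eq_iUnion]
  have : Finite T.faces := hfin
  refine LocallyFinite.continuousOn_iUnion (locallyFinite_of_finite _) (fun s => ?_) fun s => ?_
  · exact (s.1.finite_toSet.isCompact_convexHull ℝ).isClosed
  · obtain ⟨A, hA⟩ := hT s.1 s.2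
    exact A.continuous_of_finiteDimensional.continuousOn.congr hA

theorem geomSimplex_subset_skeleton {c : ℕ} {σ : Finset (Fin (n + 1))} (h : σ.card ≤ c) :
    geomSimplex σ ⊆ skeleton n c := fun _ hx => ⟨σ, h, hx⟩

/-- The point of the deleted join which corresponds to the points `y` and `y'`. -/
theorem join_mem_cellSet {σ τ : Finset (Fin (n + 1))} (h : Disjoint σ τ) {y y' : Fin (n + 1) → ℝ}
    (hy : y ∈ geomSimplex σ) (hy' : y' ∈ geomSimplex τ) :
    (2⁻¹ : ℝ) • (y - y') ∈ cellSet σ τ := by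
  have h1 : ∀ i, |y i - y' i| = y i + y' i := by
    intro i
    have := hy.1.1 i
    have := hy'.1.1 i
    by_cases hi : i ∈ σ
    · rw [hy'.2 i (Finset.disjoint_left.1 h hi), sub_zero, add_zero, abs_of_nonneg (hy.1.1 i)]
    · rw [hy.2 i hi, zero_sub, zero_add, abs_neg, abs_of_nonneg (hy'.1.1 i)]
  refine ⟨fun i hi => ?_, fun i hi => ?_, fun i hi hi' => ?_, ?_⟩
  · have := hy.1.1 i
    simp [hy'.2 i (Finset.disjoint_left.1 h hi), this]
  · have := hy'.1.1 i
    simp [hy.2 i (Finset.disjoint_right.1 h hi), this]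
  · simp [hy.2 i hi, hy'.2 i hi']
  · simp only [Pi.smul_apply, Pi.sub_apply, smul_eq_mul, abs_mul, h1, ← Finset.mul_sum,
      Finset.sum_add_distrib, hy.1.2, hy'.1.2]
    norm_num

theorem posPartVec_sub_neg (x : Fin (n + 1) → ℝ) : posPartVec x - posPartVec (-x) = x := by
  funext i
  simp only [posPartVec, Pi.sub_apply, Pi.neg_apply]
  rcases le_total (x i) 0 with h | h
  · rw [max_eq_right h, max_eq_left (by linarith)]; ring
  · rw [max_eq_left h, max_eq_right (by linarith)]; ring

theorem sum_posPartVec {σ τ : Finset (Fin (n + 1))} {x : Fin (n + 1) → ℝ}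
    (hx : x ∈ cellSet σ τ) (h0 : ∑ i, x i = 0) : ∑ i, posPartVec x i = 2⁻¹ := by
  have h1 : ∀ i, posPartVec x i = 2⁻¹ * (x i + |x i|) := by
    intro i
    simp only [posPartVec]
    rcases le_total (x i) 0 with h | h
    · rw [max_eq_right h, abs_of_nonpos h]; ring
    · rw [max_eq_left h, abs_of_nonneg h]; ring
  rw [Finset.sum_congr rfl fun i _ => h1 i, ← Finset.mul_sum, Finset.sum_add_distrib, h0, hx.2.2.2]
  norm_num

/-- The zeros of `joinMap g` on the simplex `σ * τ` of the deleted join are the pairs of points of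
`σ` and `τ` with the same image. -/
theorem joinMap_eq_zero {F : Type*} [AddCommGroup F] [Module ℝ F]
    {g : (Fin (n + 1) → ℝ) → F} {σ τ : Finset (Fin (n + 1))}
    {x : Fin (n + 1) → ℝ} (hx : x ∈ cellSet σ τ) (h0 : joinMap g x = 0) :
    (2 : ℝ) • posPartVec x ∈ geomSimplex σ ∧ (2 : ℝ) • posPartVec (-x) ∈ geomSimplex τ ∧
      g ((2 : ℝ) • posPartVec x) = g ((2 : ℝ) • posPartVec (-x)) := by
  rw [joinMap, Prod.mk_eq_zero] at h0
  obtain ⟨h0, hs⟩ := h0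
  have h1 := sum_posPartVec hx hs
  have hx' := neg_mem_cellSet hx
  have h2 := sum_posPartVec hx' (by simp [hs])
  have h3 := smul_mem_geomSimplex (posPartVec_mapsTo σ τ hx).1 (posPartVec_mapsTo σ τ hx).2
    (by rw [h1]; norm_num)
  have h4 := smul_mem_geomSimplex (posPartVec_mapsTo τ σ hx').1 (posPartVec_mapsTo τ σ hx').2
    (by rw [h2]; norm_num)
  rw [radial, radial, h1, h2, ← smul_sub, inv_inv] at h0
  rw [h1, inv_inv] at h3
  rw [h2, inv_inv] at h4
  exact ⟨h3, h4, sub_eq_zero.1 ((smul_eq_zero.1 h0).resolve_left (by norm_num))⟩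

theorem joinMap_join {F : Type*} [AddCommGroup F] [Module ℝ F]
    {g : (Fin (n + 1) → ℝ) → F} {σ τ : Finset (Fin (n + 1))} (h : Disjoint σ τ)
    {y y' : Fin (n + 1) → ℝ} (hy : y ∈ geomSimplex σ) (hy' : y' ∈ geomSimplex τ) (hg : g y = g y') :
    joinMap g ((2⁻¹ : ℝ) • (y - y')) = 0 ∧ (2 : ℝ) • posPartVec ((2⁻¹ : ℝ) • (y - y')) = y := by
  have e1 : ∀ {σ τ : Finset (Fin (n + 1))} (_ : Disjoint σ τ) {y y' : Fin (n + 1) → ℝ}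
      (_ : y ∈ geomSimplex σ) (_ : y' ∈ geomSimplex τ),
      posPartVec ((2⁻¹ : ℝ) • (y - y')) = (2⁻¹ : ℝ) • y := by
    intro σ τ h y y' hy hy'
    funext i
    rw [posPartVec_eq (join_mem_cellSet h hy hy')]
    split_ifs with hi
    · simp [hy'.2 i (Finset.disjoint_left.1 h hi)]
    · simp [hy.2 i hi]
  have e2 : posPartVec (-((2⁻¹ : ℝ) • (y - y'))) = (2⁻¹ : ℝ) • y' := by
    rw [← smul_neg, neg_sub, e1 h.symm hy' hy]
  have hs : ∀ {σ : Finset (Fin (n + 1))} {y : Fin (n + 1) → ℝ}, y ∈ geomSimplex σ →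
      radial g ((2⁻¹ : ℝ) • y) = (2⁻¹ : ℝ) • g y := by
    intro σ y hy
    have : ∑ i, ((2⁻¹ : ℝ) • y) i = 2⁻¹ := by
      simp only [Pi.smul_apply, smul_eq_mul, ← Finset.mul_sum, hy.1.2, mul_one]
    rw [radial, this, smul_smul, inv_mul_cancel₀ (by norm_num), one_smul]
  refine ⟨?_, by rw [e1 h hy hy', smul_smul]; norm_num⟩
  rw [joinMap, e2, e1 h hy hy', hs hy, hs hy', hg, sub_self, Prod.mk_eq_zero]
  refine ⟨rfl, ?_⟩
  simp only [Pi.smul_apply, Pi.sub_apply, smul_eq_mul, ← Finset.mul_sum, Finset.sum_sub_distrib,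
    hy.1.2, hy'.1.2, sub_self, mul_zero]

theorem geomSimplex_ne {σ τ : Finset (Fin (n + 1))} (h : Disjoint σ τ) {y y' : Fin (n + 1) → ℝ}
    (hy : y ∈ geomSimplex σ) (hy' : y' ∈ geomSimplex τ) : y ≠ y' := by
  rintro rfl
  have : ∀ i, y i = 0 := fun i => by
    by_cases hi : i ∈ σ
    · exact hy'.2 i (Finset.disjoint_left.1 h hi)
    · exact hy.2 i hi
  have h1 := hy.1.2
  simp [this] at h1

/-- The sum of the coordinates, as a linear form. -/
noncomputable def coordSum : (Fin (n + 1) → ℝ) →ₗ[ℝ] ℝ := ∑ i, LinearMap.proj i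

theorem coordSum_apply (x : Fin (n + 1) → ℝ) : coordSum x = ∑ i, x i := by
  simp [coordSum]

/-- The projection to the coordinates in `σ`. -/
noncomputable def coordProj (σ : Finset (Fin (n + 1))) :
    (Fin (n + 1) → ℝ) →ₗ[ℝ] (Fin (n + 1) → ℝ) :=
  LinearMap.pi fun i => if i ∈ σ then LinearMap.proj i else 0

theorem coordProj_apply (σ : Finset (Fin (n + 1))) (x : Fin (n + 1) → ℝ) (i : Fin (n + 1)) :
    coordProj σ x i = if i ∈ σ then x i else 0 := by
  simp only [coordProj, LinearMap.pi_apply]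
  split_ifs <;> simp

theorem coordProj_eq_self {σ : Finset (Fin (n + 1))} {x : Fin (n + 1) → ℝ} (h : ∀ i ∉ σ, x i = 0) :
    coordProj σ x = x := by
  funext i
  rw [coordProj_apply]
  split_ifs with hi
  · rfl
  · exact (h i hi).symm

theorem coordProj_eq_zero {σ τ : Finset (Fin (n + 1))} (hd : Disjoint σ τ) {x : Fin (n + 1) → ℝ}
    (h : ∀ i ∉ τ, x i = 0) : coordProj σ x = 0 := by
  funext i
  rw [coordProj_apply]
  split_ifs with hi
  · exact h i (Finset.disjoint_left.1 hd hi)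
  · rfl

/-- The linear extension to the ambient vector space of an affine map of a simplex. -/
noncomputable def homogenize {F : Type*} [AddCommGroup F] [Module ℝ F]
    (A : (Fin (n + 1) → ℝ) →ᵃ[ℝ] F) : (Fin (n + 1) → ℝ) →ₗ[ℝ] F :=
  A.linear + coordSum.smulRight (A 0)

theorem radial_affine {F : Type*} [AddCommGroup F] [Module ℝ F]
    (A : (Fin (n + 1) → ℝ) →ᵃ[ℝ] F) {X : Fin (n + 1) → ℝ} (hX : ∑ i, X i ≠ 0) :
    radial A X = homogenize A X := by
  have h1 : A ((∑ i, X i)⁻¹ • X) = A.linear ((∑ i, X i)⁻¹ • X) + A 0 := by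
    have h := A.linearMap_vsub ((∑ i, X i)⁻¹ • X) 0
    rw [vsub_eq_sub, vsub_eq_sub, sub_zero] at h
    rw [h, sub_add_cancel]
  rw [radial, h1, map_smul, smul_add, smul_smul, mul_inv_cancel₀ hX, one_smul]
  simp [homogenize, coordSum_apply]

theorem radial_eventuallyEq {F : Type*} [AddCommGroup F] [Module ℝ F]
    {g : (Fin (n + 1) → ℝ) → F} {σ : Finset (Fin (n + 1))} {A : (Fin (n + 1) → ℝ) →ᵃ[ℝ] F}
    {X : Fin (n + 1) → ℝ} (hX : ∑ i, X i ≠ 0)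
    (hA : ∀ᶠ x in 𝓝[geomSimplex σ] ((∑ i, X i)⁻¹ • X), g x = A x) :
    ∀ᶠ Y in 𝓝[{X | (∀ i, 0 ≤ X i) ∧ ∀ i ∉ σ, X i = 0}] X, radial g Y = homogenize A Y := by
  have hs : Continuous fun X : Fin (n + 1) → ℝ => ∑ i, X i := by fun_prop
  have hne : ∀ᶠ Y in 𝓝[{X | (∀ i, 0 ≤ X i) ∧ ∀ i ∉ σ, X i = 0}] X, ∑ i, Y i ≠ 0 :=
    (hs.continuousAt.eventually_ne hX).filter_mono nhdsWithin_le_nhds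
  have hev : ∀ᶠ Y in 𝓝[{X | (∀ i, 0 ≤ X i) ∧ ∀ i ∉ σ, X i = 0}] X,
      (∑ i, Y i)⁻¹ • Y ∈ geomSimplex σ := by
    filter_upwards [self_mem_nhdsWithin, hne] with Y hY hY1
    exact smul_mem_geomSimplex hY.1 hY.2 hY1
  have hlim : Tendsto (fun Y : Fin (n + 1) → ℝ => (∑ i, Y i)⁻¹ • Y)
      (𝓝[{X | (∀ i, 0 ≤ X i) ∧ ∀ i ∉ σ, X i = 0}] X) (𝓝 ((∑ i, X i)⁻¹ • X)) :=
    (((hs.continuousAt.inv₀ hX).smul continuousAt_id).tendsto).mono_left nhdsWithin_le_nhds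
  filter_upwards [(tendsto_nhdsWithin_iff.2 ⟨hlim, hev⟩).eventually hA, hne] with Y hY hY1
  rw [← radial_affine A hY1, radial, hY, radial]

theorem mem_vectorSpan_geomSimplex {σ : Finset (Fin (n + 1))} {u : Fin (n + 1) → ℝ}
    (hu : u ∈ vectorSpan ℝ (geomSimplex σ)) : (∀ i ∉ σ, u i = 0) ∧ coordSum u = 0 := by
  rw [vectorSpan] at hu
  induction hu using Submodule.span_induction with
  | mem x hx =>
    obtain ⟨y, hy, z, hz, rfl⟩ := hx
    refine ⟨fun i hi => ?_, ?_⟩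
    · simp [hy.2 i hi, hz.2 i hi]
    · simp [coordSum_apply, hy.1.2, hz.1.2]
  | zero => simp
  | add x y _ _ hx hy =>
    exact ⟨fun i hi => by simp [hx.1 i hi, hy.1 i hi], by rw [map_add, hx.2, hy.2, add_zero]⟩
  | smul a x _ hx => exact ⟨fun i hi => by simp [hx.1 i hi], by rw [map_smul, hx.2, smul_zero]⟩

theorem geomSimplex_subset_cellSet {σ τ : Finset (Fin (n + 1))} (h : Disjoint σ τ) :
    geomSimplex σ ⊆ cellSet σ τ := fun x hx =>
  ⟨fun i _ => hx.1.1 i, fun i hi => (hx.2 i (Finset.disjoint_right.1 h hi)).le,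
    fun i hi _ => hx.2 i hi, by simpa only [abs_of_nonneg (hx.1.1 _)] using hx.1.2⟩

theorem vectorSpan_geomSimplex_le {σ τ : Finset (Fin (n + 1))} (h : Disjoint σ τ) :
    vectorSpan ℝ (geomSimplex σ) ≤ vectorSpan ℝ (cellSet σ τ) :=
  vectorSpan_mono ℝ (geomSimplex_subset_cellSet h)

theorem vectorSpan_geomSimplex_le' {σ τ : Finset (Fin (n + 1))} (h : Disjoint σ τ) :
    vectorSpan ℝ (geomSimplex τ) ≤ vectorSpan ℝ (cellSet σ τ) := by
  refine Submodule.span_le.2 ?_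
  rintro _ ⟨x, hx, y, hy, rfl⟩
  have h1 := neg_mem_cellSet (geomSimplex_subset_cellSet h.symm hx)
  have h2 := neg_mem_cellSet (geomSimplex_subset_cellSet h.symm hy)
  have := vsub_mem_vectorSpan ℝ h2 h1
  simpa [neg_add_eq_sub] using this

theorem single_mem_geomSimplex {σ : Finset (Fin (n + 1))} {i : Fin (n + 1)} (hi : i ∈ σ) :
    (Pi.single i 1 : Fin (n + 1) → ℝ) ∈ geomSimplex σ :=
  ⟨single_mem_stdSimplex ℝ i, fun j hj => Pi.single_eq_of_ne (by rintro rfl; exact hj hi) _⟩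

/-- Transversality of two affine maps of `σ` and `τ` makes the induced linear map of the deleted
join nondegenerate. -/
theorem map_vectorSpan_cellSet_eq_top {F : Type*} [AddCommGroup F] [Module ℝ F]
    {σ τ : Finset (Fin (n + 1))} (h : Disjoint σ τ) (hσ : σ.Nonempty) (hτ : τ.Nonempty)
    {A B : (Fin (n + 1) → ℝ) →ᵃ[ℝ] F}
    (hAB : (vectorSpan ℝ (geomSimplex σ)).map A.linear ⊔
      (vectorSpan ℝ (geomSimplex τ)).map B.linear = ⊤) :
    (vectorSpan ℝ (cellSet σ τ)).map
      (((homogenize A ∘ₗ coordProj σ + homogenize B ∘ₗ coordProj τ)).prod coordSum) = ⊤ := by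
  set M := ((homogenize A ∘ₗ coordProj σ + homogenize B ∘ₗ coordProj τ)).prod coordSum with hM
  have h1 : ∀ w : F, (w, (0 : ℝ)) ∈ (vectorSpan ℝ (cellSet σ τ)).map M := by
    intro w
    have hw : w ∈ (vectorSpan ℝ (geomSimplex σ)).map A.linear ⊔
      (vectorSpan ℝ (geomSimplex τ)).map B.linear := hAB ▸ Submodule.mem_top
    obtain ⟨_, ⟨u, hu, rfl⟩, _, ⟨u', hu', rfl⟩, rfl⟩ := Submodule.mem_sup.1 hw
    obtain ⟨hu1, hu2⟩ := mem_vectorSpan_geomSimplex hu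
    obtain ⟨hu1', hu2'⟩ := mem_vectorSpan_geomSimplex hu'
    refine ⟨u + u', Submodule.add_mem _ (vectorSpan_geomSimplex_le h hu)
      (vectorSpan_geomSimplex_le' h hu'), ?_⟩
    simp [hM, homogenize, coordProj_eq_self hu1, coordProj_eq_self hu1', hu2, hu2',
      coordProj_eq_zero h hu1', coordProj_eq_zero h.symm hu1]
  obtain ⟨i, hi⟩ := hσ
  obtain ⟨j, hj⟩ := hτ
  set u : Fin (n + 1) → ℝ := Pi.single i 1 + Pi.single j 1
  have hu : u ∈ vectorSpan ℝ (cellSet σ τ) := by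
    have := vsub_mem_vectorSpan ℝ (geomSimplex_subset_cellSet h (single_mem_geomSimplex hi))
      (neg_mem_cellSet (geomSimplex_subset_cellSet h.symm (single_mem_geomSimplex hj)))
    simpa using this
  have hu2 : (M u).2 = 2 := by
    simp [hM, u, coordSum_apply, Finset.sum_add_distrib]
    norm_num
  refine eq_top_iff.2 fun w _ => ?_
  have h2 : (w.2 / 2) • M u ∈ (vectorSpan ℝ (cellSet σ τ)).map M :=
    Submodule.smul_mem _ _ (Submodule.mem_map_of_mem hu)
  have h3 := Submodule.add_mem _ h2 (h1 (w.1 - (w.2 / 2) • (M u).1))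
  convert h3 using 1
  refine Prod.ext ?_ ?_
  · simp
  · simp [hu2]

/-- The target of the map of the deleted join which is induced by a map of `|K|` to `ℝ²ᵏ`. -/
abbrev JoinTarget (k : ℕ) : Type := EuclideanSpace ℝ (Fin (2 * k)) × ℝ

theorem finrank_joinTarget : finrank ℝ (JoinTarget k) = 2 * k + 1 := by simp

theorem mem_skeleton_of_eq_zero {σ : Finset (Fin (n + 1))} (hσ : σ.card ≤ k + 1)
    {y : Fin (n + 1) → ℝ} (hy : y ∈ geomSimplex σ) {i : Fin (n + 1)} (hi : i ∈ σ) (h0 : y i = 0) :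
    y ∈ skeleton n k := by
  refine ⟨σ.erase i, by rw [Finset.card_erase_of_mem hi]; omega, hy.1, fun j hj => ?_⟩
  by_cases hji : j = i
  · rw [hji, h0]
  · exact hy.2 j fun h => hj (Finset.mem_erase.2 ⟨hji, h⟩)

/-- For a general position map `g`, the degree of the map of the deleted join on the simplex `σ * τ`
is the number modulo 2 of intersection points of `g(σ)` and `g(τ)`. -/
theorem eventually_count_joinMap (μ : Measure (JoinTarget k)) [μ.IsAddHaarMeasure]
    {g : (Fin (n + 1) → ℝ) → EuclideanSpace ℝ (Fin (2 * k))}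
    (hg : IsGeneralPosition n k g) (σ τ : KSimplex n k) (h : Disjoint σ.1 τ.1) :
    ∀ᶠ r in atTop, ∀ᶠ v in 𝓝 (0 : JoinTarget k) ⊓ ae μ,
      count {v} (push (joinMap g) ((sd (2 * k + 2) ^ r) (single (cellList σ.1 τ.1) 1))) =
        ((g '' geomSimplex σ.1 ∩ g '' geomSimplex τ.1).ncard : ZMod 2) := by
  classical
  have hcont := continuousOn_of_isPL hg.isPL
  have hσs := geomSimplex_subset_skeleton (n := n) σ.2.le
  have hτs := geomSimplex_subset_skeleton (n := n) τ.2.le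
  set Zs : Set (Fin (n + 1) → ℝ) := {x | x ∈ cellSet σ.1 τ.1 ∧ joinMap g x = 0} with hZs
  have hbij : Set.BijOn (fun x => g ((2 : ℝ) • posPartVec x)) Zs
      (g '' geomSimplex σ.1 ∩ g '' geomSimplex τ.1) := by
    refine ⟨fun x hx => ?_, fun x hx x' hx' hxx => ?_, ?_⟩
    · obtain ⟨h1, h2, h3⟩ := joinMap_eq_zero hx.1 hx.2
      exact ⟨⟨_, h1, rfl⟩, ⟨_, h2, h3.symm⟩⟩
    · obtain ⟨h1, h2, h3⟩ := joinMap_eq_zero hx.1 hx.2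
      obtain ⟨h1', h2', h3'⟩ := joinMap_eq_zero hx'.1 hx'.2
      have hd := (hg.double _ (hσs h1) _ (hτs h2) (geomSimplex_ne h h1 h2) h3).2.2
      have hxx : g ((2 : ℝ) • posPartVec x) = g ((2 : ℝ) • posPartVec x') := hxx
      have e1 := (hd _ (hσs h1') hxx.symm).resolve_right (geomSimplex_ne h h1' h2)
      have e2 := (hd _ (hτs h2') (h3'.symm.trans hxx.symm)).resolve_left
        (geomSimplex_ne h h1 h2').symm
      have e3 := smul_right_injective _ (two_ne_zero (α := ℝ)) e1
      have e4 := smul_right_injective _ (two_ne_zero (α := ℝ)) e2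
      rw [← posPartVec_sub_neg x, ← posPartVec_sub_neg x', e3, e4]
    · rintro _ ⟨⟨y, hy, rfl⟩, y', hy', hyy⟩
      obtain ⟨h1, h2⟩ := joinMap_join h hy hy' hyy.symm
      exact ⟨_, ⟨join_mem_cellSet h hy hy', h1⟩, by simp only [h2]⟩
  have hfin : Zs.Finite := by
    refine hbij.finite_iff_finite.2 (hg.finite.subset ?_)
    rintro _ ⟨⟨y, hy, rfl⟩, y', hy', hyy⟩
    exact ⟨y, hσs hy, y', hτs hy', geomSimplex_ne h hy hy', rfl, hyy⟩
  have hncard : (g '' geomSimplex σ.1 ∩ g '' geomSimplex τ.1).ncard = hfin.toFinset.card := by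
    rw [← Set.ncard_eq_toFinset_card Zs hfin, ← hbij.image_eq, hbij.injOn.ncard_image]
  have hcard : σ.1.card + τ.1.card = finrank ℝ (JoinTarget k) + 1 := by
    rw [finrank_joinTarget, σ.2, τ.2]; ring
  rw [hncard]
  have key := eventually_count_push_sd_pow μ
    (l₀ := cellList σ.1 τ.1) ((length_cellList h).trans hcard) (G := joinMap g)
    (by
      rw [convexHull_cellList h]
      exact continuousOn_joinMap (hcont.mono hσs) (hcont.mono hτs)) hfin.toFinset
    (by
      rw [convexHull_cellList h]
      intro x hx
      simp [hZs, hx])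
    (by
      rw [convexHull_cellList h]
      intro z hz
      exact ((Set.Finite.mem_toFinset _).1 hz).1) ?_
  · rw [finrank_joinTarget] at key
    exact key
  · intro z hz
    obtain ⟨hz, hz0⟩ := (Set.Finite.mem_toFinset _).1 hz
    obtain ⟨h1, h2, h3⟩ := joinMap_eq_zero hz hz0
    have hne := geomSimplex_ne h h1 h2
    obtain ⟨hy, hy', -⟩ := hg.double _ (hσs h1) _ (hτs h2) hne h3
    obtain ⟨A, B, hA, hB, hAB⟩ := hg.transverse σ τ _ h1 _ h2 hne h3
    have hz' := neg_mem_cellSet hz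
    have hsum : ∑ i, z i = 0 := congrArg Prod.snd hz0
    have hs1 := sum_posPartVec hz hsum
    have hs2 := sum_posPartVec hz' (by simp [hsum])
    have hxσ : ∀ i ∈ σ.1, z i ≠ 0 := fun i hi h0 => hy (mem_skeleton_of_eq_zero σ.2.le h1 hi (by
      simp [posPartVec, h0]))
    have hxτ : ∀ i ∈ τ.1, z i ≠ 0 := fun i hi h0 => hy' (mem_skeleton_of_eq_zero τ.2.le h2 hi (by
      simp [posPartVec, h0]))
    have hσn : σ.1.Nonempty := Finset.card_pos.1 (by rw [σ.2]; omega)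
    have hτn : τ.1.Nonempty := Finset.card_pos.1 (by rw [τ.2]; omega)
    have hev : ∀ᶠ x in 𝓝[convexHull ℝ {x | x ∈ cellList σ.1 τ.1}] z, joinMap g x =
        (((homogenize A ∘ₗ coordProj σ.1 + homogenize B ∘ₗ coordProj τ.1)).prod coordSum) x := by
      rw [convexHull_cellList h]
      have t1 : Tendsto posPartVec (𝓝[cellSet σ.1 τ.1] z)
          (𝓝[{X | (∀ i, 0 ≤ X i) ∧ ∀ i ∉ σ.1, X i = 0}] posPartVec z) :=
        continuous_posPartVec.continuousWithinAt.tendsto_nhdsWithin (posPartVec_mapsTo σ.1 τ.1)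
      have t2 : Tendsto (fun x => posPartVec (-x)) (𝓝[cellSet σ.1 τ.1] z)
          (𝓝[{X | (∀ i, 0 ≤ X i) ∧ ∀ i ∉ τ.1, X i = 0}] posPartVec (-z)) :=
        (continuous_posPartVec.comp continuous_neg).continuousWithinAt.tendsto_nhdsWithin
          fun x hx => posPartVec_mapsTo τ.1 σ.1 (neg_mem_cellSet hx)
      have r1 := radial_eventuallyEq (g := g) (σ := σ.1) (A := A) (X := posPartVec z)
        (by rw [hs1]; norm_num) (by rw [hs1, inv_inv]; exact hA)
      have r2 := radial_eventuallyEq (g := g) (σ := τ.1) (A := B) (X := posPartVec (-z))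
        (by rw [hs2]; norm_num) (by rw [hs2, inv_inv]; exact hB)
      filter_upwards [t1.eventually r1, t2.eventually r2, self_mem_nhdsWithin] with x hx1 hx2 hx
      have e1 : posPartVec x = coordProj σ.1 x := by
        funext i; rw [posPartVec_eq hx, coordProj_apply]
      have e2 : posPartVec (-x) = -coordProj τ.1 x := by
        rw [← map_neg]
        funext i; rw [posPartVec_eq (neg_mem_cellSet hx), coordProj_apply]
      rw [joinMap, hx1, hx2, e1, e2]
      refine Prod.ext ?_ ?_
      · simp
      · simp [coordSum_apply]
    refine ⟨_, hev, ?_⟩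
    refine injOn_and_mem_interior_cell h hcard
      (map_vectorSpan_cellSet_eq_top h hσn hτn hAB) hz hxσ hxτ ?_
    rw [← hz0]
    rw [convexHull_cellList h] at hev
    exact (hev.self_of_nhdsWithin hz).symm

/-- On a simplex of the deleted join of smaller dimension, the map has no zeros. -/
theorem joinMap_ne_zero {g : (Fin (n + 1) → ℝ) → EuclideanSpace ℝ (Fin (2 * k))}
    (hg : IsGeneralPosition n k g) {σ τ : Finset (Fin (n + 1))} (h : Disjoint σ τ)
    (hσ : σ.card ≤ k + 1) (hτ : τ.card ≤ k + 1) (hcard : σ.card + τ.card ≤ 2 * k + 1)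
    {x : Fin (n + 1) → ℝ} (hx : x ∈ cellSet σ τ) : joinMap g x ≠ 0 := by
  intro h0
  obtain ⟨h1, h2, h3⟩ := joinMap_eq_zero hx h0
  obtain ⟨hy, hy', -⟩ := hg.double _ (geomSimplex_subset_skeleton hσ h1) _
    (geomSimplex_subset_skeleton hτ h2) (geomSimplex_ne h h1 h2) h3
  rcases (show σ.card ≤ k ∨ τ.card ≤ k by omega) with h | h
  · exact hy (geomSimplex_subset_skeleton h h1)
  · exact hy' (geomSimplex_subset_skeleton h h2)

/-! ### Cycles of the deleted join -/

theorem bdList_cellList_of_disjoint {σ τ : Finset (Fin (n + 1))} (h : Disjoint σ τ) :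
    bdList (cellList σ τ) = ∑ i ∈ σ, single (cellList (σ.erase i) τ) 1 +
      ∑ j ∈ τ, single (cellList σ (τ.erase j)) 1 := by
  rw [bdList_cellList, Finset.sum_union h]
  congr 1
  · refine Finset.sum_congr rfl fun i hi => ?_
    rw [Finset.erase_eq_of_notMem (Finset.disjoint_left.1 h hi)]
  · refine Finset.sum_congr rfl fun j hj => ?_
    rw [Finset.erase_eq_of_notMem (Finset.disjoint_right.1 h hj)]

/-- A face of codimension 2 is a facet of exactly two facets. -/
theorem sum_erase_erase {X A : Type*} [DecidableEq X] [AddCommGroup A] [Module (ZMod 2) A]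
    (s : Finset X) (f : Finset X → A) :
    ∑ x ∈ s, ∑ i ∈ s.erase x, f ((s.erase x).erase i) = 0 := by
  rw [Finset.sum_sigma']
  refine Finset.sum_involution (fun p _ => ⟨p.2, p.1⟩) ?_ ?_ ?_ ?_
  · rintro ⟨x, i⟩ h
    dsimp only
    rw [Finset.erase_right_comm, ZModModule.add_self]
  · rintro ⟨x, i⟩ h _ he
    simp only [Finset.mem_sigma, Finset.mem_erase] at h
    exact h.2.1 (congrArg Sigma.fst he)
  · rintro ⟨x, i⟩ h
    simp only [Finset.mem_sigma, Finset.mem_erase] at h ⊢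
    exact ⟨h.2.2, h.2.1.symm, h.1⟩
  · rintro ⟨x, i⟩ h
    rfl

/-- The join of the boundaries of two disjoint simplices. -/
noncomputable def boundaryJoin (κ κ' : Finset (Fin (n + 1))) : Chain (Fin (n + 1) → ℝ) :=
  ∑ x ∈ κ, ∑ y ∈ κ', single (cellList (κ.erase x) (κ'.erase y)) 1

theorem disjoint_erase {κ κ' : Finset (Fin (n + 1))} (h : Disjoint κ κ') (x y : Fin (n + 1)) :
    Disjoint (κ.erase x) (κ'.erase y) :=
  h.mono (Finset.erase_subset _ _) (Finset.erase_subset _ _)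

theorem bd_boundaryJoin {κ κ' : Finset (Fin (n + 1))} (h : Disjoint κ κ') :
    bd (boundaryJoin κ κ') = 0 := by
  have h1 : ∀ x y, bd (single (cellList (κ.erase x) (κ'.erase y)) 1) =
      ∑ i ∈ κ.erase x, single (cellList ((κ.erase x).erase i) (κ'.erase y)) 1 +
      ∑ j ∈ κ'.erase y, single (cellList (κ.erase x) ((κ'.erase y).erase j)) 1 := fun x y => by
    rw [bd_single, bdList_cellList_of_disjoint (disjoint_erase h x y)]
  simp only [boundaryJoin, map_sum, h1, Finset.sum_add_distrib]
  rw [Finset.sum_comm]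
  have h2 : ∀ y, ∑ x ∈ κ, ∑ i ∈ κ.erase x,
      single (cellList ((κ.erase x).erase i) (κ'.erase y)) (1 : ZMod 2) = 0 := fun y =>
    sum_erase_erase κ fun s => single (cellList s (κ'.erase y)) (1 : ZMod 2)
  have h3 : ∀ x, ∑ y ∈ κ', ∑ j ∈ κ'.erase y,
      single (cellList (κ.erase x) ((κ'.erase y).erase j)) (1 : ZMod 2) = 0 := fun x =>
    sum_erase_erase κ' fun s => single (cellList (κ.erase x) s) (1 : ZMod 2)
  simp only [h2, h3, Finset.sum_const_zero, add_zero]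

/-- The images of the boundaries of two disjoint `(k+1)`-simplices under a general position map have
an even number of intersections. -/
theorem sum_ncard_boundary {g : (Fin (n + 1) → ℝ) → EuclideanSpace ℝ (Fin (2 * k))}
    (hg : IsGeneralPosition n k g) {κ κ' : Finset (Fin (n + 1))} (hκ : κ.card = k + 2)
    (hκ' : κ'.card = k + 2) (h : Disjoint κ κ') :
    ∑ x ∈ κ, ∑ y ∈ κ', ((g '' geomSimplex (κ.erase x) ∩
      g '' geomSimplex (κ'.erase y)).ncard : ZMod 2) = 0 := by
  let μ : Measure (JoinTarget k) := Measure.addHaar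
  have hx : ∀ x ∈ κ, (κ.erase x).card = k + 1 := fun x hx => by
    rw [Finset.card_erase_of_mem hx, hκ]; rfl
  have hy : ∀ y ∈ κ', (κ'.erase y).card = k + 1 := fun y hy => by
    rw [Finset.card_erase_of_mem hy, hκ']; rfl
  have h1 : ∀ᶠ r in atTop, ∀ x ∈ κ, ∀ y ∈ κ', ∀ᶠ v in 𝓝 (0 : JoinTarget k) ⊓ ae μ,
      count {v} (push (joinMap g) ((sd (2 * k + 2) ^ r)
        (single (cellList (κ.erase x) (κ'.erase y)) 1))) =
        ((g '' geomSimplex (κ.erase x) ∩ g '' geomSimplex (κ'.erase y)).ncard : ZMod 2) :=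
    (Filter.eventually_all_finset _).2 fun x hxκ => (Filter.eventually_all_finset _).2 fun y hyκ =>
      eventually_count_joinMap μ hg ⟨_, hx x hxκ⟩ ⟨_, hy y hyκ⟩ (disjoint_erase h x y)
  obtain ⟨r, hr⟩ := h1.exists
  have hlen : boundaryJoin κ κ' ∈ supp {l : List (Fin (n + 1) → ℝ) | l.length = 2 * k + 2} :=
    Submodule.sum_mem _ fun x hxκ => Submodule.sum_mem _ fun y hyκ => single_mem_supp (by
      rw [Set.mem_ofPred_eq, length_cellList (disjoint_erase h x y), hx x hxκ, hy y hyκ]; ring)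
  have h2 : ∀ᵐ v ∂μ,
      count {v} (push (joinMap g) ((sd (2 * k + 2) ^ r) (boundaryJoin κ κ'))) = 0 := by
    refine ae_count_cycle μ (push_mem (s := {l | l.length = 2 * k + 2}) (fun l hl => ?_)
      (sd_pow_mem_length hlen r)) ?_
    · rw [Set.mem_ofPred_eq, List.length_map, hl, finrank_joinTarget]
    · rw [bd_push, bd_sd_pow hlen, bd_boundaryJoin h, map_zero, map_zero]
  have hne := neBot_nhds_inf_ae μ
  obtain ⟨v, hv, hv'⟩ := ((h2.filter_mono inf_le_right).and
    ((Filter.eventually_all_finset _).2 fun x hxκ => (Filter.eventually_all_finset _).2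
      fun y hyκ => hr x hxκ y hyκ)).exists
  rw [← hv, boundaryJoin]
  simp only [map_sum]
  exact Finset.sum_congr rfl fun x hxκ => Finset.sum_congr rfl fun y hyκ => (hv' x hxκ y hyκ).symm

/-! ### The deleted join of the `k`-skeleton of a `(2k+2)`-simplex -/

/-- The pairs of disjoint `k`-simplices with vertices in `V`. -/
def joinCells (k : ℕ) (V : Finset (Fin (n + 1))) :
    Finset (Finset (Fin (n + 1)) × Finset (Fin (n + 1))) :=
  (V.powerset ×ˢ V.powerset).filter fun p => Disjoint p.1 p.2 ∧ p.1.card = k + 1 ∧ p.2.card = k + 1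

theorem mem_joinCells {V : Finset (Fin (n + 1))} {p : Finset (Fin (n + 1)) × Finset (Fin (n + 1))} :
    p ∈ joinCells k V ↔ (p.1 ⊆ V ∧ p.2 ⊆ V) ∧ Disjoint p.1 p.2 ∧ p.1.card = k + 1 ∧
      p.2.card = k + 1 := by
  simp [joinCells]

/-- A choice of one of the two orders of each pair of disjoint `k`-simplices: `u` belongs to the
first simplex, or to none, in which case `w` belongs to the first simplex. -/
def halfCells (k : ℕ) (V : Finset (Fin (n + 1))) (u w : Fin (n + 1)) :
    Finset (Finset (Fin (n + 1)) × Finset (Fin (n + 1))) :=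
  (joinCells k V).filter fun p => u ∈ p.1 ∨ u ∉ p.2 ∧ w ∈ p.1

theorem card_union_joinCell {V : Finset (Fin (n + 1))}
    {p : Finset (Fin (n + 1)) × Finset (Fin (n + 1))} (hp : p ∈ joinCells k V) :
    (p.1 ∪ p.2).card = 2 * k + 2 := by
  obtain ⟨-, h, h1, h2⟩ := mem_joinCells.1 hp
  rw [Finset.card_union_of_disjoint h, h1, h2]; ring

/-- Every vertex but one belongs to one of the two simplices. -/
theorem mem_or_mem_of_joinCell {V : Finset (Fin (n + 1))} (hV : V.card = 2 * k + 3)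
    {p : Finset (Fin (n + 1)) × Finset (Fin (n + 1))} (hp : p ∈ joinCells k V) {x y : Fin (n + 1)}
    (hx : x ∈ V) (hy : y ∈ V) (hxy : x ≠ y) (hxp : x ∉ p.1) (hxp' : x ∉ p.2) :
    y ∈ p.1 ∨ y ∈ p.2 := by
  by_contra hcon
  push Not at hcon
  have h1 := card_union_joinCell hp
  obtain ⟨⟨hs1, hs2⟩, -⟩ := mem_joinCells.1 hp
  have h2 : p.1 ∪ p.2 ⊆ (V.erase x).erase y := by
    intro i hi
    rw [Finset.mem_erase, Finset.mem_erase]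
    rw [Finset.mem_union] at hi
    refine ⟨?_, ?_, hi.elim (fun h => hs1 h) (fun h => hs2 h)⟩
    · rintro rfl; tauto
    · rintro rfl; tauto
  have h3 := Finset.card_le_card h2
  rw [Finset.card_erase_of_mem (Finset.mem_erase.2 ⟨hxy.symm, hy⟩),
    Finset.card_erase_of_mem hx] at h3
  omega

theorem sum_joinCells {A : Type*} [AddCommMonoid A] {V : Finset (Fin (n + 1))}
    (hV : V.card = 2 * k + 3) {u w : Fin (n + 1)} (hu : u ∈ V) (hw : w ∈ V) (huw : u ≠ w)
    (f : Finset (Fin (n + 1)) × Finset (Fin (n + 1)) → A) :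
    ∑ p ∈ joinCells k V, f p = ∑ p ∈ halfCells k V u w, (f p + f p.swap) := by
  rw [Finset.sum_add_distrib, ← Finset.sum_filter_add_sum_filter_not (joinCells k V)
    (fun p => u ∈ p.1 ∨ u ∉ p.2 ∧ w ∈ p.1), halfCells]
  congr 1
  refine Finset.sum_nbij' Prod.swap Prod.swap ?_ ?_ (fun _ _ => rfl) (fun _ _ => rfl)
    (fun _ _ => rfl)
  · intro p hp
    obtain ⟨hp, hpos⟩ := Finset.mem_filter.1 hp
    push Not at hpos
    refine Finset.mem_filter.2 ⟨?_, ?_⟩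
    · obtain ⟨⟨h1, h2⟩, h3, h4, h5⟩ := mem_joinCells.1 hp
      exact mem_joinCells.2 ⟨⟨h2, h1⟩, h3.symm, h5, h4⟩
    · by_cases h : u ∈ p.2
      · exact Or.inl h
      · exact Or.inr ⟨hpos.1, (mem_or_mem_of_joinCell hV hp hu hw huw hpos.1 h).resolve_left
          (hpos.2 h)⟩
  · intro p hp
    obtain ⟨hp, hpos⟩ := Finset.mem_filter.1 hp
    obtain ⟨⟨h1, h2⟩, h3, h4, h5⟩ := mem_joinCells.1 hp
    refine Finset.mem_filter.2 ⟨mem_joinCells.2 ⟨⟨h2, h1⟩, h3.symm, h5, h4⟩, ?_⟩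
    have h6 := fun x (hx : x ∈ p.1) => Finset.disjoint_left.1 h3 hx
    have h7 := h6 u
    have h8 := h6 w
    simp only [Prod.fst_swap, Prod.snd_swap]
    tauto

/-- The sum of the top-dimensional simplices of the deleted join, one of each antipodal pair. -/
noncomputable def halfChain (k : ℕ) (V : Finset (Fin (n + 1))) (u w : Fin (n + 1)) :
    Chain (Fin (n + 1) → ℝ) :=
  ∑ p ∈ halfCells k V u w, single (cellList p.1 p.2) 1

theorem halfCells_subset {V : Finset (Fin (n + 1))} {u w : Fin (n + 1)} :
    halfCells k V u w ⊆ joinCells k V := Finset.filter_subset _ _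

theorem halfChain_add_push_neg {V : Finset (Fin (n + 1))} (hV : V.card = 2 * k + 3)
    {u w : Fin (n + 1)} (hu : u ∈ V) (hw : w ∈ V) (huw : u ≠ w) :
    halfChain k V u w + push Neg.neg (halfChain k V u w) =
      ∑ p ∈ joinCells k V, single (cellList p.1 p.2) 1 := by
  rw [sum_joinCells hV hu hw huw, Finset.sum_add_distrib, halfChain, map_sum]
  congr 1
  refine Finset.sum_congr rfl fun p hp => ?_
  rw [push_single, map_neg_cellList (mem_joinCells.1 (halfCells_subset hp)).2.1, Prod.fst_swap,
    Prod.snd_swap]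

/-- The deleted join is a cycle: in a simplex, a vertex can be exchanged for the vertex which is
missing. -/
theorem bd_sum_joinCells {V : Finset (Fin (n + 1))} (hV : V.card = 2 * k + 3) :
    bd (∑ p ∈ joinCells k V, single (cellList p.1 p.2) 1) = 0 := by
  classical
  have hex : ∀ p ∈ joinCells k V, ∃ o, V \ (p.1 ∪ p.2) = {o} := fun p hp => by
    obtain ⟨⟨h1, h2⟩, -⟩ := mem_joinCells.1 hp
    rw [← Finset.card_eq_one, Finset.card_sdiff_of_subset (Finset.union_subset h1 h2), hV,
      card_union_joinCell hp]
    omega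
  choose! o ho using hex
  have homem : ∀ p ∈ joinCells k V, o p ∈ V ∧ o p ∉ p.1 ∧ o p ∉ p.2 := fun p hp => by
    have : o p ∈ V \ (p.1 ∪ p.2) := by rw [ho p hp]; exact Finset.mem_singleton_self _
    simpa using this
  rw [map_sum]
  simp only [bd_single, bdList_cellList]
  rw [Finset.sum_sigma']
  -- The exchange of the vertex `i` for the missing vertex.
  let ex : Fin (n + 1) → Fin (n + 1) → Finset (Fin (n + 1)) → Finset (Fin (n + 1)) :=
    fun i m s => if i ∈ s then insert m (s.erase i) else s
  have hex1 : ∀ i m s, m ∉ s → (ex i m s).erase m = s.erase i := by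
    intro i m s hm
    simp only [ex]
    split_ifs with hi
    · rw [Finset.erase_insert fun h => hm (Finset.mem_of_mem_erase h)]
    · rw [Finset.erase_eq_of_notMem hm, Finset.erase_eq_of_notMem hi]
  have hex2 : ∀ i m s, m ∉ s → ex m i (ex i m s) = s := by
    intro i m s hm
    by_cases hi : i ∈ s
    · have h1 : ex i m s = insert m (s.erase i) := if_pos hi
      rw [h1]
      simp only [ex]
      rw [if_pos (Finset.mem_insert_self _ _),
        Finset.erase_insert fun h => hm (Finset.mem_of_mem_erase h), Finset.insert_erase hi]
    · have h1 : ex i m s = s := if_neg hi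
      rw [h1]
      exact if_neg hm
  have hex3 : ∀ i m s, m ∉ s → i ≠ m → i ∉ ex i m s := by
    intro i m s hm him
    simp only [ex]
    split_ifs with hi
    · simp [him]
    · exact hi
  have hex4 : ∀ i m s, m ∉ s → (ex i m s).card = s.card := by
    intro i m s hm
    simp only [ex]
    split_ifs with hi
    · rw [Finset.card_insert_of_notMem fun h => hm (Finset.mem_of_mem_erase h),
        Finset.card_erase_add_one hi]
    · rfl
  have hex5 : ∀ i m s, m ∈ V → s ⊆ V → ex i m s ⊆ V := by
    intro i m s hm hs
    simp only [ex]
    split_ifs with hi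
    · exact Finset.insert_subset hm ((Finset.erase_subset _ _).trans hs)
    · exact hs
  have hcell : ∀ p ∈ joinCells k V, ∀ i ∈ p.1 ∪ p.2,
      (ex i (o p) p.1, ex i (o p) p.2) ∈ joinCells k V ∧
      o (ex i (o p) p.1, ex i (o p) p.2) = i ∧ o p ∈ ex i (o p) p.1 ∪ ex i (o p) p.2 := by
    intro p hp i hi
    obtain ⟨⟨h1, h2⟩, h3, h4, h5⟩ := mem_joinCells.1 hp
    obtain ⟨hoV, ho1, ho2⟩ := homem p hp
    have hio : i ≠ o p := by
      rintro rfl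
      exact (Finset.mem_union.1 hi).elim ho1 ho2
    have hiV : i ∈ V := (Finset.mem_union.1 hi).elim (fun h => h1 h) (fun h => h2 h)
    have hmem : (ex i (o p) p.1, ex i (o p) p.2) ∈ joinCells k V := by
      refine mem_joinCells.2 ⟨⟨hex5 _ _ _ hoV h1, hex5 _ _ _ hoV h2⟩, ?_,
        (hex4 _ _ _ ho1).trans h4, (hex4 _ _ _ ho2).trans h5⟩
      rw [Finset.disjoint_left] at h3 ⊢
      intro x hx hx'
      simp only [ex] at hx hx'
      have h6 := @h3 x
      have h7 := @h3 i
      split_ifs at hx hx' <;> try simp only [Finset.mem_insert, Finset.mem_erase] at hx hx'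
      · tauto
      · rcases hx with rfl | hx <;> tauto
      · rcases hx' with rfl | hx' <;> tauto
      · tauto
    refine ⟨hmem, ?_, ?_⟩
    · have h6 : i ∈ V \ (ex i (o p) p.1 ∪ ex i (o p) p.2) := by
        rw [Finset.mem_sdiff, Finset.mem_union]
        exact ⟨hiV, fun h => h.elim (hex3 _ _ _ ho1 hio) (hex3 _ _ _ ho2 hio)⟩
      rw [ho _ hmem] at h6
      exact (Finset.mem_singleton.1 h6).symm
    · rw [Finset.mem_union]
      rcases Finset.mem_union.1 hi with h | h
      · left
        simp only [ex]
        rw [if_pos h]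
        exact Finset.mem_insert_self _ _
      · right
        simp only [ex]
        rw [if_pos h]
        exact Finset.mem_insert_self _ _
  refine Finset.sum_involution
    (fun q _ => ⟨(ex q.2 (o q.1) q.1.1, ex q.2 (o q.1) q.1.2), o q.1⟩) ?_ ?_ ?_ ?_
  · rintro ⟨p, i⟩ hq
    obtain ⟨hp, hi⟩ := Finset.mem_sigma.1 hq
    obtain ⟨-, ho1, ho2⟩ := homem p hp
    dsimp only
    rw [hex1 _ _ _ ho1, hex1 _ _ _ ho2, ZModModule.add_self]
  · rintro ⟨p, i⟩ hq _ he
    obtain ⟨hp, hi⟩ := Finset.mem_sigma.1 hq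
    obtain ⟨-, ho1, ho2⟩ := homem p hp
    have h1 : o p = i := by
      have := congrArg Sigma.snd he
      exact this
    rw [← h1] at hi
    exact (Finset.mem_union.1 hi).elim ho1 ho2
  · rintro ⟨p, i⟩ hq
    obtain ⟨hp, hi⟩ := Finset.mem_sigma.1 hq
    obtain ⟨h1, -, h3⟩ := hcell p hp i hi
    exact Finset.mem_sigma.2 ⟨h1, h3⟩
  · rintro ⟨p, i⟩ hq
    obtain ⟨hp, hi⟩ := Finset.mem_sigma.1 hq
    obtain ⟨-, h2, -⟩ := hcell p hp i hi
    obtain ⟨-, ho1, ho2⟩ := homem p hp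
    dsimp only at h2 ⊢
    rw [h2, hex2 _ _ _ ho1, hex2 _ _ _ ho2]

/-- The simplices of the deleted join with `m` vertices. -/
def cellLists (k : ℕ) (V : Finset (Fin (n + 1))) (m : ℕ) : Set (List (Fin (n + 1) → ℝ)) :=
  {l | ∃ σ τ : Finset (Fin (n + 1)), Disjoint σ τ ∧ σ ⊆ V ∧ τ ⊆ V ∧ σ.card ≤ k + 1 ∧
    τ.card ≤ k + 1 ∧ σ.card + τ.card = m ∧ l = cellList σ τ}

theorem bd_mem_cellLists {V : Finset (Fin (n + 1))} {m : ℕ} {c : Chain (Fin (n + 1) → ℝ)}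
    (hc : c ∈ supp (cellLists k V (m + 1))) : bd c ∈ supp (cellLists k V m) := by
  refine linearMap_mem_of_single ?_ hc
  rintro _ ⟨σ, τ, h, hσ, hτ, hσ', hτ', hm, rfl⟩
  rw [bd_single, bdList_cellList_of_disjoint h]
  refine Submodule.add_mem _ (Submodule.sum_mem _ fun i hi => single_mem_supp ?_)
    (Submodule.sum_mem _ fun j hj => single_mem_supp ?_)
  · have := Finset.card_erase_add_one hi
    exact ⟨_, _, h.mono_left (Finset.erase_subset _ _), (Finset.erase_subset _ _).trans hσ, hτ,
      by omega, hτ', by omega, rfl⟩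
  · have := Finset.card_erase_add_one hj
    exact ⟨_, _, h.mono_right (Finset.erase_subset _ _), hσ, (Finset.erase_subset _ _).trans hτ,
      hσ', by omega, by omega, rfl⟩

theorem push_neg_apply {E : Type*} [AddGroup E] (c : Chain E) (l : List E) :
    push Neg.neg c l = c (l.map Neg.neg) := by
  have h2 : ∀ l : List E, (l.map Neg.neg).map Neg.neg = l := fun l => by
    rw [List.map_map]; simp
  have h1 : Function.Injective (List.map (Neg.neg : E → E)) := neg_injective.list_map
  have := Finsupp.mapDomain_apply h1 c (l.map Neg.neg)
  rw [h2] at this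
  exact this

/-- A chain of the deleted join which is invariant under the antipodal map, which acts freely, is of
the form `c + t c`: the chain `c` collects the simplices whose first vertex is positive. -/
theorem exists_eq_add_push_neg {V : Finset (Fin (n + 1))} {m : ℕ} {b : Chain (Fin (n + 1) → ℝ)}
    (hb : b ∈ supp (cellLists k V (m + 1))) (hsymm : push Neg.neg b = b) :
    ∃ c ∈ supp (cellLists k V (m + 1)), b = c + push Neg.neg c := by
  classical
  let P : List (Fin (n + 1) → ℝ) → Prop := fun l => ∃ a ∈ l.head?, 0 < ∑ i, a i
  have hP : ∀ l ∈ cellLists k V (m + 1), P (l.map Neg.neg) ↔ ¬P l := by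
    rintro l ⟨σ, τ, h, -, -, -, -, hm, rfl⟩
    have hl : (cellList σ τ).length = m + 1 := (length_cellList h).trans hm
    obtain ⟨a, t, hat⟩ : ∃ a t, cellList σ τ = a :: t := by
      rcases hcl : cellList σ τ with _ | ⟨a, t⟩
      · rw [hcl] at hl; simp at hl
      · exact ⟨a, t, rfl⟩
    have ha : a ∈ cellList σ τ := by rw [hat]; exact List.mem_cons_self
    obtain ⟨j, -, rfl⟩ := List.mem_map.1 ha
    rw [hat]
    have hs : ∑ i, signed σ j i = if j ∈ σ then 1 else -1 := by
      simp [signed]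
    simp only [P, List.map_cons, List.head?_cons, Option.mem_some_iff, exists_eq_left',
      Pi.neg_apply, Finset.sum_neg_distrib, hs]
    split_ifs <;> norm_num
  refine ⟨b.filter P, ?_, Finsupp.ext fun l => ?_⟩
  · rw [mem_supported] at hb ⊢
    refine subset_trans ?_ hb
    rw [Finset.coe_subset, Finsupp.support_filter]
    exact Finset.filter_subset _ _
  · have h1 : b (l.map Neg.neg) = b l := by rw [← push_neg_apply, hsymm]
    rw [Finsupp.add_apply, push_neg_apply, Finsupp.filter_apply, Finsupp.filter_apply, h1]
    by_cases h0 : b l = 0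
    · simp [h0]
    · have hl := hP l ((mem_supported _ _).1 hb (Finsupp.mem_support_iff.2 h0))
      by_cases hPl : P l
      · rw [if_pos hPl, if_neg (fun h => hl.1 h hPl), add_zero]
      · rw [if_neg hPl, if_pos (hl.2 hPl), zero_add]

theorem add_push_neg_eq_zero {E : Type*} [Neg E] {b : Chain E} (h : b + push Neg.neg b = 0) :
    push Neg.neg b = b := by
  rw [add_comm, ← ZModModule.sub_eq_add, sub_eq_zero] at h
  exact h

/-- The boundary of a hemisphere of the deleted join is the double of a chain. -/
theorem exists_bd_halfChain {V : Finset (Fin (n + 1))} (hV : V.card = 2 * k + 3)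
    {u w : Fin (n + 1)} (hu : u ∈ V) (hw : w ∈ V) (huw : u ≠ w) :
    ∃ c ∈ supp (cellLists k V (2 * k + 1)), bd (halfChain k V u w) = c + push Neg.neg c := by
  have hmem : halfChain k V u w ∈ supp (cellLists k V (2 * k + 2)) :=
    Submodule.sum_mem _ fun p hp => single_mem_supp (by
      obtain ⟨⟨h1, h2⟩, h3, h4, h5⟩ := mem_joinCells.1 (halfCells_subset hp)
      exact ⟨p.1, p.2, h3, h1, h2, h4.le, h5.le, by omega, rfl⟩)
  refine exists_eq_add_push_neg (bd_mem_cellLists hmem) (add_push_neg_eq_zero ?_)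
  rw [← bd_push, ← map_add, halfChain_add_push_neg hV hu hw huw, bd_sum_joinCells hV]

/-! ### A linear map of the deleted join -/

/-- A linear map to `ℝ²ᵏ` which maps the vertices of `A` and of `B` to the vertices of two
`k`-simplices with barycenter `0` in complementary subspaces. -/
theorem exists_linearMap_eq_zero_iff {A B : Finset (Fin (n + 1))} (h : Disjoint A B)
    (hA : A.card = k + 1) (hB : B.card = k + 1) :
    ∃ L : (Fin (n + 1) → ℝ) →ₗ[ℝ] EuclideanSpace ℝ (Fin (2 * k)), Function.Surjective L ∧
      ∀ x, L x = 0 ↔ (∃ a, ∀ i ∈ A, x i = a) ∧ ∃ b, ∀ i ∈ B, x i = b := by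
  classical
  obtain ⟨a, ha⟩ : A.Nonempty := Finset.card_pos.1 (by omega)
  obtain ⟨b, hb⟩ : B.Nonempty := Finset.card_pos.1 (by omega)
  let pr (i : Fin (n + 1)) : (Fin (n + 1) → ℝ) →ₗ[ℝ] ℝ := LinearMap.proj i
  let L₁ : (Fin (n + 1) → ℝ) →ₗ[ℝ] (A.erase a → ℝ) × (B.erase b → ℝ) :=
    (LinearMap.pi fun i => pr i.1 - pr a).prod (LinearMap.pi fun i => pr i.1 - pr b)
  have hL₁ : ∀ x, L₁ x = (fun i => x i.1 - x a, fun i => x i.1 - x b) := fun x => rfl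
  have hrank : finrank ℝ ((A.erase a → ℝ) × (B.erase b → ℝ)) =
      finrank ℝ (EuclideanSpace ℝ (Fin (2 * k))) := by
    rw [finrank_prod, finrank_fintype_fun_eq_card, finrank_fintype_fun_eq_card, Fintype.card_coe,
      Fintype.card_coe, Finset.card_erase_of_mem ha, Finset.card_erase_of_mem hb, hA, hB,
      finrank_euclideanSpace_fin]
    omega
  let e := LinearEquiv.ofFinrankEq _ _ hrank
  refine ⟨e.toLinearMap ∘ₗ L₁, ?_, fun x => ?_⟩
  · rw [LinearMap.coe_comp, LinearEquiv.coe_coe]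
    refine e.surjective.comp ?_
    rintro ⟨p, q⟩
    refine ⟨fun i => if hi : i ∈ A.erase a then p ⟨i, hi⟩ else
      if hi : i ∈ B.erase b then q ⟨i, hi⟩ else 0, ?_⟩
    have haB : a ∉ B := Finset.disjoint_left.1 h ha
    have hbA : b ∉ A := Finset.disjoint_right.1 h hb
    rw [hL₁]
    refine Prod.ext (funext fun i => ?_) (funext fun i => ?_)
    · have hi := i.2
      simp [haB, hi]
    · have hi := i.2
      have hiA : i.1 ∉ A := Finset.disjoint_right.1 h (Finset.mem_of_mem_erase hi)
      simp [hbA, hiA, hi]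
  · rw [LinearMap.comp_apply, LinearEquiv.coe_coe, e.map_eq_zero_iff, hL₁, Prod.mk_eq_zero]
    refine and_congr ⟨fun hx => ⟨x a, fun i hi => ?_⟩, ?_⟩ ⟨fun hx => ⟨x b, fun i hi => ?_⟩, ?_⟩
    · by_cases hia : i = a
      · rw [hia]
      · exact sub_eq_zero.1 (congrFun hx ⟨i, Finset.mem_erase.2 ⟨hia, hi⟩⟩)
    · rintro ⟨c, hc⟩
      funext i
      simp [hc i.1 (Finset.mem_of_mem_erase i.2), hc a ha]
    · by_cases hib : i = b
      · rw [hib]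
      · exact sub_eq_zero.1 (congrFun hx ⟨i, Finset.mem_erase.2 ⟨hib, hi⟩⟩)
    · rintro ⟨c, hc⟩
      funext i
      simp [hc i.1 (Finset.mem_of_mem_erase i.2), hc b hb]

/-- The barycenter of a simplex. -/
noncomputable def barycenter (A : Finset (Fin (n + 1))) : Fin (n + 1) → ℝ :=
  fun i => if i ∈ A then (A.card : ℝ)⁻¹ else 0

theorem barycenter_mem {A : Finset (Fin (n + 1))} (hA : A.Nonempty) :
    barycenter A ∈ geomSimplex A := by
  have h0 : (A.card : ℝ) ≠ 0 := by exact_mod_cast (Finset.card_pos.2 hA).ne'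
  refine ⟨⟨fun i => ?_, ?_⟩, fun i hi => if_neg hi⟩
  · simp only [barycenter]
    split_ifs <;> positivity
  · simp [barycenter, h0]

theorem map_single_mem {F : Type*} [AddCommGroup F] [Module ℝ F] {A : Finset (Fin (n + 1))}
    {L : (Fin (n + 1) → ℝ) →ₗ[ℝ] F} (hL : L (barycenter A) = 0) (x : Fin (n + 1) → ℝ) :
    L (coordProj A x) ∈ (vectorSpan ℝ (geomSimplex A)).map L := by
  have h1 : coordProj A x = ∑ i ∈ A, x i • Pi.single i (1 : ℝ) := by
    funext j
    rw [coordProj_apply, Finset.sum_apply]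
    simp [Pi.single_apply]
  rw [h1, map_sum]
  refine Submodule.sum_mem _ fun i hi => ?_
  rw [map_smul]
  refine Submodule.smul_mem _ _ ⟨Pi.single i 1 - barycenter A, ?_, by rw [map_sub, hL, sub_zero]⟩
  exact vsub_mem_vectorSpan ℝ (single_mem_geomSimplex hi) (barycenter_mem ⟨i, hi⟩)

/-- Let `V` be the disjoint union of `A`, `B` and `{w}`. There is a linear map whose only zero in
the deleted join, up to sign, is the midpoint of the barycenters of `A` and `B`. -/
theorem exists_linearMap_joinTarget {A B V : Finset (Fin (n + 1))} {w : Fin (n + 1)}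
    (h : Disjoint A B) (hA : A.card = k + 1) (hB : B.card = k + 1) (hwA : w ∉ A) (hwB : w ∉ B)
    (hV : V = insert w (A ∪ B)) :
    ∃ L : (Fin (n + 1) → ℝ) →ₗ[ℝ] JoinTarget k,
      (∀ σ τ : Finset (Fin (n + 1)), σ ⊆ V → τ ⊆ V → σ.card ≤ k + 1 → τ.card ≤ k + 1 →
        ∀ x ∈ cellSet σ τ, L x = 0 → (A ⊆ σ ∧ B ⊆ τ) ∨ (A ⊆ τ ∧ B ⊆ σ)) ∧
      (∀ x ∈ cellSet A B, L x = 0 ↔ x = (2⁻¹ : ℝ) • (barycenter A - barycenter B)) ∧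
      ∃ M : (Fin (n + 1) → ℝ) →ₗ[ℝ] JoinTarget k, (∀ x ∈ cellSet A B, L x = M x) ∧
        (vectorSpan ℝ (cellSet A B)).map M = ⊤ := by
  classical
  obtain ⟨N, hN, hN0⟩ := exists_linearMap_eq_zero_iff h hA hB
  have hAn : A.Nonempty := Finset.card_pos.1 (by omega)
  have hBn : B.Nonempty := Finset.card_pos.1 (by omega)
  have hk : (0 : ℝ) < k + 1 := by positivity
  have hkV : ∀ x : Fin (n + 1) → ℝ, (∀ i ∉ V, x i = 0) →
      ∑ i, x i = x w + (∑ i ∈ A, x i + ∑ i ∈ B, x i) := by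
    intro x hx
    rw [← Finset.sum_subset (Finset.subset_univ V) fun i _ hi => hx i hi, hV,
      Finset.sum_insert (by simp [hwA, hwB]), Finset.sum_union h]
  let L : (Fin (n + 1) → ℝ) →ₗ[ℝ] JoinTarget k := N.prod (coordSum - (2 : ℝ) • LinearMap.proj w)
  have hL : ∀ x, L x = (N x, ∑ i, x i - 2 * x w) := fun x => by
    simp [L, coordSum_apply]
  have hbA : N (barycenter A) = 0 := (hN0 _).2
    ⟨⟨_, fun i hi => if_pos hi⟩, ⟨_, fun i hi => if_neg (Finset.disjoint_right.1 h hi)⟩⟩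
  have hbB : N (barycenter B) = 0 := (hN0 _).2
    ⟨⟨_, fun i hi => if_neg (Finset.disjoint_left.1 h hi)⟩, ⟨_, fun i hi => if_pos hi⟩⟩
  -- The coordinates of a zero are `a` on `A`, `b` on `B`, and `(k + 1) (a + b)` at `w`.
  have hker : ∀ x : Fin (n + 1) → ℝ, (∀ i ∉ V, x i = 0) → L x = 0 →
      ∃ a b : ℝ, (∀ i ∈ A, x i = a) ∧ (∀ i ∈ B, x i = b) ∧ x w = (k + 1) * (a + b) := by
    intro x hx h0
    rw [hL, Prod.mk_eq_zero] at h0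
    obtain ⟨⟨a, ha⟩, b, hb⟩ := (hN0 x).1 h0.1
    refine ⟨a, b, ha, hb, ?_⟩
    have h2 := h0.2
    rw [hkV x hx, Finset.sum_congr rfl ha, Finset.sum_congr rfl hb] at h2
    simp only [Finset.sum_const, hA, hB, nsmul_eq_mul] at h2
    push_cast at h2
    linarith
  refine ⟨L, ?_, ?_, ?_⟩
  · intro σ τ hσ hτ hσk hτk x hx h0
    obtain ⟨a, b, ha, hb, hw⟩ := hker x (fun i hi => hx.2.2.1 i (fun h => hi (hσ h))
      fun h => hi (hτ h)) h0
    have hpos : ∀ i, 0 < x i → i ∈ σ := fun i hi => by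
      by_contra hiσ
      by_cases hiτ : i ∈ τ
      · exact absurd (hx.2.1 i hiτ) (not_le.2 hi)
      · exact hi.ne' (hx.2.2.1 i hiσ hiτ)
    have hneg : ∀ i, x i < 0 → i ∈ τ := fun i hi => by
      by_contra hiτ
      by_cases hiσ : i ∈ σ
      · exact absurd (hx.1 i hiσ) (not_le.2 hi)
      · exact hi.ne (hx.2.2.1 i hiσ hiτ)
    have hlarge : ∀ C D : Finset (Fin (n + 1)), C.card = k + 1 → w ∉ C → D.card ≤ k + 1 →
        w ∈ D → ¬C ⊆ D := fun C D hC hwC hD hwD hCD => by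
      have := Finset.card_le_card (Finset.insert_subset hwD hCD)
      rw [Finset.card_insert_of_notMem hwC] at this
      omega
    rcases lt_trichotomy (a + b) 0 with hab | hab | hab
    · have hwτ : w ∈ τ := hneg w (by rw [hw]; exact mul_neg_of_pos_of_neg hk hab)
      exfalso
      rcases (show a < 0 ∨ b < 0 by by_contra! hcon; linarith) with h1 | h1
      · exact hlarge A τ hA hwA hτk hwτ fun i hi => hneg i (by rw [ha i hi]; exact h1)
      · exact hlarge B τ hB hwB hτk hwτ fun i hi => hneg i (by rw [hb i hi]; exact h1)
    · rcases lt_trichotomy a 0 with h1 | h1 | h1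
      · exact Or.inr ⟨fun i hi => hneg i (by rw [ha i hi]; exact h1),
          fun i hi => hpos i (by rw [hb i hi]; linarith)⟩
      · exfalso
        have h2 : ∀ i, x i = 0 := fun i => by
          by_cases hiA : i ∈ A
          · rw [ha i hiA, h1]
          by_cases hiB : i ∈ B
          · rw [hb i hiB]; linarith
          by_cases hiw : i = w
          · rw [hiw, hw, hab, mul_zero]
          have hiV : i ∉ V := by simp [hV, hiA, hiB, hiw]
          exact hx.2.2.1 i (fun h => hiV (hσ h)) fun h => hiV (hτ h)
        have h3 := hx.2.2.2
        simp [h2] at h3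
      · exact Or.inl ⟨fun i hi => hpos i (by rw [ha i hi]; exact h1),
          fun i hi => hneg i (by rw [hb i hi]; linarith)⟩
    · have hwσ : w ∈ σ := hpos w (by rw [hw]; exact mul_pos hk hab)
      exfalso
      rcases (show 0 < a ∨ 0 < b by by_contra! hcon; linarith) with h1 | h1
      · exact hlarge A σ hA hwA hσk hwσ fun i hi => hpos i (by rw [ha i hi]; exact h1)
      · exact hlarge B σ hB hwB hσk hwσ fun i hi => hpos i (by rw [hb i hi]; exact h1)
  · intro x hx
    have hxV : ∀ i ∉ V, x i = 0 := fun i hi => hx.2.2.1 i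
      (fun h => hi (by simp [hV, h])) fun h => hi (by simp [hV, h])
    have hxw : x w = 0 := hx.2.2.1 w hwA hwB
    constructor
    · intro h0
      obtain ⟨a, b, ha, hb, hw⟩ := hker x hxV h0
      rw [hxw] at hw
      have hab : a + b = 0 := by
        rcases mul_eq_zero.1 hw.symm with h1 | h1
        · exact absurd h1 hk.ne'
        · exact h1
      have h1 : ∑ i, |x i| = |x w| + (∑ i ∈ A, |x i| + ∑ i ∈ B, |x i|) :=
        hkV (fun i => |x i|) fun i hi => by simp [hxV i hi]
      obtain ⟨i₀, hi₀⟩ := hAn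
      have ha0 : 0 ≤ a := by rw [← ha i₀ hi₀]; exact hx.1 i₀ hi₀
      have hsA : ∑ i ∈ A, |x i| = ∑ i ∈ A, a :=
        Finset.sum_congr rfl fun i hi => by rw [ha i hi, abs_of_nonneg ha0]
      have hsB : ∑ i ∈ B, |x i| = ∑ i ∈ B, a := Finset.sum_congr rfl fun i hi => by
        rw [hb i hi, show b = -a by linarith, abs_neg, abs_of_nonneg ha0]
      rw [hx.2.2.2, hxw, hsA, hsB] at h1
      simp only [Finset.sum_const, hA, hB, nsmul_eq_mul, abs_zero] at h1
      push_cast at h1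
      have ha1 : a = 2⁻¹ * (k + 1 : ℝ)⁻¹ := by
        field_simp
        linarith
      funext i
      simp only [Pi.smul_apply, Pi.sub_apply, smul_eq_mul, barycenter, hA, hB]
      push_cast
      by_cases hiA : i ∈ A
      · rw [if_pos hiA, if_neg (Finset.disjoint_left.1 h hiA), ha i hiA, sub_zero, ha1]
      · by_cases hiB : i ∈ B
        · rw [if_neg hiA, if_pos hiB, hb i hiB, show b = -a by linarith, ha1]; ring
        · rw [if_neg hiA, if_neg hiB, hx.2.2.1 i hiA hiB]; ring
    · rintro rfl
      rw [hL, hxw, map_smul, map_sub, hbA, hbB]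
      simp [← Finset.mul_sum, (barycenter_mem hAn).1.2, (barycenter_mem hBn).1.2]
  · have hz : ∀ x, homogenize N.toAffineMap x = N x := fun x => by simp [homogenize]
    have hdec : ∀ x, N (coordProj A x) + N (coordProj B x) = N x := fun x => by
      rw [← map_add, ← sub_eq_zero, ← map_sub, hN0]
      refine ⟨⟨0, fun i hi => ?_⟩, ⟨0, fun i hi => ?_⟩⟩
      · simp [coordProj_apply, hi, Finset.disjoint_left.1 h hi]
      · simp [coordProj_apply, hi, Finset.disjoint_right.1 h hi]
    refine ⟨_, fun x hx => ?_, map_vectorSpan_cellSet_eq_top h hAn hBn (A := N.toAffineMap)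
      (B := N.toAffineMap) ?_⟩
    · rw [hL, hx.2.2.1 w hwA hwB]
      simp [hz, hdec, coordSum_apply]
    · refine eq_top_iff.2 fun y _ => ?_
      obtain ⟨x, rfl⟩ := hN y
      rw [← hdec]
      exact Submodule.add_mem_sup (map_single_mem hbA x) (map_single_mem hbB x)

/-! ### The parity of the number of intersection points -/

/-- The number of intersection points of the images of disjoint `k`-simplices of the
`(2k+2)`-simplex is odd: it is the degree of an odd map of the deleted join, a sphere with the
antipodal map, and agrees with the degree of a linear map. -/
theorem sum_ncard_halfCells (hk : 1 ≤ k) {g : (Fin (n + 1) → ℝ) → EuclideanSpace ℝ (Fin (2 * k))}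
    (hg : IsGeneralPosition n k g) {V : Finset (Fin (n + 1))} (hV : V.card = 2 * k + 3)
    {u w : Fin (n + 1)} (hu : u ∈ V) (hw : w ∈ V) (huw : u ≠ w) :
    ∑ p ∈ halfCells k V u w,
      ((g '' geomSimplex p.1 ∩ g '' geomSimplex p.2).ncard : ZMod 2) = 1 := by
  classical
  let μ : Measure (JoinTarget k) := Measure.addHaar
  -- A linear map whose only zero lies in the simplex `A * B`.
  obtain ⟨A, huA, hAV, hA⟩ := Finset.exists_subsuperset_card_eq (s := {u}) (t := V.erase w)
    (n := k + 1) (by simpa using ⟨huw, hu⟩) (by simp)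
    (by rw [Finset.card_erase_of_mem hw, hV]; omega)
  rw [Finset.singleton_subset_iff] at huA
  set B := V.erase w \ A with hBdef
  have hB : B.card = k + 1 := by
    rw [hBdef, Finset.card_sdiff_of_subset hAV, Finset.card_erase_of_mem hw, hV, hA]; omega
  have hAB : Disjoint A B := Finset.disjoint_sdiff
  have hwA : w ∉ A := fun hwA => Finset.notMem_erase w V (hAV hwA)
  have hwB : w ∉ B := fun hwB => Finset.notMem_erase w V (Finset.sdiff_subset hwB)
  have hVAB : V = insert w (A ∪ B) := by
    rw [hBdef, Finset.union_sdiff_of_subset hAV, Finset.insert_erase hw]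
  obtain ⟨L, hL1, hL2, M, hLM, hM⟩ := exists_linearMap_joinTarget hAB hA hB hwA hwB hVAB
  have hLc : Continuous L := L.continuous_of_finiteDimensional
  have hpAB : (A, B) ∈ halfCells k V u w := Finset.mem_filter.2 ⟨mem_joinCells.2
    ⟨⟨hAV.trans (Finset.erase_subset _ _), Finset.sdiff_subset.trans (Finset.erase_subset _ _)⟩,
      hAB, hA, hB⟩, Or.inl huA⟩
  have hdim : ∀ p ∈ halfCells k V u w,
      (cellList p.1 p.2).length = finrank ℝ (JoinTarget k) + 1 := fun p hp => by
    obtain ⟨-, h1, h2, h3⟩ := mem_joinCells.1 (halfCells_subset hp)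
    rw [length_cellList h1, h2, h3, finrank_joinTarget]; ring
  -- The degree of the linear map.
  have hcountL : ∀ᶠ r in atTop, ∀ p ∈ halfCells k V u w, ∀ᶠ v in 𝓝 (0 : JoinTarget k) ⊓ ae μ,
      count {v} (push L ((sd (2 * k + 2) ^ r) (single (cellList p.1 p.2) 1))) =
        if p = (A, B) then 1 else 0 := by
    refine (Filter.eventually_all_finset _).2 fun p hp => ?_
    obtain ⟨⟨h1, h2⟩, h3, h4, h5⟩ := mem_joinCells.1 (halfCells_subset hp)
    by_cases hpe : p = (A, B)
    · subst hpe
      set z : Fin (n + 1) → ℝ := (2⁻¹ : ℝ) • (barycenter A - barycenter B) with hz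
      have hAn : A.Nonempty := ⟨u, huA⟩
      have hBn : B.Nonempty := Finset.card_pos.1 (by omega)
      have hzmem : z ∈ cellSet A B := join_mem_cellSet hAB (barycenter_mem hAn) (barycenter_mem hBn)
      have hk : (k + 1 : ℝ) ≠ 0 := by positivity
      have key := eventually_count_push_sd_pow μ (hdim _ hp) (G := L) hLc.continuousOn {z}
        (by
          rw [convexHull_cellList hAB]
          intro x hx
          rw [hL2 x hx, Finset.mem_singleton])
        (by
          rw [convexHull_cellList hAB]
          intro y hy
          rw [Finset.mem_singleton.1 hy]
          exact hzmem)
        (by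
          intro y hy
          rw [Finset.mem_singleton.1 hy]
          refine ⟨M, ?_, injOn_and_mem_interior_cell hAB
            ((length_cellList hAB).symm.trans (hdim _ hp)) hM hzmem (fun i hi => ?_)
            (fun i hi => ?_) ?_⟩
          · rw [convexHull_cellList hAB]
            filter_upwards [self_mem_nhdsWithin] with x hx
            exact hLM x hx
          · simp [hz, barycenter, hi, Finset.disjoint_left.1 hAB hi, hA, hk]
          · simp [hz, barycenter, hi, Finset.disjoint_right.1 hAB hi, hB, hk]
          · rw [← hLM z hzmem, hL2 z hzmem])
      rw [finrank_joinTarget, Finset.card_singleton, Nat.cast_one] at key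
      simpa using key
    · rw [if_neg hpe]
      have key := eventually_count_push_sd_pow μ (hdim _ hp) (G := L) hLc.continuousOn ∅
        (by
          rw [convexHull_cellList h3]
          intro x hx
          refine iff_of_false (fun h0 => hpe ?_) (Finset.notMem_empty _)
          rcases hL1 p.1 p.2 h1 h2 h4.le h5.le x hx h0 with h6 | h6
          · exact Prod.ext (Finset.eq_of_subset_of_card_le h6.1 (by omega)).symm
              (Finset.eq_of_subset_of_card_le h6.2 (by omega)).symm
          · exfalso
            have h7 := h6.1 huA
            rcases (Finset.mem_filter.1 hp).2 with h8 | h8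
            · exact Finset.disjoint_left.1 h3 h8 h7
            · exact h8.1 h7)
        (by simp) (by simp)
      rw [finrank_joinTarget, Finset.card_empty, Nat.cast_zero] at key
      exact key
  have hcountG : ∀ᶠ r in atTop, ∀ p ∈ halfCells k V u w, ∀ᶠ v in 𝓝 (0 : JoinTarget k) ⊓ ae μ,
      count {v} (push (joinMap g) ((sd (2 * k + 2) ^ r) (single (cellList p.1 p.2) 1))) =
        ((g '' geomSimplex p.1 ∩ g '' geomSimplex p.2).ncard : ZMod 2) := by
    refine (Filter.eventually_all_finset _).2 fun p hp => ?_
    obtain ⟨-, h3, h4, h5⟩ := mem_joinCells.1 (halfCells_subset hp)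
    exact eventually_count_joinMap μ hg ⟨_, h4⟩ ⟨_, h5⟩ h3
  -- The boundary of a hemisphere is the double of a chain, and so is the boundary of that chain.
  obtain ⟨c₁, hc₁, hb₂⟩ := exists_bd_halfChain hV hu hw huw
  have hinv₁ : push Neg.neg (bd c₁) = bd c₁ := by
    refine add_push_neg_eq_zero ?_
    rw [← bd_push, ← map_add, ← hb₂, bd_bd]
  have hb₁ : ∃ c₀ : Chain (Fin (n + 1) → ℝ), bd c₁ = c₀ + push Neg.neg c₀ := by
    obtain ⟨j, hj⟩ : ∃ j, 2 * k = j + 1 := ⟨2 * k - 1, by omega⟩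
    rw [hj] at hc₁
    obtain ⟨c₀, -, hc₀⟩ := exists_eq_add_push_neg (bd_mem_cellLists hc₁) hinv₁
    exact ⟨c₀, hc₀⟩
  obtain ⟨c₀, hb₁⟩ := hb₁
  have hcont := continuousOn_of_isPL hg.isPL
  have hdeg := eventually_count_push_eq_of_odd μ (finrank_joinTarget (k := k)) (G := joinMap g)
    (G' := L) (Submodule.sum_mem _ fun p hp => single_mem_supp
      ((hdim p hp).trans (by rw [finrank_joinTarget]))) hb₂ hb₁ (joinMap_neg g)
    (fun x => map_neg L x)
    (supported_mono (fun l hl => by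
      obtain ⟨σ, τ, h, h1, h2, h3, h4, h5, rfl⟩ := hl
      refine ⟨(length_cellList h).trans h5, ?_⟩
      rw [convexHull_cellList h]
      refine ⟨fun x hx => neg_notMem_cellSet hx, ⟨continuousOn_joinMap
        (hcont.mono (geomSimplex_subset_skeleton h3)) (hcont.mono (geomSimplex_subset_skeleton h4)),
        fun x hx => joinMap_ne_zero hg h h3 h4 h5.le hx⟩, hLc.continuousOn, fun x hx h0 => ?_⟩
      have h6 : A.card + B.card ≤ σ.card + τ.card := by
        rcases hL1 σ τ h1 h2 h3 h4 x hx h0 with h6 | h6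
        · exact Nat.add_le_add (Finset.card_le_card h6.1) (Finset.card_le_card h6.2)
        · rw [add_comm σ.card]
          exact Nat.add_le_add (Finset.card_le_card h6.1) (Finset.card_le_card h6.2)
      omega) hc₁)
  obtain ⟨r, hr, hrL, hrG⟩ := (hdeg.and (hcountL.and hcountG)).exists
  have hne := neBot_nhds_inf_ae μ
  obtain ⟨v, hv, hvL, hvG⟩ := (hr.and (((Filter.eventually_all_finset _).2 hrL).and
    ((Filter.eventually_all_finset _).2 hrG))).exists
  simp only [map_sum] at hv
  rw [Finset.sum_congr rfl hvL, Finset.sum_congr rfl hvG, Finset.sum_ite_eq', if_pos hpAB] at hv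
  exact hv

/-! ### Cochains of the deleted product on cycles of the deleted join -/

theorem single_mem_cellList_iff {σ τ : Finset (Fin (n + 1))} (h : Disjoint σ τ)
    (i : Fin (n + 1)) :
    ((Pi.single i 1 : Fin (n + 1) → ℝ) ∈ cellList σ τ ↔ i ∈ σ) ∧
      ((Pi.single i (-1) : Fin (n + 1) → ℝ) ∈ cellList σ τ ↔ i ∈ τ) := by
  have h1 : ∀ {σ τ : Finset (Fin (n + 1))} (_ : Disjoint σ τ),
      (Pi.single i 1 : Fin (n + 1) → ℝ) ∈ cellList σ τ ↔ i ∈ σ := by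
    intro σ τ h
    rw [cellList, List.mem_map]
    constructor
    · rintro ⟨j, -, hj⟩
      have h1 := congrFun hj i
      by_cases hij : i = j
      · subst hij
        by_contra hi
        simp [signed, hi] at h1
        norm_num at h1
      · simp [signed, hij] at h1
    · intro hi
      exact ⟨i, by simp [hi], by simp [signed, hi]⟩
  refine ⟨h1 h, ?_⟩
  rw [← h1 h.symm, ← map_neg_cellList h, List.mem_map]
  constructor
  · intro hi
    exact ⟨_, hi, by rw [← Pi.single_neg, neg_neg]⟩
  · rintro ⟨x, hx, hxi⟩
    rw [Pi.single_neg, ← hxi, neg_neg]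
    exact hx

/-- A symmetric function of pairs of simplices extends to a linear form on chains which is invariant
under the antipodal map. -/
theorem exists_linearForm_cellList (F : Finset (Fin (n + 1)) → Finset (Fin (n + 1)) → ZMod 2)
    (hF : ∀ σ τ, F σ τ = F τ σ) :
    ∃ φ : Chain (Fin (n + 1) → ℝ) →ₗ[ZMod 2] ZMod 2,
      (∀ σ τ, Disjoint σ τ → φ (single (cellList σ τ) 1) = F σ τ) ∧
        ∀ c, φ (push Neg.neg c) = φ c := by
  classical
  let f : List (Fin (n + 1) → ℝ) → ZMod 2 := fun l =>
    F (Finset.univ.filter fun i => Pi.single i 1 ∈ l)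
      (Finset.univ.filter fun i => Pi.single i (-1) ∈ l)
  refine ⟨linearCombination (ZMod 2) f, fun σ τ h => ?_, fun c => ?_⟩
  · have h1 := single_mem_cellList_iff h
    simp [f, h1]
  · have h2 : ∀ l : List (Fin (n + 1) → ℝ), f (l.map Neg.neg) = f l := by
      intro l
      have h3 : ∀ (i : Fin (n + 1)) (a : ℝ),
          (Pi.single i a : Fin (n + 1) → ℝ) ∈ l.map Neg.neg ↔ Pi.single i (-a) ∈ l := by
        intro i a
        rw [List.mem_map]
        constructor
        · rintro ⟨x, hx, hxi⟩
          rw [Pi.single_neg, ← hxi, neg_neg]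
          exact hx
        · intro hi
          exact ⟨_, hi, by rw [← Pi.single_neg, neg_neg]⟩
      simp only [f, h3, neg_neg]
      exact hF _ _
    have h3 : linearCombination (ZMod 2) f ∘ₗ push Neg.neg = linearCombination (ZMod 2) f :=
      Finsupp.lhom_ext fun l r => by
        rw [LinearMap.comp_apply, push_single, linearCombination_single,
          linearCombination_single, h2]
    exact LinearMap.congr_fun h3 c

section Coboundary

variable {f F : Finset (Fin (n + 1)) → Finset (Fin (n + 1)) → ZMod 2}

/-- A coboundary vanishes on the join of two boundaries. -/
theorem sum_coboundary_boundary (hF : ∀ σ τ, F σ τ = F τ σ)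
    (hf : ∀ σ τ, Disjoint σ τ → σ.card = k + 1 → τ.card = k + 1 →
      f σ τ = ∑ i ∈ σ, F (σ.erase i) τ + ∑ j ∈ τ, F σ (τ.erase j))
    {κ κ' : Finset (Fin (n + 1))} (hκ : κ.card = k + 2) (hκ' : κ'.card = k + 2)
    (h : Disjoint κ κ') : ∑ x ∈ κ, ∑ y ∈ κ', f (κ.erase x) (κ'.erase y) = 0 := by
  obtain ⟨φ, hφ, -⟩ := exists_linearForm_cellList F hF
  have h1 : ∀ σ τ, Disjoint σ τ → σ.card = k + 1 → τ.card = k + 1 →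
      φ (bd (single (cellList σ τ) 1)) = f σ τ := by
    intro σ τ h hσ hτ
    rw [hf σ τ h hσ hτ, bd_single, bdList_cellList_of_disjoint h, map_add, map_sum, map_sum]
    congr 1
    · exact Finset.sum_congr rfl fun i _ => hφ _ _ (h.mono_left (Finset.erase_subset _ _))
    · exact Finset.sum_congr rfl fun i _ => hφ _ _ (h.mono_right (Finset.erase_subset _ _))
  have h2 : φ (bd (boundaryJoin κ κ')) = 0 := by rw [bd_boundaryJoin h, map_zero]
  rw [← h2, boundaryJoin]
  simp only [map_sum]
  refine Finset.sum_congr rfl fun x hx => Finset.sum_congr rfl fun y hy =>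
    (h1 _ _ (disjoint_erase h x y) ?_ ?_).symm
  · rw [Finset.card_erase_of_mem hx, hκ]; rfl
  · rw [Finset.card_erase_of_mem hy, hκ']; rfl

/-- A coboundary vanishes on the quotient of the deleted join by the involution. -/
theorem sum_coboundary_halfCells (hF : ∀ σ τ, F σ τ = F τ σ)
    (hf : ∀ σ τ, Disjoint σ τ → σ.card = k + 1 → τ.card = k + 1 →
      f σ τ = ∑ i ∈ σ, F (σ.erase i) τ + ∑ j ∈ τ, F σ (τ.erase j))
    {V : Finset (Fin (n + 1))} (hV : V.card = 2 * k + 3) {u w : Fin (n + 1)} (hu : u ∈ V)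
    (hw : w ∈ V) (huw : u ≠ w) : ∑ p ∈ halfCells k V u w, f p.1 p.2 = 0 := by
  obtain ⟨φ, hφ, hφ'⟩ := exists_linearForm_cellList F hF
  obtain ⟨c, -, hc⟩ := exists_bd_halfChain hV hu hw huw
  have h2 : φ (bd (halfChain k V u w)) = 0 := by
    rw [hc, map_add, hφ', ZModModule.add_self]
  rw [← h2, halfChain]
  simp only [map_sum]
  refine Finset.sum_congr rfl fun p hp => ?_
  obtain ⟨-, h, hσ, hτ⟩ := mem_joinCells.1 (halfCells_subset hp)
  rw [hf _ _ h hσ hτ, bd_single, bdList_cellList_of_disjoint h, map_add, map_sum, map_sum]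
  congr 1
  · exact Finset.sum_congr rfl fun i _ => (hφ _ _ (h.mono_left (Finset.erase_subset _ _))).symm
  · exact Finset.sum_congr rfl fun i _ => (hφ _ _ (h.mono_right (Finset.erase_subset _ _))).symm

/-- The value of a cochain on `K̄` on the image of `σ × τ`, extended by zero. -/
def cochainOn {m : ℕ} (c : BarCochain n k m) (σ τ : Finset (Fin (n + 1))) : ZMod 2 :=
  open Classical in
  if h : σ.Nonempty ∧ τ.Nonempty ∧ σ.card ≤ k + 1 ∧ τ.card ≤ k + 1 ∧ Disjoint σ τ ∧
    σ.card + τ.card = m + 2 then c (Quotient.mk _ ⟨(σ, τ), h⟩) else 0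

theorem cochainOn_cell {m : ℕ} (c : BarCochain n k m) (q : Cell n k m) :
    cochainOn c q.1.1 q.1.2 = c (Quotient.mk _ q) := dif_pos q.2

theorem cochainOn_symm {m : ℕ} (c : BarCochain n k m) (σ τ : Finset (Fin (n + 1))) :
    cochainOn c σ τ = cochainOn c τ σ := by
  by_cases h : σ.Nonempty ∧ τ.Nonempty ∧ σ.card ≤ k + 1 ∧ τ.card ≤ k + 1 ∧ Disjoint σ τ ∧
    σ.card + τ.card = m + 2
  · have h1 := cochainOn_cell c ⟨(σ, τ), h⟩
    rw [show Quotient.mk (cellSetoid n k m) ⟨(σ, τ), h⟩ = Quotient.mk _ (Cell.swap ⟨(σ, τ), h⟩) from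
      Quotient.sound (Or.inr rfl), ← cochainOn_cell c] at h1
    exact h1
  · rw [cochainOn, cochainOn, dif_neg h,
      dif_neg fun h' => h (Cell.swap (⟨(τ, σ), h'⟩ : Cell n k m)).2]

theorem coboundary_mk (hk : 1 ≤ k) (c : BarCochain n k (2 * k - 1)) (p : Cell n k (2 * k)) :
    coboundary n k (2 * k - 1) (2 * k) c (Quotient.mk _ p) =
      ∑ i ∈ p.1.1, cochainOn c (p.1.1.erase i) p.1.2 +
        ∑ j ∈ p.1.2, cochainOn c p.1.1 (p.1.2.erase j) := by
  classical
  obtain ⟨⟨σ, τ⟩, hσ0, hτ0, hσ, hτ, h, hm⟩ := p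
  change σ.card ≤ k + 1 at hσ
  change τ.card ≤ k + 1 at hτ
  change σ.card + τ.card = 2 * k + 2 at hm
  have hσ' : σ.card = k + 1 := by omega
  have hτ' : τ.card = k + 1 := by omega
  have hL : ∀ i ∈ σ, (σ.erase i).Nonempty ∧ τ.Nonempty ∧ (σ.erase i).card ≤ k + 1 ∧
      τ.card ≤ k + 1 ∧ Disjoint (σ.erase i) τ ∧ (σ.erase i).card + τ.card = 2 * k - 1 + 2 :=
    fun i hi => by
      have h1 : (σ.erase i).card = k := by rw [Finset.card_erase_of_mem hi, hσ']; rfl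
      exact ⟨Finset.card_pos.1 (by omega), hτ0, by omega, hτ,
        h.mono_left (Finset.erase_subset _ _), by omega⟩
  have hR : ∀ j ∈ τ, σ.Nonempty ∧ (τ.erase j).Nonempty ∧ σ.card ≤ k + 1 ∧
      (τ.erase j).card ≤ k + 1 ∧ Disjoint σ (τ.erase j) ∧
        σ.card + (τ.erase j).card = 2 * k - 1 + 2 :=
    fun j hj => by
      have h1 : (τ.erase j).card = k := by rw [Finset.card_erase_of_mem hj, hτ']; rfl
      exact ⟨hσ0, Finset.card_pos.1 (by omega), hσ, by omega,
        h.mono_right (Finset.erase_subset _ _), by omega⟩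
  have herase : ∀ {s t : Finset (Fin (n + 1))}, s ⊆ t → s.card + 1 = t.card →
      ∃ i ∈ t, t.erase i = s := fun {s t} hst hc => by
    obtain ⟨i, hi⟩ := Finset.card_eq_one.1 (show (t \ s).card = 1 by
      rw [Finset.card_sdiff_of_subset hst]; omega)
    refine ⟨i, Finset.sdiff_subset (hi ▸ Finset.mem_singleton_self i), ?_⟩
    rw [Finset.erase_eq, ← hi, Finset.sdiff_sdiff_eq_self hst]
  change (∑ q : Cell n k (2 * k - 1), if q.IsFacet (⟨(σ, τ), hσ0, hτ0, hσ, hτ, h, hm⟩ :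
    Cell n k (2 * k)) then c (Quotient.mk _ q) else 0) = _
  rw [← Finset.sum_filter]
  have hsplit : (Finset.univ.filter fun q : Cell n k (2 * k - 1) =>
      q.IsFacet (⟨(σ, τ), hσ0, hτ0, hσ, hτ, h, hm⟩ : Cell n k (2 * k))) =
      (Finset.univ.filter fun q : Cell n k (2 * k - 1) =>
        q.1.1 ⊆ σ ∧ q.1.1.card + 1 = σ.card ∧ q.1.2 = τ) ∪
      (Finset.univ.filter fun q : Cell n k (2 * k - 1) =>
        q.1.1 = σ ∧ q.1.2 ⊆ τ ∧ q.1.2.card + 1 = τ.card) := by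
    rw [← Finset.filter_or]
    ext q
    rw [Finset.mem_filter, Finset.mem_filter]
    exact Iff.rfl
  rw [hsplit, Finset.sum_union]
  · congr 1
    · refine (Finset.sum_bij (fun i hi => (⟨(σ.erase i, τ), hL i hi⟩ : Cell n k (2 * k - 1)))
        ?_ ?_ ?_ ?_).symm
      · intro i hi
        exact Finset.mem_filter.2 ⟨Finset.mem_univ _, Finset.erase_subset _ _,
          Finset.card_erase_add_one hi, rfl⟩
      · intro i hi j hj hij
        have h1 : σ.erase i = σ.erase j := congrArg (fun q => q.1.1) hij
        by_contra hne
        have h2 : i ∈ σ.erase j := Finset.mem_erase.2 ⟨hne, hi⟩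
        rw [← h1] at h2
        exact Finset.notMem_erase i σ h2
      · rintro ⟨⟨s, t⟩, hq⟩ hq'
        obtain ⟨-, h1, h2, h3⟩ := Finset.mem_filter.1 hq'
        obtain ⟨i, hi, hie⟩ := herase h1 h2
        exact ⟨i, hi, Subtype.ext (Prod.ext hie h3.symm)⟩
      · intro i hi
        exact cochainOn_cell c ⟨(σ.erase i, τ), hL i hi⟩
    · refine (Finset.sum_bij (fun j hj => (⟨(σ, τ.erase j), hR j hj⟩ : Cell n k (2 * k - 1)))
        ?_ ?_ ?_ ?_).symm
      · intro i hi
        exact Finset.mem_filter.2 ⟨Finset.mem_univ _, rfl, Finset.erase_subset _ _,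
          Finset.card_erase_add_one hi⟩
      · intro i hi j hj hij
        have h1 : τ.erase i = τ.erase j := congrArg (fun q => q.1.2) hij
        by_contra hne
        have h2 : i ∈ τ.erase j := Finset.mem_erase.2 ⟨hne, hi⟩
        rw [← h1] at h2
        exact Finset.notMem_erase i τ h2
      · rintro ⟨⟨s, t⟩, hq⟩ hq'
        obtain ⟨-, h1, h2, h3⟩ := Finset.mem_filter.1 hq'
        obtain ⟨i, hi, hie⟩ := herase h2 h3
        exact ⟨i, hi, Subtype.ext (Prod.ext h1.symm hie)⟩
      · intro i hi
        exact cochainOn_cell c ⟨(σ, τ.erase i), hR i hi⟩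
  · rw [Finset.disjoint_left]
    intro q hq hq'
    obtain ⟨-, -, h1, -⟩ := Finset.mem_filter.1 hq
    obtain ⟨-, h2, -⟩ := Finset.mem_filter.1 hq'
    rw [h2] at h1
    omega

end Coboundary

/-! ### The sum over the pairs of simplices which avoid a vertex -/

/-- The pairs of complementary `k`-simplices in `V` without the vertex `v`, in the order for which
`u` belongs to the first simplex. -/
def oppositePairs (k : ℕ) (V : Finset (Fin (n + 1))) (u v : Fin (n + 1)) :
    Finset (Finset (Fin (n + 1)) × Finset (Fin (n + 1))) :=
  (joinCells k (V.erase v)).filter fun p => u ∈ p.1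

theorem mem_oppositePairs {V : Finset (Fin (n + 1))} {u v : Fin (n + 1)}
    {p : Finset (Fin (n + 1)) × Finset (Fin (n + 1))} :
    p ∈ oppositePairs k V u v ↔ ((p.1 ⊆ V ∧ v ∉ p.1) ∧ p.2 ⊆ V ∧ v ∉ p.2) ∧
      (Disjoint p.1 p.2 ∧ p.1.card = k + 1 ∧ p.2.card = k + 1) ∧ u ∈ p.1 := by
  rw [oppositePairs, Finset.mem_filter, mem_joinCells, Finset.subset_erase, Finset.subset_erase,
    and_assoc]

theorem oppositePairs_union {V : Finset (Fin (n + 1))} (hV : V.card = 2 * k + 3) {u v : Fin (n + 1)}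
    (hv : v ∈ V) {p : Finset (Fin (n + 1)) × Finset (Fin (n + 1))}
    (hp : p ∈ oppositePairs k V u v) :
    p.1 ∪ p.2 = V.erase v := by
  have hp' := (Finset.mem_filter.1 hp).1
  obtain ⟨⟨h1, h2⟩, -⟩ := mem_joinCells.1 hp'
  refine Finset.eq_of_subset_of_card_le (Finset.union_subset h1 h2) ?_
  rw [card_union_joinCell hp', Finset.card_erase_of_mem hv, hV]
  omega

theorem exchange_mem {V : Finset (Fin (n + 1))} {v : Fin (n + 1)}
    {p : Finset (Fin (n + 1)) × Finset (Fin (n + 1))} (hp : p ∈ joinCells k (V.erase v))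
    {a b : Fin (n + 1)} (ha : a ∈ p.1) (hb : b ∈ p.2) :
    (insert b (p.1.erase a), insert a (p.2.erase b)) ∈ joinCells k (V.erase v) := by
  obtain ⟨⟨h1, h2⟩, h3, h4, h5⟩ := mem_joinCells.1 hp
  have hb1 : b ∉ p.1 := Finset.disjoint_right.1 h3 hb
  have ha2 : a ∉ p.2 := Finset.disjoint_left.1 h3 ha
  refine mem_joinCells.2 ⟨⟨Finset.insert_subset (h2 hb) ((Finset.erase_subset _ _).trans h1),
    Finset.insert_subset (h1 ha) ((Finset.erase_subset _ _).trans h2)⟩, ?_, ?_, ?_⟩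
  · rw [Finset.disjoint_left]
    intro x hx hx'
    rw [Finset.mem_insert, Finset.mem_erase] at hx hx'
    rcases hx with rfl | ⟨hxa, hx⟩
    · rcases hx' with rfl | hx'
      · exact hb1 ha
      · exact hx'.1 rfl
    · rcases hx' with rfl | hx'
      · exact hxa rfl
      · exact Finset.disjoint_left.1 h3 hx hx'.2
  · rw [Finset.card_insert_of_notMem fun h => hb1 (Finset.mem_of_mem_erase h),
      Finset.card_erase_add_one ha, h4]
  · rw [Finset.card_insert_of_notMem fun h => ha2 (Finset.mem_of_mem_erase h),
      Finset.card_erase_add_one hb, h5]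

/-- The pairs of facets which both contain `v` cancel: exchange the two vertices which are omitted.
-/
theorem sum_facets_containing (hk : 1 ≤ k) {V : Finset (Fin (n + 1))} {u v : Fin (n + 1)}
    {B : Finset (Fin (n + 1)) → Finset (Fin (n + 1)) → ZMod 2} (hB : ∀ σ τ, B σ τ = B τ σ) :
    ∑ p ∈ oppositePairs k V u v, ∑ a ∈ p.1, ∑ b ∈ p.2,
      B (insert v (p.1.erase a)) (insert v (p.2.erase b)) = 0 := by
  have h0 : ∀ p : Finset (Fin (n + 1)) × Finset (Fin (n + 1)), ∑ a ∈ p.1, ∑ b ∈ p.2,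
      B (insert v (p.1.erase a)) (insert v (p.2.erase b)) = ∑ x ∈ p.1 ×ˢ p.2,
      B (insert v (p.1.erase x.1)) (insert v (p.2.erase x.2)) := fun p => by
    rw [Finset.sum_product]
  rw [Finset.sum_congr rfl fun p _ => h0 p, Finset.sum_sigma']
  -- When `u` is exchanged, the two simplices exchange their roles.
  let inv : (Σ _ : Finset (Fin (n + 1)) × Finset (Fin (n + 1)), Fin (n + 1) × Fin (n + 1)) →
      Σ _ : Finset (Fin (n + 1)) × Finset (Fin (n + 1)), Fin (n + 1) × Fin (n + 1) := fun q =>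
    if q.2.1 = u then
      ⟨(insert q.2.1 (q.1.2.erase q.2.2), insert q.2.2 (q.1.1.erase q.2.1)), q.2⟩
    else ⟨(insert q.2.2 (q.1.1.erase q.2.1), insert q.2.1 (q.1.2.erase q.2.2)), q.2.swap⟩
  have hins : ∀ {s : Finset (Fin (n + 1))} {x y : Fin (n + 1)}, x ∈ s → y ∉ s →
      (insert y (s.erase x)).erase y = s.erase x := fun {s x y} _ hy =>
    Finset.erase_insert fun h => hy (Finset.mem_of_mem_erase h)
  refine Finset.sum_involution (fun q _ => inv q) ?_ ?_ ?_ ?_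
  · rintro ⟨p, a, b⟩ hq
    obtain ⟨hp, hab⟩ := Finset.mem_sigma.1 hq
    obtain ⟨ha, hb⟩ := Finset.mem_product.1 hab
    obtain ⟨-, ⟨h3, -⟩, -⟩ := mem_oppositePairs.1 hp
    have hb1 := Finset.disjoint_right.1 h3 hb
    have ha2 := Finset.disjoint_left.1 h3 ha
    dsimp only at ha hb hb1 ha2
    by_cases hau : a = u
    · simp only [inv, if_pos hau, hins hb ha2, hins ha hb1]
      rw [hB, ZModModule.add_self]
    · simp only [inv, if_neg hau, Prod.fst_swap, Prod.snd_swap, hins hb ha2, hins ha hb1]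
      rw [ZModModule.add_self]
  · rintro ⟨p, a, b⟩ hq _ he
    obtain ⟨hp, hab⟩ := Finset.mem_sigma.1 hq
    obtain ⟨ha, hb⟩ := Finset.mem_product.1 hab
    obtain ⟨-, ⟨h3, h4, -⟩, -⟩ := mem_oppositePairs.1 hp
    dsimp only at ha hb
    by_cases hau : a = u
    · simp only [inv, if_pos hau] at he
      have h6 : insert a (p.2.erase b) = p.1 := congrArg (fun q => q.1.1) he
      have h7 : p.1 ⊆ {a} := fun x hx => by
        have hx' := hx
        rw [← h6, Finset.mem_insert] at hx'
        rcases hx' with rfl | hx'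
        · exact Finset.mem_singleton_self _
        · exact absurd (Finset.mem_of_mem_erase hx') (Finset.disjoint_left.1 h3 hx)
      have h8 := Finset.card_le_card h7
      rw [Finset.card_singleton] at h8
      dsimp only at h4
      omega
    · simp only [inv, if_neg hau] at he
      have h6 : b = a := congrArg (fun q => q.2.1) he
      rw [h6] at hb
      exact Finset.disjoint_left.1 h3 ha hb
  · rintro ⟨p, a, b⟩ hq
    obtain ⟨hp, hab⟩ := Finset.mem_sigma.1 hq
    obtain ⟨ha, hb⟩ := Finset.mem_product.1 hab
    dsimp only at ha hb
    obtain ⟨hp', hu⟩ := Finset.mem_filter.1 hp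
    have h1 := exchange_mem hp' ha hb
    by_cases hau : a = u
    · simp only [inv, if_pos hau]
      obtain ⟨⟨h1, h2⟩, h3, h4, h5⟩ := mem_joinCells.1 h1
      refine Finset.mem_sigma.2 ⟨Finset.mem_filter.2 ⟨mem_joinCells.2 ⟨⟨h2, h1⟩, h3.symm, h5, h4⟩,
        ?_⟩, Finset.mem_product.2 ⟨Finset.mem_insert_self _ _, Finset.mem_insert_self _ _⟩⟩
      rw [hau]
      exact Finset.mem_insert_self _ _
    · simp only [inv, if_neg hau]
      exact Finset.mem_sigma.2 ⟨Finset.mem_filter.2 ⟨h1, Finset.mem_insert_of_mem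
        (Finset.mem_erase.2 ⟨Ne.symm hau, hu⟩)⟩, Finset.mem_product.2
          ⟨Finset.mem_insert_self _ _, Finset.mem_insert_self _ _⟩⟩
  · rintro ⟨p, a, b⟩ hq
    obtain ⟨hp, hab⟩ := Finset.mem_sigma.1 hq
    obtain ⟨ha, hb⟩ := Finset.mem_product.1 hab
    obtain ⟨-, ⟨h3, -⟩, hu⟩ := mem_oppositePairs.1 hp
    have hb1 := Finset.disjoint_right.1 h3 hb
    have ha2 := Finset.disjoint_left.1 h3 ha
    have hbu : b ≠ u := by rintro rfl; exact hb1 hu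
    dsimp only at ha hb hb1 ha2
    by_cases hau : a = u
    · simp only [inv, if_pos hau, hins hb ha2, hins ha hb1, Finset.insert_erase ha,
        Finset.insert_erase hb]
    · simp only [inv, if_neg hau, if_neg hbu, Prod.fst_swap, Prod.snd_swap, Prod.swap_swap,
        hins hb ha2, hins ha hb1, Finset.insert_erase ha, Finset.insert_erase hb]

/-- Each pair in `halfCells k V u v` one of whose simplices contains `v` arises from a pair of
simplices which avoid `v`, by the exchange of a vertex for `v`. -/
theorem sum_halfCells {V : Finset (Fin (n + 1))} (hV : V.card = 2 * k + 3) {u v : Fin (n + 1)}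
    (hu : u ∈ V) (hv : v ∈ V) (huv : u ≠ v)
    (f : Finset (Fin (n + 1)) → Finset (Fin (n + 1)) → ZMod 2) :
    ∑ p ∈ halfCells k V u v, f p.1 p.2 = ∑ p ∈ oppositePairs k V u v, (f p.1 p.2 +
      ∑ b ∈ p.2, f p.1 (insert v (p.2.erase b)) + ∑ a ∈ p.1, f (insert v (p.1.erase a)) p.2) := by
  have hhalf : ∀ {p : Finset (Fin (n + 1)) × Finset (Fin (n + 1))}, p ∈ halfCells k V u v ↔
      ((p.1 ⊆ V ∧ p.2 ⊆ V) ∧ Disjoint p.1 p.2 ∧ p.1.card = k + 1 ∧ p.2.card = k + 1) ∧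
        (u ∈ p.1 ∨ u ∉ p.2 ∧ v ∈ p.1) := fun {p} => by
    rw [halfCells, Finset.mem_filter, mem_joinCells]
  have hmiss : ∀ p ∈ joinCells k V, ∃ o ∈ V, o ∉ p.1 ∧ o ∉ p.2 := fun p hp => by
    have h1 : p.1 ∪ p.2 ⊆ V := Finset.union_subset (mem_joinCells.1 hp).1.1 (mem_joinCells.1 hp).1.2
    obtain ⟨o, ho⟩ := Finset.card_pos.1 (show 0 < (V \ (p.1 ∪ p.2)).card by
      rw [Finset.card_sdiff_of_subset h1, card_union_joinCell hp]; omega)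
    exact ⟨o, by simpa using ho⟩
  have herase : ∀ {s : Finset (Fin (n + 1))} {i j : Fin (n + 1)}, i ∈ s → s.erase i = s.erase j →
      i = j := fun {s i j} hi h => by
    by_contra hne
    have : i ∈ s.erase j := Finset.mem_erase.2 ⟨hne, hi⟩
    rw [← h] at this
    exact Finset.notMem_erase i s this
  rw [← Finset.sum_filter_add_sum_filter_not (halfCells k V u v) (fun p => v ∈ p.1), add_comm,
    Finset.sum_add_distrib]
  congr 1
  · rw [← Finset.sum_filter_add_sum_filter_not _ (fun p => v ∈ p.2), add_comm,
      Finset.sum_add_distrib]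
    congr 1
    · refine Finset.sum_congr ?_ fun _ _ => rfl
      ext p
      rw [Finset.mem_filter, Finset.mem_filter, hhalf, mem_oppositePairs]
      tauto
    · rw [Finset.sum_sigma']
      refine (Finset.sum_bij (fun q _ => (q.1.1, insert v (q.1.2.erase q.2))) ?_ ?_ ?_
        fun _ _ => rfl).symm
      · rintro ⟨p, b⟩ hq
        obtain ⟨hp, hb⟩ := Finset.mem_sigma.1 hq
        dsimp only at hb
        obtain ⟨⟨⟨h1, hv1⟩, h2, hv2⟩, ⟨h3, h4, h5⟩, hup⟩ := mem_oppositePairs.1 hp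
        refine Finset.mem_filter.2 ⟨Finset.mem_filter.2 ⟨hhalf.2 ⟨⟨⟨h1, Finset.insert_subset hv
          ((Finset.erase_subset _ _).trans h2)⟩, ?_, h4, ?_⟩, Or.inl hup⟩, hv1⟩,
            Finset.mem_insert_self _ _⟩
        · exact Finset.disjoint_insert_right.2 ⟨hv1, h3.mono_right (Finset.erase_subset _ _)⟩
        · rw [Finset.card_insert_of_notMem fun h => hv2 (Finset.mem_of_mem_erase h),
            Finset.card_erase_add_one hb, h5]
      · rintro ⟨p, b⟩ hq ⟨p', b'⟩ hq' he
        obtain ⟨hp, hb⟩ := Finset.mem_sigma.1 hq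
        obtain ⟨hp', hb'⟩ := Finset.mem_sigma.1 hq'
        obtain ⟨e1, e2⟩ := Prod.mk.inj he
        dsimp only at hb hb' e1 e2
        obtain ⟨⟨-, -, hv2⟩, ⟨h3, -⟩, -⟩ := mem_oppositePairs.1 hp
        obtain ⟨⟨-, -, hv2'⟩, ⟨h3', -⟩, -⟩ := mem_oppositePairs.1 hp'
        have e3 : p.2 = p'.2 := by
          rw [← Finset.union_sdiff_cancel_left h3, ← Finset.union_sdiff_cancel_left h3',
            oppositePairs_union hV hv hp, oppositePairs_union hV hv hp', e1]
        have e4 : p = p' := Prod.ext e1 e3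
        subst e4
        have e5 : p.2.erase b = p.2.erase b' := by
          rw [← Finset.erase_insert (a := v) (s := p.2.erase b)
            fun h => hv2 (Finset.mem_of_mem_erase h), e2,
            Finset.erase_insert fun h => hv2 (Finset.mem_of_mem_erase h)]
        rw [herase hb e5]
      · rintro ⟨σ, τ⟩ hp
        obtain ⟨hp, hvτ⟩ := Finset.mem_filter.1 hp
        obtain ⟨hp, hvσ⟩ := Finset.mem_filter.1 hp
        obtain ⟨o, hoV, ho1, ho2⟩ := hmiss _ (halfCells_subset hp)
        obtain ⟨⟨⟨h1, h2⟩, h3, h4, h5⟩, hup⟩ := hhalf.1 hp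
        dsimp only at *
        have hvo : v ≠ o := by rintro rfl; exact ho2 hvτ
        have hoe : o ∉ τ.erase v := fun h => ho2 (Finset.mem_of_mem_erase h)
        refine ⟨⟨(σ, insert o (τ.erase v)), o⟩, Finset.mem_sigma.2 ⟨mem_oppositePairs.2
          ⟨⟨⟨h1, hvσ⟩, Finset.insert_subset hoV ((Finset.erase_subset _ _).trans h2), ?_⟩,
            ⟨?_, h4, ?_⟩, ?_⟩, Finset.mem_insert_self _ _⟩, ?_⟩
        · simp [hvo]
        · exact Finset.disjoint_insert_right.2 ⟨ho1, h3.mono_right (Finset.erase_subset _ _)⟩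
        · rw [Finset.card_insert_of_notMem hoe, Finset.card_erase_add_one hvτ, h5]
        · exact hup.resolve_right fun h => hvσ h.2
        · dsimp only
          rw [Finset.erase_insert hoe, Finset.insert_erase hvτ]
  · rw [Finset.sum_sigma']
    refine (Finset.sum_bij (fun q _ => (insert v (q.1.1.erase q.2), q.1.2)) ?_ ?_ ?_
      fun _ _ => rfl).symm
    · rintro ⟨p, a⟩ hq
      obtain ⟨hp, ha⟩ := Finset.mem_sigma.1 hq
      dsimp only at ha
      obtain ⟨⟨⟨h1, hv1⟩, h2, hv2⟩, ⟨h3, h4, h5⟩, hup⟩ := mem_oppositePairs.1 hp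
      refine Finset.mem_filter.2 ⟨hhalf.2 ⟨⟨⟨Finset.insert_subset hv
        ((Finset.erase_subset _ _).trans h1), h2⟩, ?_, ?_, h5⟩,
          Or.inr ⟨Finset.disjoint_left.1 h3 hup, Finset.mem_insert_self _ _⟩⟩,
            Finset.mem_insert_self _ _⟩
      · exact Finset.disjoint_insert_left.2 ⟨hv2, h3.mono_left (Finset.erase_subset _ _)⟩
      · rw [Finset.card_insert_of_notMem fun h => hv1 (Finset.mem_of_mem_erase h),
          Finset.card_erase_add_one ha, h4]
    · rintro ⟨p, a⟩ hq ⟨p', a'⟩ hq' he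
      obtain ⟨hp, ha⟩ := Finset.mem_sigma.1 hq
      obtain ⟨hp', ha'⟩ := Finset.mem_sigma.1 hq'
      obtain ⟨e1, e2⟩ := Prod.mk.inj he
      dsimp only at ha ha' e1 e2
      obtain ⟨⟨⟨-, hv1⟩, -⟩, ⟨h3, -⟩, -⟩ := mem_oppositePairs.1 hp
      obtain ⟨⟨⟨-, hv1'⟩, -⟩, ⟨h3', -⟩, -⟩ := mem_oppositePairs.1 hp'
      have e3 : p.1 = p'.1 := by
        rw [← Finset.union_sdiff_cancel_right h3, ← Finset.union_sdiff_cancel_right h3',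
          oppositePairs_union hV hv hp, oppositePairs_union hV hv hp', e2]
      have e4 : p = p' := Prod.ext e3 e2
      subst e4
      have e5 : p.1.erase a = p.1.erase a' := by
        rw [← Finset.erase_insert (a := v) (s := p.1.erase a)
          fun h => hv1 (Finset.mem_of_mem_erase h), e1,
          Finset.erase_insert fun h => hv1 (Finset.mem_of_mem_erase h)]
      rw [herase ha e5]
    · rintro ⟨σ, τ⟩ hp
      obtain ⟨hp, hvσ⟩ := Finset.mem_filter.1 hp
      have hp' := halfCells_subset hp
      obtain ⟨o, hoV, ho1, ho2⟩ := hmiss _ hp'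
      obtain ⟨⟨⟨h1, h2⟩, h3, h4, h5⟩, hup⟩ := hhalf.1 hp
      have huo : u ∈ σ ∨ u = o := by
        rcases hup with h | h
        · exact Or.inl h
        · by_contra! hcon
          exact (mem_or_mem_of_joinCell hV hp' hoV hu hcon.2.symm ho1 ho2).elim hcon.1 h.1
      dsimp only at *
      have hvo : v ≠ o := by rintro rfl; exact ho1 hvσ
      have hoe : o ∉ σ.erase v := fun h => ho1 (Finset.mem_of_mem_erase h)
      refine ⟨⟨(insert o (σ.erase v), τ), o⟩, Finset.mem_sigma.2 ⟨mem_oppositePairs.2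
        ⟨⟨⟨Finset.insert_subset hoV ((Finset.erase_subset _ _).trans h1), ?_⟩, h2,
          Finset.disjoint_left.1 h3 hvσ⟩, ⟨?_, ?_, h5⟩, ?_⟩, Finset.mem_insert_self _ _⟩, ?_⟩
      · simp [hvo]
      · exact Finset.disjoint_insert_left.2 ⟨ho2, h3.mono_left (Finset.erase_subset _ _)⟩
      · rw [Finset.card_insert_of_notMem hoe, Finset.card_erase_add_one hvσ, h4]
      · rw [Finset.mem_insert, Finset.mem_erase]
        exact huo.symm.imp id fun h => ⟨huv, h⟩
      · dsimp only
        rw [Finset.erase_insert hoe, Finset.insert_erase hvσ]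

/-- The expansion of a symmetric bilinear form on the boundaries of the cones with apex `v` over the
pairs of complementary simplices. -/
theorem sum_boundary_cone (hk : 1 ≤ k) {V : Finset (Fin (n + 1))} (hV : V.card = 2 * k + 3)
    {u v : Fin (n + 1)} (hu : u ∈ V) (hv : v ∈ V) (huv : u ≠ v)
    {B : Finset (Fin (n + 1)) → Finset (Fin (n + 1)) → ZMod 2} (hB : ∀ σ τ, B σ τ = B τ σ) :
    ∑ p ∈ oppositePairs k V u v, ∑ a ∈ insert v p.1, ∑ b ∈ insert v p.2,
      B ((insert v p.1).erase a) ((insert v p.2).erase b) = ∑ p ∈ halfCells k V u v, B p.1 p.2 := by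
  rw [sum_halfCells hV hu hv huv B, ← add_zero (∑ p ∈ oppositePairs k V u v, (_ + _)),
    ← sum_facets_containing (V := V) (u := u) (v := v) hk hB, ← Finset.sum_add_distrib]
  refine Finset.sum_congr rfl fun p hp => ?_
  obtain ⟨⟨⟨-, hv1⟩, -, hv2⟩, -, -⟩ := mem_oppositePairs.1 hp
  have hne : ∀ {s : Finset (Fin (n + 1))}, v ∉ s → ∀ a ∈ s,
      (insert v s).erase a = insert v (s.erase a) := fun {s} hvs a ha =>
    Finset.erase_insert_of_ne (by rintro rfl; exact hvs ha)
  have h1 : ∀ s, ∑ b ∈ insert v p.2, B s ((insert v p.2).erase b) =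
      B s p.2 + ∑ b ∈ p.2, B s (insert v (p.2.erase b)) := fun s => by
    rw [Finset.sum_insert hv2, Finset.erase_insert hv2]
    congr 1
    exact Finset.sum_congr rfl fun b hb => by rw [hne hv2 b hb]
  have h2 : ∑ a ∈ p.1, ∑ b ∈ insert v p.2, B ((insert v p.1).erase a) ((insert v p.2).erase b) =
      ∑ a ∈ p.1, (B (insert v (p.1.erase a)) p.2 +
        ∑ b ∈ p.2, B (insert v (p.1.erase a)) (insert v (p.2.erase b))) :=
    Finset.sum_congr rfl fun a ha => by rw [hne hv1 a ha, h1]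
  rw [Finset.sum_insert hv1, Finset.erase_insert hv1, h1, h2, Finset.sum_add_distrib]
  ring

/-! ### The intersection form on the boundaries of simplices -/

/-- A `k`-simplex as a chain; other simplices are sent to zero. -/
noncomputable def kchain (k : ℕ) (σ : Finset (Fin (n + 1))) : KChain n k :=
  if h : σ.card = k + 1 then single ⟨σ, h⟩ 1 else 0

theorem boundary_eq_sum (κ : Finset (Fin (n + 1))) :
    boundary k κ = ∑ x ∈ κ, kchain k (κ.erase x) := rfl

theorem kchain_eq (σ : KSimplex n k) : kchain k σ.1 = single σ 1 := dif_pos σ.2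

theorem bilin_boundary {H : Type*} [AddCommGroup H] [Module (ZMod 2) H]
    (Ω : LinearMap.BilinForm (ZMod 2) H) (ψ : KChain n k →ₗ[ZMod 2] H)
    (κ κ' : Finset (Fin (n + 1))) :
    Ω (ψ (boundary k κ)) (ψ (boundary k κ')) =
      ∑ x ∈ κ, ∑ y ∈ κ', Ω (ψ (kchain k (κ.erase x))) (ψ (kchain k (κ'.erase y))) := by
  simp only [boundary_eq_sum, map_sum, LinearMap.sum_apply]
  exact Finset.sum_comm

/-- The unordered pairs of disjoint simplices which avoid `v` are ordered by the position of `u`. -/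
theorem sum_pairs {V : Finset (Fin (n + 1))} (hV : V.card = 2 * k + 3) {u v : Fin (n + 1)}
    (hu : u ∈ V) (hv : v ∈ V) (huv : u ≠ v) (f : Sym2 (KSimplex n k) → ZMod 2)
    (f' : Finset (Fin (n + 1)) → Finset (Fin (n + 1)) → ZMod 2)
    (hf : ∀ σ τ : KSimplex n k, f s(σ, τ) = f' σ.1 τ.1) :
    ∑ p ∈ pairs k V v, f p = ∑ p ∈ oppositePairs k V u v, f' p.1 p.2 := by
  refine (Finset.sum_bij (fun p hp => s(⟨p.1, (mem_oppositePairs.1 hp).2.1.2.1⟩,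
    ⟨p.2, (mem_oppositePairs.1 hp).2.1.2.2⟩)) ?_ ?_ ?_ fun p hp =>
      (hf ⟨p.1, (mem_oppositePairs.1 hp).2.1.2.1⟩
        ⟨p.2, (mem_oppositePairs.1 hp).2.1.2.2⟩).symm).symm
  · intro p hp
    obtain ⟨⟨⟨h1, hv1⟩, h2, hv2⟩, ⟨h3, h4, h5⟩, -⟩ := mem_oppositePairs.1 hp
    exact Finset.mem_filter.2 ⟨Finset.mem_univ _, _, _, rfl, h3, h1, h2, hv1, hv2⟩
  · intro p hp p' hp' he
    obtain ⟨-, ⟨h3, -⟩, hup⟩ := mem_oppositePairs.1 hp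
    obtain ⟨-, -, hup'⟩ := mem_oppositePairs.1 hp'
    rcases Sym2.eq_iff.1 he with ⟨e1, e2⟩ | ⟨-, e2⟩
    · exact Prod.ext (congrArg Subtype.val e1) (congrArg Subtype.val e2)
    · have e2 : p.2 = p'.1 := congrArg Subtype.val e2
      rw [← e2] at hup'
      exact absurd hup' (Finset.disjoint_left.1 h3 hup)
  · intro q hq
    obtain ⟨-, σ, τ, rfl, h3, h1, h2, hv1, hv2⟩ := Finset.mem_filter.1 hq
    have hunion : σ.1 ∪ τ.1 = V.erase v := by
      refine Finset.eq_of_subset_of_card_le (Finset.union_subset (Finset.subset_erase.2 ⟨h1, hv1⟩)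
        (Finset.subset_erase.2 ⟨h2, hv2⟩)) ?_
      rw [Finset.card_union_of_disjoint h3, Finset.card_erase_of_mem hv, hV, σ.2, τ.2]
      omega
    have huστ : u ∈ σ.1 ∪ τ.1 := by rw [hunion]; exact Finset.mem_erase.2 ⟨huv, hu⟩
    rcases Finset.mem_union.1 huστ with h | h
    · exact ⟨(σ.1, τ.1), mem_oppositePairs.2 ⟨⟨⟨h1, hv1⟩, h2, hv2⟩, ⟨h3, σ.2, τ.2⟩, h⟩, rfl⟩
    · exact ⟨(τ.1, σ.1), mem_oppositePairs.2 ⟨⟨⟨h2, hv2⟩, h1, hv1⟩, ⟨h3.symm, τ.2, σ.2⟩, h⟩,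
        Sym2.eq_swap⟩

end VanKampen

theorem mainTheorem11 (k n : ℕ) (hk : 1 ≤ k)
    {M : Type*} [TopologicalSpace M] [T2Space M] [ChartedSpace (EuclideanSpace ℝ (Fin (2 * k))) M]
    (hM : CompactSpace M ∨ Nonempty (M ≃ₜ EuclideanSpace ℝ (Fin (2 * k))))
    (ψ : KChain n k →ₗ[ZMod 2] singularHomology M k)
    (g : (Fin (n + 1) → ℝ) → EuclideanSpace ℝ (Fin (2 * k))) (hg : IsGeneralPosition n k g)
    (h : cohomologyClass n k (Phi n k (2 * k) (omegaCochain ψ)) +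
      cohomologyClass n k (Phi n k (2 * k) (thetaCochain g)) = 0) :
    (∀ κ κ' : Finset (Fin (n + 1)), κ.card = k + 2 → κ'.card = k + 2 → Disjoint κ κ' →
      intersectionForm M k (ψ (boundary k κ)) (ψ (boundary k κ')) = 0) ∧
    (∀ V : Finset (Fin (n + 1)), V.card = 2 * k + 3 → ∀ v ∈ V,
      ∑ p ∈ pairs k V v, pairValue ψ v p = 1) := by
  rw [← map_add, Submodule.mkQ_apply, Submodule.Quotient.mk_eq_zero] at h
  obtain ⟨c, hc⟩ := h
  let B : Finset (Fin (n + 1)) → Finset (Fin (n + 1)) → ZMod 2 := fun σ τ =>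
    intersectionForm M k (ψ (kchain k σ)) (ψ (kchain k τ))
  let θ : Finset (Fin (n + 1)) → Finset (Fin (n + 1)) → ZMod 2 := fun σ τ =>
    ((g '' geomSimplex σ ∩ g '' geomSimplex τ).ncard : ZMod 2)
  have hBsymm : ∀ σ τ, B σ τ = B τ σ := fun σ τ => intersectionForm_symm M k _ _
  have hcob : ∀ σ τ, Disjoint σ τ → σ.card = k + 1 → τ.card = k + 1 →
      B σ τ + θ σ τ = ∑ i ∈ σ, cochainOn c (σ.erase i) τ + ∑ j ∈ τ, cochainOn c σ (τ.erase j) := by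
    intro σ τ hd hσ hτ
    let p : Cell n k (2 * k) := ⟨(σ, τ), Finset.card_pos.1 (by rw [hσ]; omega),
      Finset.card_pos.1 (by rw [hτ]; omega), hσ.le, hτ.le, hd, by rw [hσ, hτ]; ring⟩
    have h1 : Phi n k (2 * k) (omegaCochain ψ) (Quotient.mk _ p) = B σ τ := by
      change intersectionForm M k (ψ (Finsupp.single p.fst 1)) (ψ (Finsupp.single p.snd 1)) = _
      rw [← kchain_eq, ← kchain_eq]
      rfl
    have h2 : Phi n k (2 * k) (thetaCochain g) (Quotient.mk _ p) = θ σ τ := rfl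
    rw [← coboundary_mk hk c p, hc, Pi.add_apply, h1, h2]
  constructor
  · intro κ κ' hκ hκ' hd
    have h1 := sum_coboundary_boundary (cochainOn_symm c) hcob hκ hκ' hd
    have h2 := sum_ncard_boundary hg hκ hκ' hd
    simp only [Finset.sum_add_distrib] at h1
    rw [show (∑ x ∈ κ, ∑ y ∈ κ', θ (κ.erase x) (κ'.erase y)) = 0 from h2, add_zero] at h1
    rw [bilin_boundary]
    exact h1
  · intro V hV v hv
    obtain ⟨u, hu⟩ : (V.erase v).Nonempty := Finset.card_pos.1 (by
      rw [Finset.card_erase_of_mem hv, hV]; omega)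
    obtain ⟨huv, hu⟩ := Finset.mem_erase.1 hu
    have h1 := sum_coboundary_halfCells (cochainOn_symm c) hcob hV hu hv huv
    have h2 := sum_ncard_halfCells hk hg hV hu hv huv
    rw [Finset.sum_add_distrib, show (∑ p ∈ halfCells k V u v, θ p.1 p.2) = 1 from h2,
      ← ZModModule.sub_eq_add, sub_eq_zero] at h1
    rw [← h1, ← sum_boundary_cone hk hV hu hv huv hBsymm]
    exact sum_pairs hV hu hv huv _ (fun σ τ => ∑ a ∈ insert v σ, ∑ b ∈ insert v τ,
      B ((insert v σ).erase a) ((insert v τ).erase b)) fun σ τ => bilin_boundary _ ψ _ _
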